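/- **Setting.** Recursive types are given by $\tau ::= X \mid \bot \mid \top \mid \tau_1\to\tau_2 \mid \mu X.\,\tau_1\to\tau_2$, up to renaming of bound variables. Subtyping has the axioms $\bot\le\tau$; $\tau\le\top$; $\tau\le\tau$; $\mu X.\tau_1\to\tau_2\le[\mu X.\tau_1\to\tau_2/X](\tau_1\to\tau_2)$ (unfold); its converse (fold); the coinductive rule (arr) deriving $\sigma_1\to\sigma_2\le\tau_1\to\tau_2$ from $\tau_1\le\sigma_1$ and $\sigma_2\le\tau_2$; and the inductive rule (trans) deriving $\tau_1\le\tau_3$ from $\tau_1\le\tau_2$ and $\tau_2\le\tau_3$. A *valid cyclic derivation* of $\sigma\le\tau$ consists of finitely many named derivations $r_i = D_i$ of judgments $\sigma_i\le\tau_i$ and a main derivation of $\sigma\le\tau$. These are finite trees built by the rules whose leaves may also be references to the names $r_i$; each $D_i$ ends in a rule, and every cycle of references passes through an application of (arr). Two cyclic derivations of $\sigma\le\tau$ are identified when they unfold to the same infinite derivation. CoLF is the logical framework of canonical forms with kinds $\mathsf{type}$ (inductive) and $\mathsf{cotype}$ (coinductive), ordinary variables $x:A$ and prepattern variables $x\mathrel{\hat:}A$,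 whose signatures may contain mutually recursive definitions $r:A=M$. Here $A$ has only prepattern abstractions, $M$ has a constant or a variable as its head, every occurrence of $r$ is applied to prepattern variables only, and every trace from $r$ back to itself contains a coinductive constructor that has the highest priority on the trace (families declared later have higher priority). Let $\Sigma_0$ be the signature tp : type; bot : tp; top : tp; arr : tp → tp → tp; mu : (tp → tp) → (tp → tp) → tp; subtp : tp → tp → type; subtpinf : tp → tp → cotype; subtp/top : {T} subtp T top; subtp/bot : {T} subtp bot T; refl : {T} subtp T T; trans : {T1}{T2}{T3} subtp T1 T2 → subtp T2 T3 → subtp T1 T3; subtp/arr : {T1}{T2} subtpinf T1 T2 → subtp T1 T2; unfold : {T1}{T2} subtp (mu T1 T2) (arr (T1 (mu T1 T2)) (T2 (mu T1 T2))); fold : {T1}{T2} subtp (arr (T1 (mu T1 T2)) (T2 (mu T1 T2))) (mu T1 T2); inf/arr : {T1}{S1}{S2}{T2} subtp T1 S1 → subtp S2 T2 → subtpinf (arr S1 S2) (arr T1 T2). A *valid canonical term* of type $A$ in a context $\Gamma$ is a valid extension $\Sigma$ of $\Sigma_0$ by finitely many recursive definitions together with a canonical term $M$ such that $\Gamma\vdash_\Sigma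 M\Leftarrow A$. Canonical terms are identified when they expand to the same Böhm tree. **Theorem (Adequacy of the encoding of classical subtyping).** (1) For every context $\Gamma$ that declares $n$ variables $x_1,\dots,x_n$ of type tp, each ordinary or prepattern, the encoding $\ulcorner X_i\urcorner=x_i$, $\ulcorner\bot\urcorner=\mathsf{bot}$, $\ulcorner\top\urcorner=\mathsf{top}$, $\ulcorner\sigma\to\tau\urcorner=\mathsf{arr}\,\ulcorner\sigma\urcorner\,\ulcorner\tau\urcorner$, $\ulcorner\mu X.\sigma\to\tau\urcorner=\mathsf{mu}\,(\lambda x.\ulcorner\sigma\urcorner)\,(\lambda x.\ulcorner\tau\urcorner)$ is a bijection between the recursive types with free variables among $X_1,\dots,X_n$ and the valid canonical terms of type tp in $\Gamma$. It is compositional: if $M$ and $N$, over the same signature, represent $\sigma$ and $\tau$ and $x$ is an ordinary variable, then the hereditary substitution $[N/x]M$ is defined, is again a valid canonical term of type tp, and represents $[\tau/X]\sigma$; and a renaming of variables that sends prepattern variables to prepattern variables, applied to $M$, represents the renamed type. (2) For all recursive types $\sigma,\tau$ with free variables among $X_1,\dots,X_n$, the encoding that sends each rule to the constructor of the same name, with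 the types of its instance as the explicit arguments (an application of (arr) becoming $\mathsf{subtp/arr}$ applied to $\mathsf{inf/arr}$), and that sends each named derivation $r_i = D_i$ of $\sigma_i\le\tau_i$ to the recursive definition $r_i:\Pi\hat x_1{:}\mathsf{tp}\dots\Pi\hat x_n{:}\mathsf{tp}.\,\mathsf{subtp}\,\ulcorner\sigma_i\urcorner\,\ulcorner\tau_i\urcorner=\lambda x_1\dots x_n.\,\ulcorner D_i\urcorner$ and a reference to it to $r_i\cdot([x_1];\dots;[x_n])$, is a bijection between the valid cyclic derivations of $\sigma\le\tau$ and the valid canonical terms of type $\mathsf{subtp}\,\ulcorner\sigma\urcorner\,\ulcorner\tau\urcorner$ in the context $x_1\mathrel{\hat:}\mathsf{tp},\dots,x_n\mathrel{\hat:}\mathsf{tp}$ (for closed types: in the empty context). It is compositional: it commutes with renaming of the variables. -/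

import Mathlib

namespace CoLF

/-! # The framework: syntax

All syntax is well scoped and nameless: `Tm n` is the set of terms whose free variables are among `n`
variables, the variable `0 : Fin n` being the innermost one, so that terms are identified up to
renaming of bound variables. Constants are named by their position in the signature. -/

/-- Ordinary (`x : A`) and prepattern (`x :^ A`) binding. -/
inductive Mode : Type
  | ord
  | pre

/-- Heads: variables, constructors, recursion constants. -/
inductive Head (n : ℕ) : Type
  | var (x : Fin n)
  | con (c : ℕ)
  | rc (r : ℕ)

mutual
/-- Canonical terms `M ::= λ x. M | H · S`. -/
inductive Tm : ℕ → Type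
  | lam {n : ℕ} (M : Tm (n + 1)) : Tm n
  | neu {n : ℕ} (H : Head n) (S : Spine n) : Tm n
/-- Spines `S ::= () | M ; S | [x] ; S`. -/
inductive Spine : ℕ → Type
  | nil {n : ℕ} : Spine n
  | app {n : ℕ} (M : Tm n) (S : Spine n) : Spine n
  | papp {n : ℕ} (x : Fin n) (S : Spine n) : Spine n
end

/-- Canonical types `A ::= a · S | Π x : A. B | Π x :^ A. B`. -/
inductive Ty : ℕ → Type
  | atom {n : ℕ} (a : ℕ) (S : Spine n) : Ty n
  | pi {n : ℕ} (m : Mode) (A : Ty n) (B : Ty (n + 1)) : Ty n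

/-- Kinds `K ::= type | cotype | Π x : A. K | Π x :^ A. K`. -/
inductive Kd : ℕ → Type
  | type {n : ℕ} : Kd n
  | cotype {n : ℕ} : Kd n
  | pi {n : ℕ} (m : Mode) (A : Ty n) (K : Kd (n + 1)) : Kd n

/-- Contexts. -/
inductive Ctx : ℕ → Type
  | nil : Ctx 0
  | cons {n : ℕ} (Γ : Ctx n) (m : Mode) (A : Ty n) : Ctx (n + 1)

/-- Declarations `a : K`, `c : A`, `r : A = M`. -/
inductive Decl : Type
  | fam (K : Kd 0)
  | con (A : Ty 0)
  | defn (A : Ty 0) (M : Tm 0)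

/-- Signatures; the name of a declaration is its index in the list. -/
abbrev Sig : Type := List Decl

/-! ## Renaming substitution -/

/-- A renaming extended under a binder. -/
def liftRen {n m : ℕ} (ρ : Fin n → Fin m) : Fin (n + 1) → Fin (m + 1) :=
  Fin.cases 0 (fun i => (ρ i).succ)

/-- The renaming `[[y/x]]` for the innermost variable `x`. -/
def instRen {n : ℕ} (y : Fin n) : Fin (n + 1) → Fin n := Fin.cases y id

def Head.rename {n m : ℕ} (ρ : Fin n → Fin m) : Head n → Head m
  | .var x => .var (ρ x)
  | .con c => .con c
  | .rc r => .rc r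

mutual
def Tm.rename : {n : ℕ} → {m : ℕ} → (Fin n → Fin m) → Tm n → Tm m
  | _, _, ρ, .lam M => .lam (M.rename (liftRen ρ))
  | _, _, ρ, .neu H S => .neu (H.rename ρ) (S.rename ρ)
def Spine.rename : {n : ℕ} → {m : ℕ} → (Fin n → Fin m) → Spine n → Spine m
  | _, _, _, .nil => .nil
  | _, _, ρ, .app M S => .app (M.rename ρ) (S.rename ρ)
  | _, _, ρ, .papp x S => .papp (ρ x) (S.rename ρ)
end

def Ty.rename : {n : ℕ} → {m : ℕ} → (Fin n → Fin m) → Ty n → Ty m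
  | _, _, ρ, .atom a S => .atom a (S.rename ρ)
  | _, _, ρ, .pi p A B => .pi p (A.rename ρ) (B.rename (liftRen ρ))

def Kd.rename : {n : ℕ} → {m : ℕ} → (Fin n → Fin m) → Kd n → Kd m
  | _, _, _, .type => .type
  | _, _, _, .cotype => .cotype
  | _, _, ρ, .pi p A K => .pi p (A.rename ρ) (K.rename (liftRen ρ))

/-- Closed terms, types and kinds are used in every context. -/
def Tm.ofClosed {n : ℕ} (M : Tm 0) : Tm n := M.rename Fin.elim0
def Ty.ofClosed {n : ℕ} (A : Ty 0) : Ty n := A.rename Fin.elim0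
def Kd.ofClosed {n : ℕ} (K : Kd 0) : Kd n := K.rename Fin.elim0

/-- The binding mode and the type of a variable. -/
def Ctx.get : {n : ℕ} → Ctx n → Fin n → Mode × Ty n
  | _, .cons Γ m A, i =>
      Fin.cases (m, A.rename Fin.succ) (fun j => ((Γ.get j).1, (Γ.get j).2.rename Fin.succ)) i

/-! ## Hereditary substitution -/

/-- Simple types. -/
inductive STy : Type
  | star
  | arr (τ₂ τ₁ : STy)

/-- The erasure of a type. -/
def Ty.erase : {n : ℕ} → Ty n → STy
  | _, .atom _ _ => .star
  | _, .pi .ord A B => .arr A.erase B.erase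
  | _, .pi .pre _ B => .arr .star B.erase

/-- Replacing one variable out of `k` is described by a map `θ : Fin k → Option (Fin n)`, sending the
replaced variable to `none` and every other variable to its name among the remaining ones. This is
the map under a binder. -/
def liftOpt {k n : ℕ} (θ : Fin k → Option (Fin n)) : Fin (k + 1) → Option (Fin (n + 1)) :=
  Fin.cases (some 0) (fun i => (θ i).map Fin.succ)

mutual
/-- `[N/x] M`, where `red S N` stands for `S ▷ N` at the simple type of `N`. -/
def Tm.hsubWith (red : (n : ℕ) → Spine n → Tm n → Option (Tm n)) :
    {k : ℕ} → {n : ℕ} → (Fin k → Option (Fin n)) → Tm n → Tm k → Option (Tm n)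
  | _, _, θ, N, .lam M => (Tm.hsubWith red (liftOpt θ) (N.rename Fin.succ) M).map .lam
  | _, n, θ, N, .neu (.var y) S =>
      (Spine.hsubWith red θ N S).bind fun S' =>
        match θ y with
        | none => red n S' N
        | some y' => some (.neu (.var y') S')
  | _, _, θ, N, .neu (.con c) S => (Spine.hsubWith red θ N S).map (.neu (.con c))
  | _, _, θ, N, .neu (.rc r) S => (Spine.hsubWith red θ N S).map (.neu (.rc r))
def Spine.hsubWith (red : (n : ℕ) → Spine n → Tm n → Option (Tm n)) :
    {k : ℕ} → {n : ℕ} → (Fin k → Option (Fin n)) → Tm n → Spine k → Option (Spine n)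
  | _, _, _, _, .nil => some .nil
  | _, _, θ, N, .app M S =>
      (Tm.hsubWith red θ N M).bind fun M' => (Spine.hsubWith red θ N S).map (.app M')
  | _, _, θ, N, .papp z S =>
      (θ z).bind fun z' => (Spine.hsubWith red θ N S).map (.papp z')
end

/-- The map describing the replacement of the innermost variable. -/
def theta0 {n : ℕ} : Fin (n + 1) → Option (Fin n) := Fin.cases none some

/-- `S ▷^τ N`. -/
def reduce : STy → (n : ℕ) → Spine n → Tm n → Option (Tm n)
  | .star, _, .nil, .neu H S => some (.neu H S)
  | .arr τ₂ τ₁, n, .app N S, .lam M =>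
      (Tm.hsubWith (reduce τ₂) theta0 N M).bind fun M' => reduce τ₁ n S M'
  | .arr .star τ₁, n, .papp y S, .lam M => reduce τ₁ n S (M.rename (instRen y))
  | _, _, _, _ => none

/-- `[N/x]^τ M`; the variable `x` is the one that `θ` maps to `none`. -/
def Tm.hsub {k n : ℕ} (τ : STy) (θ : Fin k → Option (Fin n)) (N : Tm n) (M : Tm k) :
    Option (Tm n) :=
  Tm.hsubWith (reduce τ) θ N M

def Spine.hsub {k n : ℕ} (τ : STy) (θ : Fin k → Option (Fin n)) (N : Tm n) (S : Spine k) :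
    Option (Spine n) :=
  Spine.hsubWith (reduce τ) θ N S

def Ty.hsub (τ : STy) : {k : ℕ} → {n : ℕ} → (Fin k → Option (Fin n)) → Tm n → Ty k → Option (Ty n)
  | _, _, θ, N, .atom a S => (Spine.hsub τ θ N S).map (.atom a)
  | _, _, θ, N, .pi m A B =>
      (Ty.hsub τ θ N A).bind fun A' =>
        (Ty.hsub τ (liftOpt θ) (N.rename Fin.succ) B).map (.pi m A')

def Kd.hsub (τ : STy) : {k : ℕ} → {n : ℕ} → (Fin k → Option (Fin n)) → Tm n → Kd k → Option (Kd n)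
  | _, _, _, _, .type => some .type
  | _, _, _, _, .cotype => some .cotype
  | _, _, θ, N, .pi m A K =>
      (Ty.hsub τ θ N A).bind fun A' =>
        (Kd.hsub τ (liftOpt θ) (N.rename Fin.succ) K).map (.pi m A')

/-! ## Prepattern and contractiveness conditions -/

inductive Spine.Prepat : {n : ℕ} → Spine n → Prop
  | nil {n : ℕ} : Spine.Prepat (.nil : Spine n)
  | papp {n : ℕ} {x : Fin n} {S : Spine n} : S.Prepat → Spine.Prepat (.papp x S)

inductive Ty.Prepat : {n : ℕ} → Ty n → Prop
  | atom {n a : ℕ} {S : Spine n} : Ty.Prepat (.atom a S)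
  | pi {n : ℕ} {A : Ty n} {B : Ty (n + 1)} : B.Prepat → Ty.Prepat (.pi .pre A B)

/-- The head of the term is a constructor or a variable. -/
inductive Tm.Contra : {n : ℕ} → Tm n → Prop
  | lam {n : ℕ} {M : Tm (n + 1)} : M.Contra → Tm.Contra (.lam M)
  | var {n : ℕ} {x : Fin n} {S : Spine n} : Tm.Contra (.neu (.var x) S)
  | con {n c : ℕ} {S : Spine n} : Tm.Contra (.neu (.con c) S)

/-! ## Term and type equality -/

/-- An assumption `Θ ⊢ L = R` between neutral terms. -/
structure EqHyp : Type where
  scope : ℕ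
  lhsHead : Head scope
  lhsSpine : Spine scope
  rhsHead : Head scope
  rhsSpine : Spine scope

mutual
/-- `Δ ; Θ ⊢ M = M'` in the signature `Ψ`. -/
inductive EqTm (Ψ : Sig) : List EqHyp → {n : ℕ} → Tm n → Tm n → Prop
  | hyp {Δ : List EqHyp} {n : ℕ} (h : EqHyp) (ρ : Fin h.scope → Fin n) : h ∈ Δ →
      EqTm Ψ Δ (.neu (h.lhsHead.rename ρ) (h.lhsSpine.rename ρ))
        (.neu (h.rhsHead.rename ρ) (h.rhsSpine.rename ρ))
  | unfoldL {Δ : List EqHyp} {n r : ℕ} {A : Ty 0} {M : Tm 0} {S₁ S₂ : Spine n} {H : Head n}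
      {M' : Tm n} : Ψ[r]? = some (.defn A M) → S₁.Prepat → M.Contra →
      reduce A.erase n S₁ M.ofClosed = some M' →
      EqTm Ψ (⟨n, .rc r, S₁, H, S₂⟩ :: Δ) M' (.neu H S₂) →
      EqTm Ψ Δ (.neu (.rc r) S₁) (.neu H S₂)
  | unfoldR {Δ : List EqHyp} {n r : ℕ} {A : Ty 0} {M : Tm 0} {S₁ S₂ : Spine n} {H : Head n}
      {M' : Tm n} : Ψ[r]? = some (.defn A M) → S₂.Prepat → M.Contra → (∀ r', H ≠ .rc r') →
      reduce A.erase n S₂ M.ofClosed = some M' →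
      EqTm Ψ (⟨n, H, S₁, .rc r, S₂⟩ :: Δ) (.neu H S₁) M' →
      EqTm Ψ Δ (.neu H S₁) (.neu (.rc r) S₂)
  | con {Δ : List EqHyp} {n c : ℕ} {S S' : Spine n} : EqSp Ψ Δ S S' →
      EqTm Ψ Δ (.neu (.con c) S) (.neu (.con c) S')
  | var {Δ : List EqHyp} {n : ℕ} {y : Fin n} {S S' : Spine n} : EqSp Ψ Δ S S' →
      EqTm Ψ Δ (.neu (.var y) S) (.neu (.var y) S')
  | lam {Δ : List EqHyp} {n : ℕ} {M M' : Tm (n + 1)} : EqTm Ψ Δ M M' →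
      EqTm Ψ Δ (.lam M) (.lam M')
/-- `Δ ; Θ ⊢ S = S'` in the signature `Ψ`. -/
inductive EqSp (Ψ : Sig) : List EqHyp → {n : ℕ} → Spine n → Spine n → Prop
  | nil {Δ : List EqHyp} {n : ℕ} : EqSp Ψ Δ (.nil : Spine n) .nil
  | app {Δ : List EqHyp} {n : ℕ} {M M' : Tm n} {S S' : Spine n} :
      EqTm Ψ Δ M M' → EqSp Ψ Δ S S' → EqSp Ψ Δ (.app M S) (.app M' S')
  | papp {Δ : List EqHyp} {n : ℕ} {x : Fin n} {S S' : Spine n} :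
      EqSp Ψ Δ S S' → EqSp Ψ Δ (.papp x S) (.papp x S')
end

/-- `Γ ⊢ A = A'` in the signature `Ψ`; only the variables of `Γ` matter, not their types. -/
inductive EqTy (Ψ : Sig) : {n : ℕ} → Ty n → Ty n → Prop
  | atom {n a : ℕ} {S S' : Spine n} : EqSp Ψ [] S S' → EqTy Ψ (.atom a S) (.atom a S')
  | pi {n : ℕ} {m : Mode} {A A' : Ty n} {B B' : Ty (n + 1)} :
      EqTy Ψ A A' → EqTy Ψ B B' → EqTy Ψ (.pi m A B) (.pi m A' B')

/-! ## Typing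

`Ξ` is the local signature (the declarations before the current one), `Ψ` the global one, and `fwd`
says whether recursion constants of `Ψ` may be referred to ahead of their declaration. -/

mutual
/-- `Γ ⊢ M ⇐ A`. -/
inductive ChkTm (Ξ Ψ : Sig) (fwd : Prop) : {n : ℕ} → Ctx n → Tm n → Ty n → Prop
  | neu {n a : ℕ} {Γ : Ctx n} {H : Head n} {S S' : Spine n} {P : Ty n} :
      SynNeu Ξ Ψ fwd Γ H S P → EqTy Ψ P (.atom a S') →
      ChkTm Ξ Ψ fwd Γ (.neu H S) (.atom a S')
  | lam {n : ℕ} {Γ : Ctx n} {m : Mode} {A : Ty n} {B : Ty (n + 1)} {M : Tm (n + 1)} :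
      ChkTm Ξ Ψ fwd (Γ.cons m A) M B → ChkTm Ξ Ψ fwd Γ (.lam M) (.pi m A B)
/-- `Γ ⊢ H · S ⇒ P`. -/
inductive SynNeu (Ξ Ψ : Sig) (fwd : Prop) : {n : ℕ} → Ctx n → Head n → Spine n → Ty n → Prop
  | var {n : ℕ} {Γ : Ctx n} {x : Fin n} {S : Spine n} {P : Ty n} :
      ChkSp Ξ Ψ fwd Γ S (Γ.get x).2 P → SynNeu Ξ Ψ fwd Γ (.var x) S P
  | con {n c : ℕ} {Γ : Ctx n} {A : Ty 0} {S : Spine n} {P : Ty n} :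
      Ξ[c]? = some (.con A) → ChkSp Ξ Ψ fwd Γ S A.ofClosed P → SynNeu Ξ Ψ fwd Γ (.con c) S P
  | rc {n r : ℕ} {Γ : Ctx n} {A : Ty 0} {M : Tm 0} {S : Spine n} {P : Ty n} :
      (Ξ[r]? = some (.defn A M) ∨ (fwd ∧ Ψ[r]? = some (.defn A M))) →
      ChkSp Ξ Ψ fwd Γ S A.ofClosed P → SynNeu Ξ Ψ fwd Γ (.rc r) S P
/-- `Γ ⊢ S ▷ A ⇒ P`. -/
inductive ChkSp (Ξ Ψ : Sig) (fwd : Prop) : {n : ℕ} → Ctx n → Spine n → Ty n → Ty n → Prop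
  | nil {n a : ℕ} {Γ : Ctx n} {S : Spine n} : ChkSp Ξ Ψ fwd Γ .nil (.atom a S) (.atom a S)
  | app {n : ℕ} {Γ : Ctx n} {M : Tm n} {S : Spine n} {A : Ty n} {B : Ty (n + 1)} {B' P : Ty n} :
      ChkTm Ξ Ψ fwd Γ M A → Ty.hsub A.erase theta0 M B = some B' →
      ChkSp Ξ Ψ fwd Γ S B' P → ChkSp Ξ Ψ fwd Γ (.app M S) (.pi .ord A B) P
  | papp {n : ℕ} {Γ : Ctx n} {y : Fin n} {S : Spine n} {A : Ty n} {B : Ty (n + 1)} {P : Ty n} :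
      (Γ.get y).1 = .pre → EqTy Ψ (Γ.get y).2 A →
      ChkSp Ξ Ψ fwd Γ S (B.rename (instRen y)) P → ChkSp Ξ Ψ fwd Γ (.papp y S) (.pi .pre A B) P
end

/-- `Γ ⊢ S ▷ K ⇒ K'`. -/
inductive ChkSpKd (Ξ Ψ : Sig) (fwd : Prop) : {n : ℕ} → Ctx n → Spine n → Kd n → Kd n → Prop
  | nil {n : ℕ} {Γ : Ctx n} {K : Kd n} : ChkSpKd Ξ Ψ fwd Γ .nil K K
  | app {n : ℕ} {Γ : Ctx n} {M : Tm n} {S : Spine n} {A : Ty n} {K : Kd (n + 1)} {K' K'' : Kd n} :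
      ChkTm Ξ Ψ fwd Γ M A → Kd.hsub A.erase theta0 M K = some K' →
      ChkSpKd Ξ Ψ fwd Γ S K' K'' → ChkSpKd Ξ Ψ fwd Γ (.app M S) (.pi .ord A K) K''
  | papp {n : ℕ} {Γ : Ctx n} {y : Fin n} {S : Spine n} {A : Ty n} {K : Kd (n + 1)} {K'' : Kd n} :
      (Γ.get y).1 = .pre → EqTy Ψ (Γ.get y).2 A →
      ChkSpKd Ξ Ψ fwd Γ S (K.rename (instRen y)) K'' →
      ChkSpKd Ξ Ψ fwd Γ (.papp y S) (.pi .pre A K) K''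

/-- `Γ ⊢ A ⇐ type/cotype`. -/
inductive ChkTy (Ξ Ψ : Sig) (fwd : Prop) : {n : ℕ} → Ctx n → Ty n → Prop
  | atom {n a : ℕ} {Γ : Ctx n} {S : Spine n} {K : Kd 0} {K' : Kd n} :
      Ξ[a]? = some (.fam K) → ChkSpKd Ξ Ψ fwd Γ S K.ofClosed K' → (K' = .type ∨ K' = .cotype) →
      ChkTy Ξ Ψ fwd Γ (.atom a S)
  | pi {n : ℕ} {Γ : Ctx n} {m : Mode} {A : Ty n} {B : Ty (n + 1)} :
      ChkTy Ξ Ψ fwd Γ A → ChkTy Ξ Ψ fwd (Γ.cons m A) B → ChkTy Ξ Ψ fwd Γ (.pi m A B)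

/-- `Γ ⊢ K ⇐ kind`. -/
inductive ChkKd (Ξ Ψ : Sig) (fwd : Prop) : {n : ℕ} → Ctx n → Kd n → Prop
  | type {n : ℕ} {Γ : Ctx n} : ChkKd Ξ Ψ fwd Γ .type
  | cotype {n : ℕ} {Γ : Ctx n} : ChkKd Ξ Ψ fwd Γ .cotype
  | pi {n : ℕ} {Γ : Ctx n} {m : Mode} {A : Ty n} {K : Kd (n + 1)} :
      ChkTy Ξ Ψ fwd Γ A → ChkKd Ξ Ψ fwd (Γ.cons m A) K → ChkKd Ξ Ψ fwd Γ (.pi m A K)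

/-! ## Guardedness -/

/-- The family at the end of a type. -/
def Ty.target : {n : ℕ} → Ty n → ℕ
  | _, .atom a _ => a
  | _, .pi _ _ B => B.target

/-- The kind ends in `cotype`. -/
def Kd.IsCo : {n : ℕ} → Kd n → Prop
  | _, .type => False
  | _, .cotype => True
  | _, .pi _ _ K => K.IsCo

/-- Some coinductive constructor of `C` has the highest priority among the constructors of `C`. The
priority of a constructor is the position at which its type family is declared. -/
def ValidTrace (Ψ : Sig) (C : Finset ℕ) : Prop :=
  ∃ c ∈ C, ∃ (A : Ty 0) (K : Kd 0), Ψ[c]? = some (.con A) ∧ Ψ[A.target]? = some (.fam K) ∧ K.IsCo ∧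
    ∀ c' ∈ C, ∀ A' : Ty 0, Ψ[c']? = some (.con A') → A'.target ≤ A.target

mutual
/-- `Q ; C ⊢ r ⋊ M`: every occurrence of `r` in `M` is guarded, where `Q` holds the recursion constants
already explored and `C` the constructors already passed. -/
inductive GuardTm (Ψ : Sig) (r : ℕ) : Finset ℕ → Finset ℕ → {n : ℕ} → Tm n → Prop
  | lam {Q C : Finset ℕ} {n : ℕ} {M : Tm (n + 1)} : GuardTm Ψ r Q C M → GuardTm Ψ r Q C (.lam M)
  | con {Q C : Finset ℕ} {n c : ℕ} {S : Spine n} : GuardSp Ψ r Q (insert c C) S →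
      GuardTm Ψ r Q C (.neu (.con c) S)
  | var {Q C : Finset ℕ} {n : ℕ} {x : Fin n} {S : Spine n} : GuardSp Ψ r Q C S →
      GuardTm Ψ r Q C (.neu (.var x) S)
  | seen {Q C : Finset ℕ} {n r' : ℕ} {S : Spine n} : r ≠ r' → r' ∈ Q →
      GuardTm Ψ r Q C (.neu (.rc r') S)
  | self {Q C : Finset ℕ} {n : ℕ} {S : Spine n} : ValidTrace Ψ C →
      GuardTm Ψ r Q C (.neu (.rc r) S)
  | explore {Q C : Finset ℕ} {n r' : ℕ} {S : Spine n} {A : Ty 0} {M : Tm 0} : r ≠ r' → r' ∉ Q →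
      Ψ[r']? = some (.defn A M) → S.Prepat → GuardTm Ψ r (insert r' Q) C M →
      GuardTm Ψ r Q C (.neu (.rc r') S)
/-- `Q ; C ⊢ r ⋊ S`. -/
inductive GuardSp (Ψ : Sig) (r : ℕ) : Finset ℕ → Finset ℕ → {n : ℕ} → Spine n → Prop
  | nil {Q C : Finset ℕ} {n : ℕ} : GuardSp Ψ r Q C (.nil : Spine n)
  | app {Q C : Finset ℕ} {n : ℕ} {M : Tm n} {S : Spine n} :
      GuardTm Ψ r Q C M → GuardSp Ψ r Q C S → GuardSp Ψ r Q C (.app M S)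
  | papp {Q C : Finset ℕ} {n : ℕ} {x : Fin n} {S : Spine n} :
      GuardSp Ψ r Q C S → GuardSp Ψ r Q C (.papp x S)
end

/-! ## Valid signatures -/

/-- The local signature is valid relative to the global signature `Ψ`, the check of the bodies of
recursive definitions being deferred. -/
inductive LocalSig (Ψ : Sig) : Sig → Prop
  | nil : LocalSig Ψ []
  | fam {Ξ : Sig} {K : Kd 0} : LocalSig Ψ Ξ → ChkKd Ξ Ψ False .nil K → LocalSig Ψ (Ξ ++ [.fam K])
  | con {Ξ : Sig} {A : Ty 0} : LocalSig Ψ Ξ → ChkTy Ξ Ψ False .nil A → LocalSig Ψ (Ξ ++ [.con A])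
  | defn {Ξ : Sig} {A : Ty 0} {M : Tm 0} : LocalSig Ψ Ξ → ChkTy Ξ Ψ False .nil A →
      A.Prepat → M.Contra → GuardTm Ψ Ξ.length ∅ ∅ M → LocalSig Ψ (Ξ ++ [.defn A M])

/-- Valid signatures: all classifiers are checked first, then the bodies of the recursive definitions,
in which recursion constants may be referred to ahead of their declaration. -/
def Sig.Valid (Ψ : Sig) : Prop :=
  LocalSig Ψ Ψ ∧ ∀ (i : ℕ) (A : Ty 0) (M : Tm 0), Ψ[i]? = some (.defn A M) →
    ChkTm (Ψ.take i) Ψ True .nil M A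

/-! ## Expansion to Böhm trees -/

mutual
/-- Finite approximations of Böhm trees; `cut` is the undefined tree. -/
inductive BTm : ℕ → Type
  | cut {n : ℕ} : BTm n
  | lam {n : ℕ} (M : BTm (n + 1)) : BTm n
  | var {n : ℕ} (x : Fin n) (S : BSp n) : BTm n
  | con {n : ℕ} (c : ℕ) (S : BSp n) : BTm n
inductive BSp : ℕ → Type
  | cut {n : ℕ} : BSp n
  | nil {n : ℕ} : BSp n
  | app {n : ℕ} (M : BTm n) (S : BSp n) : BSp n
  | papp {n : ℕ} (x : Fin n) (S : BSp n) : BSp n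
end

/-- The head of a neutral term after unfolding a recursion constant once. In a valid signature
definitions are contractive, so that the new head is no recursion constant. -/
def headStep (Ψ : Sig) {n : ℕ} : Head n → Spine n → Option (Head n × Spine n)
  | .rc r, S =>
      match Ψ[r]? with
      | some (.defn A M) =>
          match reduce A.erase n S M.ofClosed with
          | some (.neu H S') => some (H, S')
          | _ => none
      | _ => none
  | H, S => some (H, S)

mutual
/-- Expansion of terms at depth `k + 1`, given the expansion `ex` of spines at depth `k`. -/
def expTmSucc (Ψ : Sig) (ex : (n : ℕ) → Spine n → BSp n) : {n : ℕ} → Tm n → BTm n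
  | _, .lam M => .lam (expTmSucc Ψ ex M)
  | n, .neu H S =>
      match headStep Ψ H S with
      | some (.var x, S') => .var x (ex n S')
      | some (.con c, S') => .con c (ex n S')
      | _ => .cut
def expSpSucc (Ψ : Sig) (ex : (n : ℕ) → Spine n → BSp n) : {n : ℕ} → Spine n → BSp n
  | _, .nil => .nil
  | _, .app M S => .app (expTmSucc Ψ ex M) (expSpSucc Ψ ex S)
  | _, .papp x S => .papp x (expSpSucc Ψ ex S)
end

/-- Expansion of spines to depth `k`. -/
def expSp (Ψ : Sig) : ℕ → (n : ℕ) → Spine n → BSp n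
  | 0, _, _ => .cut
  | k + 1, _, S => expSpSucc Ψ (expSp Ψ k) S

/-- Expansion of terms to depth `k`. -/
def expTm (Ψ : Sig) : ℕ → {n : ℕ} → Tm n → BTm n
  | 0, _, _ => .cut
  | k + 1, _, M => expTmSucc Ψ (expSp Ψ k) M

/-! # Recursive types and their cyclic subtyping derivations -/

/-- Recursive types `τ ::= X | ⊥ | ⊤ | τ₁ → τ₂ | μ X. τ₁ → τ₂` with `n` free variables, up to renaming
of bound variables. -/
inductive RTy : ℕ → Type
  | var {n : ℕ} (X : Fin n) : RTy n
  | bot {n : ℕ} : RTy n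
  | top {n : ℕ} : RTy n
  | arr {n : ℕ} (a b : RTy n) : RTy n
  | mu {n : ℕ} (a b : RTy (n + 1)) : RTy n

def RTy.rename : {n : ℕ} → {m : ℕ} → (Fin n → Fin m) → RTy n → RTy m
  | _, _, ρ, .var X => .var (ρ X)
  | _, _, _, .bot => .bot
  | _, _, _, .top => .top
  | _, _, ρ, .arr a b => .arr (a.rename ρ) (b.rename ρ)
  | _, _, ρ, .mu a b => .mu (a.rename (liftRen ρ)) (b.rename (liftRen ρ))

/-- A substitution extended under a binder. -/
def liftSub {n m : ℕ} (θ : Fin n → RTy m) : Fin (n + 1) → RTy (m + 1) :=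
  Fin.cases (.var 0) (fun i => (θ i).rename Fin.succ)

def RTy.subst : {n : ℕ} → {m : ℕ} → (Fin n → RTy m) → RTy n → RTy m
  | _, _, θ, .var X => θ X
  | _, _, _, .bot => .bot
  | _, _, _, .top => .top
  | _, _, θ, .arr a b => .arr (a.subst θ) (b.subst θ)
  | _, _, θ, .mu a b => .mu (a.subst (liftSub θ)) (b.subst (liftSub θ))

/-- `[τ/X] σ`, where `X` is the innermost variable. -/
def RTy.inst {n : ℕ} (τ : RTy n) (σ : RTy (n + 1)) : RTy n := σ.subst (Fin.cases τ .var)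

/-- `[τ/X] σ`, where `X` is any one of the `n + 1` variables. -/
def RTy.substAt {n : ℕ} (X : Fin (n + 1)) (τ : RTy n) (σ : RTy (n + 1)) : RTy n :=
  σ.subst (X.insertNth (α := fun _ => RTy n) τ .var)

/-- `[μ X. a → b / X] (a → b)`. -/
def RTy.unroll {n : ℕ} (a b : RTy (n + 1)) : RTy n :=
  .arr (RTy.inst (.mu a b) a) (RTy.inst (.mu a b) b)

/-- Finite derivation trees of `σ ≤ τ`, a leaf of which may refer back to one of the `N` named
judgments `lhs i ≤ rhs i`. -/
inductive Deriv {n N : ℕ} (lhs rhs : Fin N → RTy n) : RTy n → RTy n → Type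
  | ref (i : Fin N) : Deriv lhs rhs (lhs i) (rhs i)
  | bot (τ : RTy n) : Deriv lhs rhs .bot τ
  | top (τ : RTy n) : Deriv lhs rhs τ .top
  | unfold (a b : RTy (n + 1)) {τ : RTy n} (h : τ = RTy.unroll a b) : Deriv lhs rhs (.mu a b) τ
  | fold (a b : RTy (n + 1)) {τ : RTy n} (h : τ = RTy.unroll a b) : Deriv lhs rhs τ (.mu a b)
  | refl (τ : RTy n) : Deriv lhs rhs τ τ
  | arr {σ₁ σ₂ τ₁ τ₂ : RTy n} (D : Deriv lhs rhs τ₁ σ₁) (E : Deriv lhs rhs σ₂ τ₂) :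
      Deriv lhs rhs (.arr σ₁ σ₂) (.arr τ₁ τ₂)
  | trans {τ₁ τ₂ τ₃ : RTy n} (D : Deriv lhs rhs τ₁ τ₂) (E : Deriv lhs rhs τ₂ τ₃) :
      Deriv lhs rhs τ₁ τ₃

namespace Deriv

variable {n N : ℕ} {lhs rhs : Fin N → RTy n}

/-- The derivation is a mere reference. -/
def IsRef : {σ τ : RTy n} → Deriv lhs rhs σ τ → Prop
  | _, _, .ref _ => True
  | _, _, _ => False

/-- The name `i` is referred to from a position that is not above an application of `arr`. -/
def Exposes : {σ τ : RTy n} → Deriv lhs rhs σ τ → Fin N → Prop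
  | _, _, .ref j, i => j = i
  | _, _, .trans D E, i => D.Exposes i ∨ E.Exposes i
  | _, _, _, _ => False

end Deriv

/-- Valid cyclic derivations of `σ ≤ τ`: a finite system of named derivations, each ending in a rule,
that may refer to each other, and a main derivation. Every cycle must pass through the coinductive
rule `arr`. -/
structure CycDeriv {n : ℕ} (σ τ : RTy n) : Type where
  N : ℕ
  lhs : Fin N → RTy n
  rhs : Fin N → RTy n
  body : (i : Fin N) → Deriv lhs rhs (lhs i) (rhs i)
  main : Deriv lhs rhs σ τ
  body_rule : ∀ i, ¬ (body i).IsRef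
  valid : ∀ i, ¬ Relation.TransGen (fun i j => (body i).Exposes j) i i

/-- The axioms. -/
inductive Axm : Type
  | bot
  | top
  | unfold
  | fold
  | refl

/-- Finite approximations of infinite derivation trees; nodes carry the rule and the conclusion. -/
inductive DTree (n : ℕ) : Type
  | cut : DTree n
  | ax (r : Axm) (σ τ : RTy n) : DTree n
  | arr (σ τ : RTy n) (D E : DTree n) : DTree n
  | trans (σ τ : RTy n) (D E : DTree n) : DTree n

namespace Deriv

variable {n N : ℕ} {lhs rhs : Fin N → RTy n}

/-- A reference is replaced by the derivation that it refers to. -/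
def resolve (body : (i : Fin N) → Deriv lhs rhs (lhs i) (rhs i)) :
    {σ τ : RTy n} → Deriv lhs rhs σ τ → Deriv lhs rhs σ τ
  | _, _, .ref i => body i
  | _, _, D => D

/-- The last rule of a derivation, with `f` applied to its premises. -/
def layer (f : {σ τ : RTy n} → Deriv lhs rhs σ τ → DTree n) :
    {σ τ : RTy n} → Deriv lhs rhs σ τ → DTree n
  | _, _, .ref _ => .cut
  | _, _, .bot τ => .ax .bot .bot τ
  | _, _, .top τ => .ax .top τ .top
  | _, τ, .unfold a b _ => .ax .unfold (.mu a b) τ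
  | σ, _, .fold a b _ => .ax .fold σ (.mu a b)
  | _, _, .refl τ => .ax .refl τ τ
  | _, _, @Deriv.arr _ _ _ _ σ₁ σ₂ τ₁ τ₂ D E => .arr (.arr σ₁ σ₂) (.arr τ₁ τ₂) (f D) (f E)
  | σ, τ, .trans D E => .trans σ τ (f D) (f E)

/-- The unfolding of a derivation to depth `k`. -/
def unf (body : (i : Fin N) → Deriv lhs rhs (lhs i) (rhs i)) :
    ℕ → {σ τ : RTy n} → Deriv lhs rhs σ τ → DTree n
  | 0, _, _, _ => .cut
  | k + 1, _, _, D => (D.resolve body).layer (unf body k)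

end Deriv

/-- Cyclic derivations are identified when they unfold to the same infinite derivation. -/
instance CycDeriv.setoid {n : ℕ} (σ τ : RTy n) : Setoid (CycDeriv σ τ) where
  r D E := ∀ k, D.main.unf D.body k = E.main.unf E.body k
  iseqv := ⟨fun _ _ => rfl, fun h k => (h k).symm, fun h h' k => (h k).trans (h' k)⟩

/-! ## Renaming the free type variables of a derivation -/

theorem liftRen_liftRen {n m p : ℕ} (ρ : Fin n → Fin m) (ρ' : Fin m → Fin p) (i : Fin (n + 1)) :
    liftRen ρ' (liftRen ρ i) = liftRen (fun j => ρ' (ρ j)) i := by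
  refine Fin.cases ?_ (fun j => ?_) i <;> simp [liftRen]

theorem RTy.rename_rename : ∀ {n m p : ℕ} (ρ : Fin n → Fin m) (ρ' : Fin m → Fin p) (σ : RTy n),
    (σ.rename ρ).rename ρ' = σ.rename (fun j => ρ' (ρ j))
  | _, _, _, _, _, .var _ => rfl
  | _, _, _, _, _, .bot => rfl
  | _, _, _, _, _, .top => rfl
  | _, _, _, ρ, ρ', .arr a b => by
      simp only [RTy.rename, RTy.rename_rename ρ ρ' a, RTy.rename_rename ρ ρ' b]
  | _, _, _, ρ, ρ', .mu a b => by
      simp only [RTy.rename, RTy.rename_rename _ _ a, RTy.rename_rename _ _ b]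
      rw [show (fun j => liftRen ρ' (liftRen ρ j)) = liftRen (fun j => ρ' (ρ j)) from
        funext (liftRen_liftRen ρ ρ')]

theorem RTy.rename_subst : ∀ {n m p : ℕ} (ρ : Fin m → Fin p) (θ : Fin n → RTy m) (σ : RTy n),
    (σ.subst θ).rename ρ = σ.subst (fun j => (θ j).rename ρ)
  | _, _, _, _, _, .var _ => rfl
  | _, _, _, _, _, .bot => rfl
  | _, _, _, _, _, .top => rfl
  | _, _, _, ρ, θ, .arr a b => by
      simp only [RTy.rename, RTy.subst, RTy.rename_subst ρ θ a, RTy.rename_subst ρ θ b]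
  | _, _, _, ρ, θ, .mu a b => by
      simp only [RTy.rename, RTy.subst, RTy.rename_subst _ _ a, RTy.rename_subst _ _ b]
      rw [show (fun j => (liftSub θ j).rename (liftRen ρ)) = liftSub (fun j => (θ j).rename ρ) from
        funext fun j => by
          refine Fin.cases ?_ (fun j => ?_) j <;>
            simp [liftSub, liftRen, RTy.rename, RTy.rename_rename]]

theorem RTy.subst_rename : ∀ {n m p : ℕ} (θ : Fin m → RTy p) (ρ : Fin n → Fin m) (σ : RTy n),
    (σ.rename ρ).subst θ = σ.subst (fun j => θ (ρ j))
  | _, _, _, _, _, .var _ => rfl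
  | _, _, _, _, _, .bot => rfl
  | _, _, _, _, _, .top => rfl
  | _, _, _, θ, ρ, .arr a b => by
      simp only [RTy.rename, RTy.subst, RTy.subst_rename θ ρ a, RTy.subst_rename θ ρ b]
  | _, _, _, θ, ρ, .mu a b => by
      simp only [RTy.rename, RTy.subst, RTy.subst_rename _ _ a, RTy.subst_rename _ _ b]
      rw [show (fun j => liftSub θ (liftRen ρ j)) = liftSub (fun j => θ (ρ j)) from
        funext fun j => by
          refine Fin.cases ?_ (fun j => ?_) j <;> simp [liftSub, liftRen]]

theorem RTy.rename_inst {n m : ℕ} (ρ : Fin n → Fin m) (τ : RTy n) (σ : RTy (n + 1)) :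
    (RTy.inst τ σ).rename ρ = RTy.inst (τ.rename ρ) (σ.rename (liftRen ρ)) := by
  unfold RTy.inst
  rw [RTy.rename_subst, RTy.subst_rename]
  congr 1
  funext j
  refine Fin.cases ?_ (fun j => ?_) j <;> simp [liftRen, RTy.rename]

theorem RTy.rename_unroll {n m : ℕ} (ρ : Fin n → Fin m) (a b : RTy (n + 1)) :
    (RTy.unroll a b).rename ρ = RTy.unroll (a.rename (liftRen ρ)) (b.rename (liftRen ρ)) := by
  simp only [RTy.unroll, RTy.rename, RTy.rename_inst]

namespace Deriv

variable {n m N : ℕ} {lhs rhs : Fin N → RTy n}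

/-- Renaming of the free type variables. -/
def rename (ρ : Fin n → Fin m) : {σ τ : RTy n} → Deriv lhs rhs σ τ →
    Deriv (fun i => (lhs i).rename ρ) (fun i => (rhs i).rename ρ) (σ.rename ρ) (τ.rename ρ)
  | _, _, .ref i => .ref i
  | _, _, .bot _ => .bot _
  | _, _, .top _ => .top _
  | _, _, .unfold _ _ h => .unfold _ _ (by rw [h, RTy.rename_unroll])
  | _, _, .fold _ _ h => .fold _ _ (by rw [h, RTy.rename_unroll])
  | _, _, .refl _ => .refl _
  | _, _, .arr D E => .arr (D.rename ρ) (E.rename ρ)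
  | _, _, .trans D E => .trans (D.rename ρ) (E.rename ρ)

theorem isRef_rename (ρ : Fin n → Fin m) {σ τ : RTy n} (D : Deriv lhs rhs σ τ) :
    (D.rename ρ).IsRef → D.IsRef := by
  cases D <;> exact id

theorem exposes_rename (ρ : Fin n → Fin m) {σ τ : RTy n} (D : Deriv lhs rhs σ τ) (i : Fin N) :
    (D.rename ρ).Exposes i → D.Exposes i := by
  induction D with
  | trans D E ihD ihE => exact Or.imp ihD ihE
  | _ => exact id

end Deriv

/-- Renaming of the free type variables. -/
def CycDeriv.rename {n m : ℕ} {σ τ : RTy n} (ρ : Fin n → Fin m) (D : CycDeriv σ τ) :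
    CycDeriv (σ.rename ρ) (τ.rename ρ) where
  N := D.N
  lhs i := (D.lhs i).rename ρ
  rhs i := (D.rhs i).rename ρ
  body i := (D.body i).rename ρ
  main := D.main.rename ρ
  body_rule i h := D.body_rule i ((D.body i).isRef_rename ρ h)
  valid i h := D.valid i (Relation.TransGen.mono (fun i j => (D.body i).exposes_rename ρ j) i i h)

/-! # The encoding -/

/-- A spine of ordinary arguments. -/
def Spine.ofList {n : ℕ} : List (Tm n) → Spine n
  | [] => .nil
  | M :: l => .app M (.ofList l)

/-- A constructor applied to arguments. -/
def Tm.cst {n : ℕ} (c : ℕ) (l : List (Tm n)) : Tm n := .neu (.con c) (.ofList l)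

/-- A variable applied to arguments. -/
def Tm.v {n : ℕ} (x : Fin n) (l : List (Tm n)) : Tm n := .neu (.var x) (.ofList l)

/-- The positions of the declarations in the signature below. -/
abbrev kTp : ℕ := 0
abbrev kBot : ℕ := 1
abbrev kTop : ℕ := 2
abbrev kArr : ℕ := 3
abbrev kMu : ℕ := 4
abbrev kSubtp : ℕ := 5
abbrev kSubtpinf : ℕ := 6
abbrev kSubtpTop : ℕ := 7
abbrev kSubtpBot : ℕ := 8
abbrev kRefl : ℕ := 9
abbrev kTrans : ℕ := 10
abbrev kSubtpArr : ℕ := 11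
abbrev kUnfold : ℕ := 12
abbrev kFold : ℕ := 13
abbrev kInfArr : ℕ := 14

/-- The type `tp`. -/
def Ty.tp {n : ℕ} : Ty n := .atom kTp .nil

/-- The type `tp → tp`. -/
def Ty.tpFun {n : ℕ} : Ty n := .pi .ord .tp .tp

/-- The type `subtp M N`. -/
def Ty.subtp {n : ℕ} (M N : Tm n) : Ty n := .atom kSubtp (.ofList [M, N])

/-- The type `subtpinf M N`. -/
def Ty.subtpinf {n : ℕ} (M N : Tm n) : Ty n := .atom kSubtpinf (.ofList [M, N])

/-- `mu F G` for variables `F`, `G` of type `tp → tp`, in long form. -/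
def Tm.muVar {n : ℕ} (F G : Fin n) : Tm n :=
  .cst kMu [.lam (.v F.succ [.v 0 []]), .lam (.v G.succ [.v 0 []])]

/-- `arr (F (mu F G)) (G (mu F G))` for variables `F`, `G` of type `tp → tp`. -/
def Tm.unrollVar {n : ℕ} (F G : Fin n) : Tm n :=
  .cst kArr [.v F [.muVar F G], .v G [.muVar F G]]

/-- The signature of recursive types and subtyping, with implicit abstractions made explicit. -/
def subSig : Sig :=
  [ -- tp : type
    .fam .type,
    -- bot : tp
    .con .tp,
    -- top : tp
    .con .tp,
    -- arr : tp -> tp -> tp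
    .con (.pi .ord .tp (.pi .ord .tp .tp)),
    -- mu : (tp -> tp) -> (tp -> tp) -> tp
    .con (.pi .ord .tpFun (.pi .ord .tpFun .tp)),
    -- subtp : tp -> tp -> type
    .fam (.pi .ord .tp (.pi .ord .tp .type)),
    -- subtpinf : tp -> tp -> cotype
    .fam (.pi .ord .tp (.pi .ord .tp .cotype)),
    -- subtp/top : {T} subtp T top
    .con (.pi .ord .tp (.subtp (.v 0 []) (.cst kTop []))),
    -- subtp/bot : {T} subtp bot T
    .con (.pi .ord .tp (.subtp (.cst kBot []) (.v 0 []))),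
    -- refl : {T} subtp T T
    .con (.pi .ord .tp (.subtp (.v 0 []) (.v 0 []))),
    -- trans : {T1} {T2} {T3} subtp T1 T2 -> subtp T2 T3 -> subtp T1 T3
    .con (.pi .ord .tp (.pi .ord .tp (.pi .ord .tp
      (.pi .ord (.subtp (.v 2 []) (.v 1 []))
        (.pi .ord (.subtp (.v 2 []) (.v 1 [])) (.subtp (.v 4 []) (.v 2 []))))))),
    -- subtp/arr : {T1} {T2} subtpinf T1 T2 -> subtp T1 T2
    .con (.pi .ord .tp (.pi .ord .tp
      (.pi .ord (.subtpinf (.v 1 []) (.v 0 [])) (.subtp (.v 2 []) (.v 1 []))))),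
    -- unfold : {T1} {T2} subtp (mu T1 T2) (arr (T1 (mu T1 T2)) (T2 (mu T1 T2)))
    .con (.pi .ord .tpFun (.pi .ord .tpFun (.subtp (.muVar 1 0) (.unrollVar 1 0)))),
    -- fold : {T1} {T2} subtp (arr (T1 (mu T1 T2)) (T2 (mu T1 T2))) (mu T1 T2)
    .con (.pi .ord .tpFun (.pi .ord .tpFun (.subtp (.unrollVar 1 0) (.muVar 1 0)))),
    -- inf/arr : {T1} {S1} {S2} {T2}
    --   subtp T1 S1 -> subtp S2 T2 -> subtpinf (arr S1 S2) (arr T1 T2)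
    .con (.pi .ord .tp (.pi .ord .tp (.pi .ord .tp (.pi .ord .tp
      (.pi .ord (.subtp (.v 3 []) (.v 2 []))
        (.pi .ord (.subtp (.v 2 []) (.v 1 []))
          (.subtpinf (.cst kArr [.v 4 [], .v 3 []]) (.cst kArr [.v 5 [], .v 2 []])))))))) ]

/-- The context that declares `n` variables of type `tp`, of the given modes. -/
def tpCtx : {n : ℕ} → (Fin n → Mode) → Ctx n
  | 0, _ => .nil
  | _ + 1, m => .cons (tpCtx fun i => m i.succ) (m 0) .tp

/-- Valid canonical terms of type `A` in the context `Γ`: a valid extension of the signature by recursive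
definitions, and a term that has type `A` over it. -/
structure CTm {n : ℕ} (Γ : Ctx n) (A : Ty n) : Type where
  defs : List (Ty 0 × Tm 0)
  tm : Tm n
  sig_valid : Sig.Valid (subSig ++ defs.map fun d => .defn d.1 d.2)
  typed : ChkTm (subSig ++ defs.map fun d => .defn d.1 d.2)
    (subSig ++ defs.map fun d => .defn d.1 d.2) False Γ tm A

/-- The signature over which a canonical term is formed. -/
def CTm.sig {n : ℕ} {Γ : Ctx n} {A : Ty n} (M : CTm Γ A) : Sig :=
  subSig ++ M.defs.map fun d => .defn d.1 d.2

/-- Canonical terms are equal when they expand to the same Böhm tree. -/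
instance CTm.setoid {n : ℕ} (Γ : Ctx n) (A : Ty n) : Setoid (CTm Γ A) where
  r M N := ∀ k, expTm M.sig k M.tm = expTm N.sig k N.tm
  iseqv := ⟨fun _ _ => rfl, fun h k => (h k).symm, fun h h' k => (h k).trans (h' k)⟩

/-- The encoding of recursive types. -/
def RTy.enc : {n : ℕ} → RTy n → Tm n
  | _, .var X => .v X []
  | _, .bot => .cst kBot []
  | _, .top => .cst kTop []
  | _, .arr a b => .cst kArr [a.enc, b.enc]
  | _, .mu a b => .cst kMu [.lam a.enc, .lam b.enc]

/-- The prepattern spine of all variables, the outermost one first. -/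
def allVars (n : ℕ) : Spine n := (List.finRange n).foldl (fun S x => .papp x S) .nil

/-- The encoding of derivation trees; the `i`-th name becomes the `i`-th recursion constant after the
declarations of `subSig`. -/
def Deriv.enc {n N : ℕ} {lhs rhs : Fin N → RTy n} : {σ τ : RTy n} → Deriv lhs rhs σ τ → Tm n
  | _, _, .ref i => .neu (.rc (subSig.length + i)) (allVars n)
  | _, _, .bot τ => .cst kSubtpBot [τ.enc]
  | _, _, .top τ => .cst kSubtpTop [τ.enc]
  | _, _, .unfold a b _ => .cst kUnfold [.lam a.enc, .lam b.enc]
  | _, _, .fold a b _ => .cst kFold [.lam a.enc, .lam b.enc]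
  | _, _, .refl τ => .cst kRefl [τ.enc]
  | _, _, @Deriv.arr _ _ _ _ σ₁ σ₂ τ₁ τ₂ D E =>
      .cst kSubtpArr [(RTy.arr σ₁ σ₂).enc, (RTy.arr τ₁ τ₂).enc,
        .cst kInfArr [τ₁.enc, σ₁.enc, σ₂.enc, τ₂.enc, D.enc, E.enc]]
  | _, _, @Deriv.trans _ _ _ _ τ₁ τ₂ τ₃ D E =>
      .cst kTrans [τ₁.enc, τ₂.enc, τ₃.enc, D.enc, E.enc]

/-- The prepattern abstraction of a type over all its variables, all of type `tp`. -/
def Ty.close : {n : ℕ} → Ty n → Ty 0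
  | 0, A => A
  | _ + 1, A => Ty.close (.pi .pre .tp A)

/-- The abstraction of a term over all its variables. -/
def Tm.close : {n : ℕ} → Tm n → Tm 0
  | 0, M => M
  | _ + 1, M => Tm.close (.lam M)

/-- The recursive definitions that encode the named derivations of a cyclic derivation. -/
def CycDeriv.encDefs {n : ℕ} {σ τ : RTy n} (D : CycDeriv σ τ) : List (Ty 0 × Tm 0) :=
  List.ofFn fun i : Fin D.N =>
    ((Ty.subtp (D.lhs i).enc (D.rhs i).enc).close, (D.body i).enc.close)

/-- The type `subtp ⌜σ⌝ ⌜τ⌝`. -/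
def subtpEnc {n : ℕ} (σ τ : RTy n) : Ty n := .subtp σ.enc τ.enc

/-- The context that declares `n` prepattern variables of type `tp`. -/
def preCtx (n : ℕ) : Ctx n := tpCtx fun _ => .pre

end CoLF

open CoLF

namespace CoLF

/-! # Renaming -/

-- Guardedness is a graph condition here. `subtpinf` is the only coinductive family, it has the
-- highest priority, and `inf/arr` is its only constructor, so a trace is valid exactly when it
-- passes `inf/arr` (`validTrace_iff`). Draw an edge from r to s when the body of r mentions s
-- outside the arguments of `inf/arr`. Guarded definitions then have an acyclic graph
-- (`edge_acyclic`), and conversely acyclicity gives guardedness (`guardTm_of_acyclic`).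
--
-- A term of type `tp` contains no `inf/arr`, so unfolding its recursion constants follows edges and
-- terminates. Each such term therefore represents a recursive type (`Good.exists_tpRep`) and has
-- the Böhm tree of that type's encoding (`TpRep.bEq`). Distinct recursive types have distinct trees
-- (`RTy.enc_injective`), which gives (1). Substitution stays simple because variables of type `tp`
-- take no arguments: hereditary substitution for them is ordinary simultaneous substitution
-- (`FO.hsub_fsub`).
--
-- The sides of a type `subtp M N` may themselves use recursion constants, so typing depends on the
-- equality judgment. Equality is sound for Böhm trees (`EqTm.bEq`) and equates any two
-- representations of one recursive type (`EqTm.of_tpRep`). Typing of subtyping terms can thus be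
-- replaced by the relation `WSub`, indexed by recursive types rather than terms (`WSub.of_chkTm`,
-- `WSub.chkTm`).
--
-- For (2), the edges of an encoded system are the references not below (arr), so a valid cyclic
-- derivation has a valid encoding. Unfoldings agree exactly when Böhm trees agree: the constructors
-- display the rules, and their explicit arguments display the types (`Deriv.layer_eq_of_bEq`,
-- `Deriv.expTm_eq_of_layer`). For surjectivity, a definition may have any number of parameters and
-- may have a `subtpinf` type, whereas a named derivation lives over the n fixed variables. Hence
-- every well-typed application of a recursion constant to variables becomes a name of its own;
-- there are finitely many (`finite_rc_wSub`). These applications solve the resulting system of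
-- definitions up to Böhm trees, and solutions are unique (`Deriv.encWith_bEq`), so the term has the
-- tree of the encoded derivation (`CTm.exists_cycDeriv`).

theorem liftRen_succ {n m : ℕ} (ρ : Fin n → Fin m) (i : Fin n) :
    liftRen ρ i.succ = (ρ i).succ := rfl

theorem comp_liftRen {n m p : ℕ} (ρ : Fin n → Fin m) (ρ' : Fin m → Fin p) :
    (fun j => liftRen ρ' (liftRen ρ j)) = liftRen (fun j => ρ' (ρ j)) :=
  funext (liftRen_liftRen ρ ρ')

theorem liftRen_id {n : ℕ} : liftRen (fun i : Fin n => i) = fun i => i := by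
  funext i; refine Fin.cases ?_ (fun j => ?_) i <;> rfl

mutual
theorem Tm.rename_rename : ∀ {n m p : ℕ} (ρ : Fin n → Fin m) (ρ' : Fin m → Fin p) (M : Tm n),
    (M.rename ρ).rename ρ' = M.rename (fun j => ρ' (ρ j))
  | _, _, _, ρ, ρ', .lam M => by
      simp only [Tm.rename, Tm.rename_rename _ _ M, comp_liftRen]
  | _, _, _, ρ, ρ', .neu H S => by
      simp only [Tm.rename, Spine.rename_rename _ _ S]
      cases H <;> rfl
theorem Spine.rename_rename : ∀ {n m p : ℕ} (ρ : Fin n → Fin m) (ρ' : Fin m → Fin p)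
    (S : Spine n), (S.rename ρ).rename ρ' = S.rename (fun j => ρ' (ρ j))
  | _, _, _, _, _, .nil => rfl
  | _, _, _, ρ, ρ', .app M S => by
      simp only [Spine.rename, Tm.rename_rename _ _ M, Spine.rename_rename _ _ S]
  | _, _, _, ρ, ρ', .papp x S => by
      simp only [Spine.rename, Spine.rename_rename _ _ S]
end

theorem Ty.rename_rename : ∀ {n m p : ℕ} (ρ : Fin n → Fin m) (ρ' : Fin m → Fin p) (A : Ty n),
    (A.rename ρ).rename ρ' = A.rename (fun j => ρ' (ρ j))
  | _, _, _, _, _, .atom a S => by simp only [Ty.rename, Spine.rename_rename _ _ S]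
  | _, _, _, ρ, ρ', .pi m A B => by
      simp only [Ty.rename, Ty.rename_rename _ _ A, Ty.rename_rename _ _ B, comp_liftRen]

mutual
theorem Tm.rename_id : ∀ {n : ℕ} (M : Tm n), M.rename (fun i => i) = M
  | _, .lam M => by simp only [Tm.rename, liftRen_id, Tm.rename_id M]
  | _, .neu H S => by
      simp only [Tm.rename, Spine.rename_id S]
      cases H <;> rfl
theorem Spine.rename_id : ∀ {n : ℕ} (S : Spine n), S.rename (fun i => i) = S
  | _, .nil => rfl
  | _, .app M S => by simp only [Spine.rename, Tm.rename_id M, Spine.rename_id S]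
  | _, .papp x S => by simp only [Spine.rename, Spine.rename_id S]
end

theorem Tm.rename_ofClosed {n m : ℕ} (ρ : Fin n → Fin m) (M : Tm 0) :
    (M.ofClosed : Tm n).rename ρ = M.ofClosed := by
  simp only [Tm.ofClosed, Tm.rename_rename]
  congr 1; funext i; exact i.elim0

theorem Tm.rename_succ_liftRen {n m : ℕ} (ρ : Fin n → Fin m) (N : Tm n) :
    (N.rename Fin.succ).rename (liftRen ρ) = (N.rename ρ).rename Fin.succ := by
  simp only [Tm.rename_rename]; rfl

theorem Tm.rename_liftRen_instRen {n m : ℕ} (ρ : Fin n → Fin m) (y : Fin m) (M : Tm (n + 1)) :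
    (M.rename (liftRen ρ)).rename (instRen y)
      = M.rename (Fin.cases y ρ : Fin (n + 1) → Fin m) := by
  rw [Tm.rename_rename]
  congr 1; funext i; refine Fin.cases ?_ (fun j => ?_) i <;> rfl

theorem Ty.rename_liftRen_instRen {n m : ℕ} (ρ : Fin n → Fin m) (y : Fin m) (M : Ty (n + 1)) :
    (M.rename (liftRen ρ)).rename (instRen y)
      = M.rename (Fin.cases y ρ : Fin (n + 1) → Fin m) := by
  rw [Ty.rename_rename]
  congr 1; funext i; refine Fin.cases ?_ (fun j => ?_) i <;> rfl

theorem Tm.Contra.rename {n : ℕ} {M : Tm n} (h : M.Contra) : ∀ {m : ℕ} (ρ : Fin n → Fin m),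
    (M.rename ρ).Contra := by
  induction h with
  | lam _ ih => exact fun ρ => .lam (ih _)
  | var => exact fun ρ => .var
  | con => exact fun ρ => .con

/-! # Renaming and hereditary substitution -/

theorem liftOpt_liftRen {k n k' n' : ℕ} {θ : Fin k → Option (Fin n)} {θ' : Fin k' → Option (Fin n')}
    {ρ : Fin k → Fin k'} {ρ' : Fin n → Fin n'} (h : ∀ x, θ' (ρ x) = (θ x).map ρ') (x : Fin (k + 1)) :
    liftOpt θ' (liftRen ρ x) = (liftOpt θ x).map (liftRen ρ') := by
  refine Fin.cases rfl (fun j => ?_) x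
  simp only [liftRen_succ]
  show (θ' (ρ j)).map Fin.succ = ((θ j).map Fin.succ).map _
  rw [h]
  cases θ j <;> rfl

mutual
-- The induction on terms is kept apart from the induction on simple types: `hred` is equivariance
-- of the reduction that is called at the replaced variable, and `reduce_rename` supplies it by
-- recursion on the simple type.
theorem Tm.hsubWith_rename (red : (n : ℕ) → Spine n → Tm n → Option (Tm n))
    (hred : ∀ {n m : ℕ} (ρ : Fin n → Fin m) (S : Spine n) (N : Tm n),
      red m (S.rename ρ) (N.rename ρ) = (red n S N).map (Tm.rename ρ)) :
    ∀ {k n k' n' : ℕ} (θ : Fin k → Option (Fin n))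
    (θ' : Fin k' → Option (Fin n')) (ρ : Fin k → Fin k') (ρ' : Fin n → Fin n')
    (_ : ∀ x, θ' (ρ x) = (θ x).map ρ') (N : Tm n) (M : Tm k),
    Tm.hsubWith red θ' (N.rename ρ') (M.rename ρ) = (Tm.hsubWith red θ N M).map (Tm.rename ρ')
  | _, _, _, _, θ, θ', ρ, ρ', h, N, .lam M => by
      have := Tm.hsubWith_rename red hred (liftOpt θ) (liftOpt θ') (liftRen ρ) (liftRen ρ')
        (liftOpt_liftRen h) (N.rename Fin.succ) M
      rw [Tm.rename_succ_liftRen] at this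
      simp only [Tm.rename, Tm.hsubWith, this, Option.map_map]
      rfl
  | _, n, _, _, θ, θ', ρ, ρ', h, N, .neu (.var y) S => by
      have := Spine.hsubWith_rename red hred θ θ' ρ ρ' h N S
      simp only [Tm.rename, Head.rename, Tm.hsubWith, this]
      cases Spine.hsubWith red θ N S with
      | none => rfl
      | some S' =>
        simp only [Option.map_some, Option.bind_some, h]
        cases θ y with
        | none => exact hred _ _ _
        | some y' => rfl
  | _, _, _, _, θ, θ', ρ, ρ', h, N, .neu (.con c) S => by
      have := Spine.hsubWith_rename red hred θ θ' ρ ρ' h N S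
      simp only [Tm.rename, Head.rename, Tm.hsubWith, this, Option.map_map]
      rfl
  | _, _, _, _, θ, θ', ρ, ρ', h, N, .neu (.rc c) S => by
      have := Spine.hsubWith_rename red hred θ θ' ρ ρ' h N S
      simp only [Tm.rename, Head.rename, Tm.hsubWith, this, Option.map_map]
      rfl
theorem Spine.hsubWith_rename (red : (n : ℕ) → Spine n → Tm n → Option (Tm n))
    (hred : ∀ {n m : ℕ} (ρ : Fin n → Fin m) (S : Spine n) (N : Tm n),
      red m (S.rename ρ) (N.rename ρ) = (red n S N).map (Tm.rename ρ)) :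
    ∀ {k n k' n' : ℕ} (θ : Fin k → Option (Fin n))
    (θ' : Fin k' → Option (Fin n')) (ρ : Fin k → Fin k') (ρ' : Fin n → Fin n')
    (_ : ∀ x, θ' (ρ x) = (θ x).map ρ') (N : Tm n) (S : Spine k),
    Spine.hsubWith red θ' (N.rename ρ') (S.rename ρ)
      = (Spine.hsubWith red θ N S).map (Spine.rename ρ')
  | _, _, _, _, _, _, _, _, _, _, .nil => rfl
  | _, _, _, _, θ, θ', ρ, ρ', h, N, .app M S => by
      have h1 := Tm.hsubWith_rename red hred θ θ' ρ ρ' h N M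
      have h2 := Spine.hsubWith_rename red hred θ θ' ρ ρ' h N S
      simp only [Spine.rename, Spine.hsubWith, h1, h2]
      cases Tm.hsubWith red θ N M <;> cases Spine.hsubWith red θ N S <;> rfl
  | _, _, _, _, θ, θ', ρ, ρ', h, N, .papp x S => by
      have h2 := Spine.hsubWith_rename red hred θ θ' ρ ρ' h N S
      simp only [Spine.rename, Spine.hsubWith, h, h2]
      cases θ x <;> cases Spine.hsubWith red θ N S <;> rfl
end

theorem reduce_rename : ∀ (τ : STy) {n m : ℕ} (ρ : Fin n → Fin m) (S : Spine n) (N : Tm n),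
    reduce τ m (S.rename ρ) (N.rename ρ) = (reduce τ n S N).map (Tm.rename ρ)
  | .star, _, _, ρ, S, N => by
      cases S <;> cases N <;> simp [reduce, Spine.rename, Tm.rename]
  | .arr τ₂ τ₁, n, m, ρ, S, N => by
      cases N with
      | neu H T => cases S <;> cases τ₂ <;> simp [reduce, Spine.rename, Tm.rename]
      | lam M =>
        cases S with
        | nil => cases τ₂ <;> simp [reduce, Spine.rename, Tm.rename]
        | app N S =>
          have h := Tm.hsubWith_rename (reduce τ₂) (fun ρ S N => reduce_rename τ₂ ρ S N) theta0 theta0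
            (liftRen ρ) ρ (fun x => by refine Fin.cases rfl (fun j => rfl) x) N M
          simp only [reduce, Spine.rename, Tm.rename, h]
          cases Tm.hsubWith (reduce τ₂) theta0 N M with
          | none => rfl
          | some M' => exact reduce_rename τ₁ ρ S M'
        | papp y S =>
          cases τ₂ with
          | arr _ _ => simp [reduce, Spine.rename, Tm.rename]
          | star =>
            have := reduce_rename τ₁ ρ S (M.rename (instRen y))
            simp only [reduce, Spine.rename, Tm.rename, ← this]
            congr 1
            rw [Tm.rename_liftRen_instRen, Tm.rename_rename]
            congr 1; funext i; refine Fin.cases rfl (fun j => rfl) i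

theorem Tm.hsub_rename {k n k' n' : ℕ} (τ : STy) {θ : Fin k → Option (Fin n)}
    {θ' : Fin k' → Option (Fin n')} {ρ : Fin k → Fin k'} {ρ' : Fin n → Fin n'}
    (h : ∀ x, θ' (ρ x) = (θ x).map ρ') (N : Tm n) (M : Tm k) :
    Tm.hsub τ θ' (N.rename ρ') (M.rename ρ) = (Tm.hsub τ θ N M).map (Tm.rename ρ') :=
  Tm.hsubWith_rename _ (fun ρ S N => reduce_rename τ ρ S N) θ θ' ρ ρ' h N M

theorem liftOpt_liftRen_some {k n l : ℕ} {θ : Fin k → Option (Fin n)} {ρ : Fin l → Fin k}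
    {ρ' : Fin l → Fin n} (h : ∀ x, θ (ρ x) = some (ρ' x)) (x : Fin (l + 1)) :
    liftOpt θ (liftRen ρ x) = some (liftRen ρ' x) := by
  refine Fin.cases rfl (fun j => ?_) x
  simp only [liftRen_succ]
  show (θ (ρ j)).map Fin.succ = _
  rw [h]; rfl

mutual
-- The replaced variable is not in the image of `ρ`, so `red` is never called and may be arbitrary.
theorem Tm.hsubWith_rename_some (red : (n : ℕ) → Spine n → Tm n → Option (Tm n)) :
    ∀ {k n l : ℕ} (θ : Fin k → Option (Fin n)) (ρ : Fin l → Fin k) (ρ' : Fin l → Fin n)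
    (_ : ∀ x, θ (ρ x) = some (ρ' x)) (N : Tm n) (M : Tm l),
    Tm.hsubWith red θ N (M.rename ρ) = some (M.rename ρ')
  | _, _, _, θ, ρ, ρ', h, N, .lam M => by
      simp only [Tm.rename, Tm.hsubWith,
        Tm.hsubWith_rename_some red _ _ _ (liftOpt_liftRen_some h) _ M, Option.map_some]
  | _, _, _, θ, ρ, ρ', h, N, .neu (.var y) S => by
      simp only [Tm.rename, Head.rename, Tm.hsubWith, Spine.hsubWith_rename_some red _ _ _ h N S,
        Option.bind_some, h]
  | _, _, _, θ, ρ, ρ', h, N, .neu (.con c) S => by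
      simp only [Tm.rename, Head.rename, Tm.hsubWith, Spine.hsubWith_rename_some red _ _ _ h N S,
        Option.map_some]
  | _, _, _, θ, ρ, ρ', h, N, .neu (.rc c) S => by
      simp only [Tm.rename, Head.rename, Tm.hsubWith, Spine.hsubWith_rename_some red _ _ _ h N S,
        Option.map_some]
theorem Spine.hsubWith_rename_some (red : (n : ℕ) → Spine n → Tm n → Option (Tm n)) :
    ∀ {k n l : ℕ} (θ : Fin k → Option (Fin n)) (ρ : Fin l → Fin k) (ρ' : Fin l → Fin n)
    (_ : ∀ x, θ (ρ x) = some (ρ' x)) (N : Tm n) (S : Spine l),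
    Spine.hsubWith red θ N (S.rename ρ) = some (S.rename ρ')
  | _, _, _, _, _, _, _, _, .nil => rfl
  | _, _, _, θ, ρ, ρ', h, N, .app M S => by
      simp only [Spine.rename, Spine.hsubWith, Tm.hsubWith_rename_some red _ _ _ h N M,
        Spine.hsubWith_rename_some red _ _ _ h N S, Option.bind_some, Option.map_some]
  | _, _, _, θ, ρ, ρ', h, N, .papp x S => by
      simp only [Spine.rename, Spine.hsubWith, h,
        Spine.hsubWith_rename_some red _ _ _ h N S, Option.bind_some, Option.map_some]
end

theorem Tm.hsub_rename_some {k n l : ℕ} (τ : STy) {θ : Fin k → Option (Fin n)} {ρ : Fin l → Fin k}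
    {ρ' : Fin l → Fin n} (h : ∀ x, θ (ρ x) = some (ρ' x)) (N : Tm n) (M : Tm l) :
    Tm.hsub τ θ N (M.rename ρ) = some (M.rename ρ') :=
  Tm.hsubWith_rename_some _ θ ρ ρ' h N M

theorem Tm.hsub_theta0_rename_succ {n : ℕ} (τ : STy) (N M : Tm n) :
    Tm.hsub τ theta0 N (M.rename Fin.succ) = some M := by
  rw [Tm.hsub_rename_some (θ := theta0) τ (ρ' := fun i : Fin n => i) (fun _ => rfl), Tm.rename_id]

/-! # Renaming and expansion -/

mutual
def BTm.rename : {n m : ℕ} → (Fin n → Fin m) → BTm n → BTm m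
  | _, _, _, .cut => .cut
  | _, _, ρ, .lam M => .lam (M.rename (liftRen ρ))
  | _, _, ρ, .var x S => .var (ρ x) (S.rename ρ)
  | _, _, ρ, .con c S => .con c (S.rename ρ)
def BSp.rename : {n m : ℕ} → (Fin n → Fin m) → BSp n → BSp m
  | _, _, _, .cut => .cut
  | _, _, _, .nil => .nil
  | _, _, ρ, .app M S => .app (M.rename ρ) (S.rename ρ)
  | _, _, ρ, .papp x S => .papp (ρ x) (S.rename ρ)
end

theorem headStep_rename (Ψ : Sig) {n m : ℕ} (ρ : Fin n → Fin m) (H : Head n) (S : Spine n) :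
    headStep Ψ (H.rename ρ) (S.rename ρ)
      = (headStep Ψ H S).map fun p => (p.1.rename ρ, p.2.rename ρ) := by
  cases H with
  | var x => rfl
  | con c => rfl
  | rc r =>
    simp only [Head.rename, headStep]
    cases Ψ[r]? with
    | none => rfl
    | some d =>
      cases d with
      | fam K => rfl
      | con A => rfl
      | defn A M =>
        simp only
        -- The body of a definition is closed, so it may be regarded as renamed along with the
        -- spine.
        rw [← Tm.rename_ofClosed ρ M, reduce_rename]
        cases reduce A.erase n S M.ofClosed with
        | none => rfl
        | some M' => cases M' <;> rfl

mutual
theorem expTmSucc_rename (Ψ : Sig) (ex : (n : ℕ) → Spine n → BSp n)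
    (hex : ∀ {n m : ℕ} (ρ : Fin n → Fin m) (S : Spine n), ex m (S.rename ρ) = (ex n S).rename ρ) :
    ∀ {n m : ℕ} (ρ : Fin n → Fin m) (M : Tm n),
    expTmSucc Ψ ex (M.rename ρ) = (expTmSucc Ψ ex M).rename ρ
  | _, _, ρ, .lam M => by
      simp only [Tm.rename, expTmSucc, expTmSucc_rename Ψ ex hex _ M, BTm.rename]
  | _, _, ρ, .neu H S => by
      simp only [Tm.rename, expTmSucc, headStep_rename]
      cases headStep Ψ H S with
      | none => rfl
      | some p =>
        obtain ⟨H', S'⟩ := p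
        cases H' <;> simp only [Option.map_some, Head.rename, hex, BTm.rename]
theorem expSpSucc_rename (Ψ : Sig) (ex : (n : ℕ) → Spine n → BSp n)
    (hex : ∀ {n m : ℕ} (ρ : Fin n → Fin m) (S : Spine n), ex m (S.rename ρ) = (ex n S).rename ρ) :
    ∀ {n m : ℕ} (ρ : Fin n → Fin m) (S : Spine n),
    expSpSucc Ψ ex (S.rename ρ) = (expSpSucc Ψ ex S).rename ρ
  | _, _, _, .nil => rfl
  | _, _, ρ, .app M S => by
      simp only [Spine.rename, expSpSucc, expTmSucc_rename Ψ ex hex _ M,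
        expSpSucc_rename Ψ ex hex _ S, BSp.rename]
  | _, _, ρ, .papp x S => by
      simp only [Spine.rename, expSpSucc, expSpSucc_rename Ψ ex hex _ S, BSp.rename]
end

theorem expSp_rename (Ψ : Sig) : ∀ (k : ℕ) {n m : ℕ} (ρ : Fin n → Fin m) (S : Spine n),
    expSp Ψ k m (S.rename ρ) = (expSp Ψ k n S).rename ρ
  | 0, _, _, _, _ => rfl
  | k + 1, _, _, ρ, S => expSpSucc_rename Ψ _ (expSp_rename Ψ k) ρ S

theorem expTm_rename (Ψ : Sig) : ∀ (k : ℕ) {n m : ℕ} (ρ : Fin n → Fin m) (M : Tm n),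
    expTm Ψ k (M.rename ρ) = (expTm Ψ k M).rename ρ
  | 0, _, _, _, _ => rfl
  | k + 1, _, _, ρ, M => expTmSucc_rename Ψ _ (expSp_rename Ψ k) ρ M

/-! # Equality of Böhm trees -/

/-- The terms expand to the same Böhm tree. -/
def BEq (Ψ Ψ' : Sig) {n : ℕ} (M M' : Tm n) : Prop := ∀ k, expTm Ψ k M = expTm Ψ' k M'

theorem BEq.symm {Ψ Ψ' : Sig} {n : ℕ} {M M' : Tm n} (h : BEq Ψ Ψ' M M') : BEq Ψ' Ψ M' M :=
  fun k => (h k).symm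

theorem BEq.trans {Ψ Ψ' Ψ'' : Sig} {n : ℕ} {M M' M'' : Tm n} (h : BEq Ψ Ψ' M M')
    (h' : BEq Ψ' Ψ'' M' M'') : BEq Ψ Ψ'' M M'' := fun k => (h k).trans (h' k)

theorem BEq.rename {Ψ Ψ' : Sig} {n m : ℕ} {M M' : Tm n} (h : BEq Ψ Ψ' M M') (ρ : Fin n → Fin m) :
    BEq Ψ Ψ' (M.rename ρ) (M'.rename ρ) := fun k => by rw [expTm_rename, expTm_rename, h k]

/-- Depth is spent only in passing from a head to its spine; abstractions and spine cells keep it.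
The next lemmas record this accounting, on which all inductions on depth rely. -/
theorem expTm_lam (Ψ : Sig) (k : ℕ) {n : ℕ} (M : Tm (n + 1)) :
    expTm Ψ (k + 1) (.lam M) = .lam (expTm Ψ (k + 1) M) := rfl

theorem expTm_con (Ψ : Sig) (k c : ℕ) {n : ℕ} (S : Spine n) :
    expTm Ψ (k + 1) (.neu (.con c) S) = .con c (expSp Ψ k n S) := rfl

theorem expTm_var (Ψ : Sig) (k : ℕ) {n : ℕ} (x : Fin n) (S : Spine n) :
    expTm Ψ (k + 1) (.neu (.var x) S) = .var x (expSp Ψ k n S) := rfl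

theorem expSp_app (Ψ : Sig) (k : ℕ) {n : ℕ} (M : Tm n) (S : Spine n) :
    expSp Ψ (k + 1) n (.app M S) = .app (expTm Ψ (k + 1) M) (expSp Ψ (k + 1) n S) := rfl

theorem expSp_papp (Ψ : Sig) (k : ℕ) {n : ℕ} (x : Fin n) (S : Spine n) :
    expSp Ψ (k + 1) n (.papp x S) = .papp x (expSp Ψ (k + 1) n S) := rfl

theorem expSp_ofList_congr (Ψ Ψ' : Sig) (k : ℕ) {n : ℕ} {l l' : List (Tm n)}
    (h : List.Forall₂ (fun M M' => expTm Ψ k M = expTm Ψ' k M') l l') :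
    expSp Ψ k n (.ofList l) = expSp Ψ' k n (.ofList l') := by
  cases k with
  | zero => rfl
  | succ k =>
    induction h with
    | nil => rfl
    | cons h _ ih => simp only [Spine.ofList, expSp_app, h, ih]

theorem expTm_cst_congr (Ψ Ψ' : Sig) (k c : ℕ) {n : ℕ} {l l' : List (Tm n)}
    (h : List.Forall₂ (fun M M' => expTm Ψ k M = expTm Ψ' k M') l l') :
    expTm Ψ (k + 1) (.cst c l) = expTm Ψ' (k + 1) (.cst c l') := by
  rw [Tm.cst, expTm_con, expSp_ofList_congr Ψ Ψ' k h]; rfl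

theorem BEq.lam_iff {Ψ Ψ' : Sig} {n : ℕ} {M M' : Tm (n + 1)} :
    BEq Ψ Ψ' (.lam M) (.lam M') ↔ BEq Ψ Ψ' M M' := by
  constructor
  · intro h k
    cases k with
    | zero => rfl
    | succ k => exact BTm.lam.inj (h (k + 1))
  · intro h k
    cases k with
    | zero => rfl
    | succ k => rw [expTm_lam, expTm_lam, h]

theorem forall₂_of_expSp_ofList {Ψ Ψ' : Sig} {n : ℕ} : ∀ {l l' : List (Tm n)},
    (∀ k, expSp Ψ k n (.ofList l) = expSp Ψ' k n (.ofList l')) → List.Forall₂ (BEq Ψ Ψ') l l'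
  | [], [], _ => .nil
  | [], _ :: _, h => nomatch h 1
  | _ :: _, [], h => nomatch h 1
  | M :: l, M' :: l', h => by
      refine .cons (fun k => ?_) (forall₂_of_expSp_ofList fun k => ?_)
      · cases k with
        | zero => rfl
        | succ k => exact (BSp.app.inj (h (k + 1))).1
      · cases k with
        | zero => rfl
        | succ k => exact (BSp.app.inj (h (k + 1))).2

theorem BEq.cst_iff {Ψ Ψ' : Sig} {n c c' : ℕ} {l l' : List (Tm n)} :
    BEq Ψ Ψ' (.cst c l) (.cst c' l') ↔ c = c' ∧ List.Forall₂ (BEq Ψ Ψ') l l' := by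
  constructor
  · intro h
    refine ⟨(BTm.con.inj (h 1)).1, forall₂_of_expSp_ofList fun k => (BTm.con.inj (h (k + 1))).2⟩
  · rintro ⟨rfl, h⟩ k
    cases k with
    | zero => rfl
    | succ k => exact expTm_cst_congr _ _ _ _ (h.imp fun _ _ h => h k)

/-! # Soundness of term equality -/

def Head.IsRc {n : ℕ} : Head n → Prop
  | .rc _ => True
  | _ => False

/-- A neutral term whose head is no recursion constant. -/
def Tm.Whnf {n : ℕ} : Tm n → Prop
  | .neu H _ => ¬ H.IsRc
  | .lam _ => False

theorem Head.isRc_rename {n m : ℕ} (ρ : Fin n → Fin m) (H : Head n) :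
    (H.rename ρ).IsRc ↔ H.IsRc := by cases H <;> rfl

theorem Tm.Contra.of_lam {n : ℕ} {M : Tm (n + 1)} (h : (Tm.lam M).Contra) : M.Contra := by
  cases h; assumption

/-- Prepattern arguments only rename the body, so its head survives and no new redex arises. -/
theorem reduce_whnf : ∀ {n : ℕ} {S : Spine n} {τ : STy} {M M' : Tm n}, S.Prepat → M.Contra →
    reduce τ n S M = some M' → M'.Whnf
  | _, .nil, τ, .lam _, _, _, _, h => by
      cases τ with
      | star => simp [reduce] at h
      | arr τ₂ τ₁ => cases τ₂ <;> simp [reduce] at h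
  | _, .nil, τ, .neu H S, M', _, hM, h => by
      cases τ with
      | star =>
        simp only [reduce, Option.some.injEq] at h
        subst h
        cases hM <;> exact id
      | arr τ₂ τ₁ => cases τ₂ <;> simp [reduce] at h
  | _, .papp y S, τ, .neu _ _, _, _, _, h => by
      cases τ with
      | star => simp [reduce] at h
      | arr τ₂ τ₁ => cases τ₂ <;> simp [reduce] at h
  | _, .papp y S, τ, .lam M, M', hS, hM, h => by
      cases τ with
      | star => simp [reduce] at h
      | arr τ₂ τ₁ =>
        cases τ₂ with
        | arr _ _ => simp [reduce] at h
        | star =>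
          cases hS with
          | papp hS => exact reduce_whnf hS (hM.of_lam.rename _) h

theorem headStep_of_reduce {Ψ : Sig} {n r : ℕ} {A : Ty 0} {M : Tm 0} {S S' : Spine n} {H : Head n}
    (hr : Ψ[r]? = some (.defn A M)) (h : reduce A.erase n S M.ofClosed = some (.neu H S')) :
    headStep Ψ (.rc r) S = some (H, S') := by
  simp only [headStep, hr, h]

theorem expTm_of_reduce {Ψ : Sig} {n r : ℕ} {A : Ty 0} {M : Tm 0} {S : Spine n} {M' : Tm n}
    (hr : Ψ[r]? = some (.defn A M)) (h : reduce A.erase n S M.ofClosed = some M') (hM' : M'.Whnf) :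
    ∀ k, expTm Ψ k (.neu (.rc r) S) = expTm Ψ k M'
  | 0 => rfl
  | k + 1 => by
      cases M' with
      | lam M => exact hM'.elim
      | neu H S' =>
        simp only [expTm, expTmSucc, headStep_of_reduce hr h]
        cases H with
        | rc r => exact (hM' trivial).elim
        | var x => rfl
        | con c => rfl

/-- The two sides of an assumption agree up to depth `k`. -/
def EqHyp.Holds (Ψ : Sig) (k : ℕ) (h : EqHyp) : Prop :=
  expTm Ψ k (.neu h.lhsHead h.lhsSpine) = expTm Ψ k (.neu h.rhsHead h.rhsSpine)

/-- The assumption holds to depth `k`, unless it is not applicable at the root of the goal. -/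
def EqHyp.HoldsOrIdle (Ψ : Sig) (k : ℕ) {n : ℕ} (M M' : Tm n) (h : EqHyp) : Prop :=
  h.Holds Ψ k ∨ (M.Whnf ∧ h.lhsHead.IsRc) ∨ (M.Whnf ∧ M'.Whnf ∧ h.rhsHead.IsRc)

mutual
-- The difficulty is that an assumption could be used at once, before any constructor has been
-- passed. An unfolding adds an assumption with a recursion constant on one side and turns that side
-- of the goal into a `Whnf`, which the assumption does not match. So it is idle at the current
-- depth and is needed only at smaller depths, where the induction on depth provides it.
theorem EqTm.expTm_eq {Ψ : Sig} : ∀ {Δ : List EqHyp} {n : ℕ} {M M' : Tm n}, EqTm Ψ Δ M M' → ∀ k,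
    (∀ h ∈ Δ, ∀ j ≤ k, h.Holds Ψ j) → (∀ h ∈ Δ, h.HoldsOrIdle Ψ (k + 1) M M') →
    expTm Ψ (k + 1) M = expTm Ψ (k + 1) M'
  | Δ, n, _, _, .hyp h ρ hmem, k, _, h2 => by
      rcases h2 h hmem with h3 | ⟨h3, h4⟩ | ⟨_, h3, h4⟩
      · have := congrArg (BTm.rename ρ) h3
        rw [← expTm_rename, ← expTm_rename] at this
        exact this
      · exact (h3 ((Head.isRc_rename _ _).2 h4)).elim
      · exact (h3 ((Head.isRc_rename _ _).2 h4)).elim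
  | Δ, n, _, _, @EqTm.unfoldL _ _ _ r A M S₁ S₂ H M' hr hS hM hred hd, k, h1, h2 => by
      have hM' := reduce_whnf hS (hM.rename _) hred
      have hexp := expTm_of_reduce hr hred hM'
      -- The left side of the goal is a recursion constant, hence not `Whnf`, so no older assumption
      -- is idle and all of them hold at full depth.
      have hΔ : ∀ h ∈ Δ, ∀ j ≤ k + 1, h.Holds Ψ j := by
        intro h hmem j hj
        rcases Nat.lt_or_ge k j with hjk | hjk
        · obtain rfl : j = k + 1 := by omega
          rcases h2 h hmem with h3 | ⟨h3, _⟩ | ⟨h3, _⟩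
          · exact h3
          · exact (h3 trivial).elim
          · exact (h3 trivial).elim
        · exact h1 h hmem j hjk
      -- All depths are treated together, because the assumption added by the unfolding must hold at
      -- every smaller depth.
      have key : ∀ j, j ≤ k + 1 → expTm Ψ j (.neu (.rc r) S₁) = expTm Ψ j (.neu H S₂) := by
        intro j
        induction j using Nat.strong_induction_on with
        | _ j ih =>
          intro hj
          cases j with
          | zero => rfl
          | succ j =>
            rw [hexp]
            refine EqTm.expTm_eq hd j ?_ ?_
            · intro h hmem i hi
              rcases List.mem_cons.1 hmem with rfl | hmem
              · exact ih i (by omega) (by omega)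
              · exact hΔ h hmem i (by omega)
            · intro h hmem
              rcases List.mem_cons.1 hmem with rfl | hmem
              · exact .inr (.inl ⟨hM', trivial⟩)
              · exact .inl (hΔ h hmem _ hj)
      exact key _ le_rfl
  | Δ, n, _, _, @EqTm.unfoldR _ _ _ r A M S₁ S₂ H M' hr hS hM hH hred hd, k, h1, h2 => by
      have hM' := reduce_whnf hS (hM.rename _) hred
      have hexp := expTm_of_reduce hr hred hM'
      have hL : (Tm.neu H S₁).Whnf := by
        cases H with
        | rc r' => exact (hH r' rfl).elim
        | var x => exact id
        | con c => exact id
      have key : ∀ j, j ≤ k + 1 → expTm Ψ j (.neu H S₁) = expTm Ψ j (.neu (.rc r) S₂) := by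
        intro j
        induction j using Nat.strong_induction_on with
        | _ j ih =>
          intro hj
          cases j with
          | zero => rfl
          | succ j =>
            rw [hexp]
            refine EqTm.expTm_eq hd j ?_ ?_
            · intro h hmem i hi
              rcases List.mem_cons.1 hmem with rfl | hmem
              · exact ih i (by omega) (by omega)
              · exact h1 h hmem i (by omega)
            · intro h hmem
              rcases List.mem_cons.1 hmem with rfl | hmem
              · exact .inr (.inr ⟨hL, hM', trivial⟩)
              · rcases Nat.lt_or_ge j k with hjk | hjk
                · exact .inl (h1 h hmem _ hjk)
                · obtain rfl : j = k := by omega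
                  -- At full depth an assumption that was idle because of its left side stays idle,
                  -- as the left side of the goal is unchanged. It cannot have been idle because of
                  -- its right side, for the right side of the goal is a recursion constant.
                  rcases h2 h hmem with h3 | ⟨_, h3⟩ | ⟨_, h3, _⟩
                  · exact .inl h3
                  · exact .inr (.inl ⟨hL, h3⟩)
                  · exact (h3 trivial).elim
      exact key _ le_rfl
  | Δ, n, _, _, .con hs, k, h1, _ => by rw [expTm_con, expTm_con, EqSp.expSp_eq hs k h1]
  | Δ, n, _, _, .var hs, k, h1, _ => by rw [expTm_var, expTm_var, EqSp.expSp_eq hs k h1]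
  | Δ, n, _, _, .lam hd, k, h1, h2 => by
      rw [expTm_lam, expTm_lam, EqTm.expTm_eq hd k h1]
      intro h hmem
      rcases h2 h hmem with h3 | ⟨h3, _⟩ | ⟨h3, _⟩
      · exact .inl h3
      · exact h3.elim
      · exact h3.elim
theorem EqSp.expSp_eq {Ψ : Sig} : ∀ {Δ : List EqHyp} {n : ℕ} {S S' : Spine n}, EqSp Ψ Δ S S' → ∀ k,
    (∀ h ∈ Δ, ∀ j ≤ k, h.Holds Ψ j) → expSp Ψ k n S = expSp Ψ k n S'
  | _, _, _, _, _, 0, _ => rfl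
  | _, _, _, _, .nil, k + 1, _ => rfl
  | _, _, _, _, .app hd hs, k + 1, h1 => by
      rw [expSp_app, expSp_app, EqSp.expSp_eq hs (k + 1) h1,
        EqTm.expTm_eq hd k (fun h hm j hj => h1 h hm j (by omega))
          (fun h hm => .inl (h1 h hm _ le_rfl))]
  | _, _, _, _, .papp hs, k + 1, h1 => by
      rw [expSp_papp, expSp_papp, EqSp.expSp_eq hs (k + 1) h1]
end

theorem EqTm.bEq {Ψ : Sig} {n : ℕ} {M M' : Tm n} (h : EqTm Ψ [] M M') : BEq Ψ Ψ M M'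
  | 0 => rfl
  | k + 1 => h.expTm_eq k (by simp) (by simp)

-- Reflexivity of equality in the absence of recursion constants.

mutual
/-- No recursion constant occurs. -/
def Tm.RcFree : {n : ℕ} → Tm n → Prop
  | _, .lam M => M.RcFree
  | _, .neu H S => ¬ H.IsRc ∧ S.RcFree
def Spine.RcFree : {n : ℕ} → Spine n → Prop
  | _, .nil => True
  | _, .app M S => M.RcFree ∧ S.RcFree
  | _, .papp _ S => S.RcFree
end

def Ty.RcFree : {n : ℕ} → Ty n → Prop
  | _, .atom _ S => S.RcFree
  | _, .pi _ A B => A.RcFree ∧ B.RcFree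

mutual
-- Recursion constants are excluded because equality has no congruence rule for them: they are
-- compared by unfolding or by an assumption.
theorem EqTm.refl (Ψ : Sig) (Δ : List EqHyp) : ∀ {n : ℕ} (M : Tm n), M.RcFree → EqTm Ψ Δ M M
  | _, .lam M, h => .lam (EqTm.refl Ψ Δ M h)
  | _, .neu (.var _) S, h => .var (EqSp.refl Ψ Δ S h.2)
  | _, .neu (.con _) S, h => .con (EqSp.refl Ψ Δ S h.2)
  | _, .neu (.rc _) _, h => (h.1 trivial).elim
theorem EqSp.refl (Ψ : Sig) (Δ : List EqHyp) : ∀ {n : ℕ} (S : Spine n), S.RcFree → EqSp Ψ Δ S S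
  | _, .nil, _ => .nil
  | _, .app M S, h => .app (EqTm.refl Ψ Δ M h.1) (EqSp.refl Ψ Δ S h.2)
  | _, .papp _ S, h => .papp (EqSp.refl Ψ Δ S h)
end

theorem EqTy.refl (Ψ : Sig) : ∀ {n : ℕ} (A : Ty n), A.RcFree → EqTy Ψ A A
  | _, .atom _ S, h => .atom (EqSp.refl Ψ [] S h)
  | _, .pi _ A B, h => .pi (EqTy.refl Ψ A h.1) (EqTy.refl Ψ B h.2)

/-! # First-order terms and simultaneous substitution -/

/-- A term as an argument of a spine; a variable becomes a prepattern argument. -/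
def Tm.asArg {n : ℕ} : Tm n → Spine n → Spine n
  | .neu (.var y) .nil, S => .papp y S
  | M, S => .app M S

/-- The simultaneous substitution extended under a binder. -/
def liftTm {k n : ℕ} (θ : Fin k → Tm n) : Fin (k + 1) → Tm (n + 1) :=
  Fin.cases (.v 0 []) (fun i => (θ i).rename Fin.succ)

mutual
/-- Simultaneous substitution for variables without arguments. -/
def Tm.fsub : {k n : ℕ} → (Fin k → Tm n) → Tm k → Tm n
  | _, _, θ, .lam M => .lam (M.fsub (liftTm θ))
  | _, _, θ, .neu (.var x) _ => θ x
  | _, _, θ, .neu (.con c) S => .neu (.con c) (S.fsub θ)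
  | _, _, θ, .neu (.rc r) S => .neu (.rc r) (S.fsub θ)
def Spine.fsub : {k n : ℕ} → (Fin k → Tm n) → Spine k → Spine n
  | _, _, _, .nil => .nil
  | _, _, θ, .app M S => .app (M.fsub θ) (S.fsub θ)
  | _, _, θ, .papp x S => (θ x).asArg (S.fsub θ)
end

def Ty.fsub : {k n : ℕ} → (Fin k → Tm n) → Ty k → Ty n
  | _, _, θ, .atom a S => .atom a (S.fsub θ)
  | _, _, θ, .pi m A B => .pi m (A.fsub θ) (B.fsub (liftTm θ))

/-- The modes of a context extended by a variable of mode `p`. -/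
def consMode {n : ℕ} (p : Mode) (m : Fin n → Mode) : Fin (n + 1) → Mode := Fin.cases p m

mutual
/-- Terms without arguments of variables, in which only recursion constants have prepattern
arguments, of mode `pre`. -/
inductive FO : {n : ℕ} → (Fin n → Mode) → Tm n → Prop
  | lam {n : ℕ} {m : Fin n → Mode} {M : Tm (n + 1)} : FO (consMode .ord m) M → FO m (.lam M)
  | var {n : ℕ} {m : Fin n → Mode} {x : Fin n} : FO m (.neu (.var x) .nil)
  | con {n : ℕ} {m : Fin n → Mode} {c : ℕ} {S : Spine n} : FOs m S → FO m (.neu (.con c) S)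
  | rc {n : ℕ} {m : Fin n → Mode} {r : ℕ} {S : Spine n} : FOs m S → FO m (.neu (.rc r) S)
inductive FOs : {n : ℕ} → (Fin n → Mode) → Spine n → Prop
  | nil {n : ℕ} {m : Fin n → Mode} : FOs m .nil
  | app {n : ℕ} {m : Fin n → Mode} {M : Tm n} {S : Spine n} : FO m M → FOs m S → FOs m (.app M S)
  | papp {n : ℕ} {m : Fin n → Mode} {x : Fin n} {S : Spine n} : m x = .pre → FOs m S →
      FOs m (.papp x S)
end

theorem liftTm_comp_liftRen {k l n : ℕ} (ρ : Fin k → Fin l) (θ : Fin l → Tm n) :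
    (fun i => liftTm θ (liftRen ρ i)) = liftTm (fun i => θ (ρ i)) := by
  funext i; refine Fin.cases rfl (fun j => rfl) i

mutual
theorem Tm.fsub_of_rename : ∀ {k l n : ℕ} (ρ : Fin k → Fin l) (θ : Fin l → Tm n) (M : Tm k),
    (M.rename ρ).fsub θ = M.fsub (fun i => θ (ρ i))
  | _, _, _, ρ, θ, .lam M => by
      simp only [Tm.rename, Tm.fsub, Tm.fsub_of_rename _ _ M, liftTm_comp_liftRen]
  | _, _, _, ρ, θ, .neu (.var x) S => rfl
  | _, _, _, ρ, θ, .neu (.con x) S => by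
      simp only [Tm.rename, Head.rename, Tm.fsub, Spine.fsub_of_rename _ _ S]
  | _, _, _, ρ, θ, .neu (.rc x) S => by
      simp only [Tm.rename, Head.rename, Tm.fsub, Spine.fsub_of_rename _ _ S]
theorem Spine.fsub_of_rename : ∀ {k l n : ℕ} (ρ : Fin k → Fin l) (θ : Fin l → Tm n) (S : Spine k),
    (S.rename ρ).fsub θ = S.fsub (fun i => θ (ρ i))
  | _, _, _, _, _, .nil => rfl
  | _, _, _, ρ, θ, .app M S => by
      simp only [Spine.rename, Spine.fsub, Tm.fsub_of_rename _ _ M, Spine.fsub_of_rename _ _ S]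
  | _, _, _, ρ, θ, .papp x S => by
      simp only [Spine.rename, Spine.fsub, Spine.fsub_of_rename _ _ S]
end

theorem liftTm_var {k n : ℕ} (ρ : Fin k → Fin n) :
    liftTm (fun i => Tm.v (ρ i) []) = fun i => Tm.v (liftRen ρ i) [] := by
  funext i; refine Fin.cases rfl (fun j => rfl) i

mutual
theorem FO.fsub_var : ∀ {k n : ℕ} {m : Fin k → Mode} (ρ : Fin k → Fin n) {M : Tm k}, FO m M →
    M.fsub (fun i => .v (ρ i) []) = M.rename ρ
  | _, _, _, ρ, _, .lam h => by
      simp only [Tm.fsub, Tm.rename, liftTm_var, FO.fsub_var _ h]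
  | _, _, _, ρ, _, .var => rfl
  | _, _, _, ρ, _, .con h => by simp only [Tm.fsub, Tm.rename, FOs.fsub_var ρ h, Head.rename]
  | _, _, _, ρ, _, .rc h => by simp only [Tm.fsub, Tm.rename, FOs.fsub_var ρ h, Head.rename]
theorem FOs.fsub_var : ∀ {k n : ℕ} {m : Fin k → Mode} (ρ : Fin k → Fin n) {S : Spine k}, FOs m S →
    S.fsub (fun i => .v (ρ i) []) = S.rename ρ
  | _, _, _, ρ, _, .nil => rfl
  | _, _, _, ρ, _, .app h h' => by
      simp only [Spine.fsub, Spine.rename, FO.fsub_var ρ h, FOs.fsub_var ρ h']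
  | _, _, _, ρ, _, .papp _ h => by
      simp only [Spine.fsub, Spine.rename, FOs.fsub_var ρ h]; rfl
end

theorem FO.fsub_v {k : ℕ} {m : Fin k → Mode} {M : Tm k} (h : FO m M) :
    M.fsub (fun i => .v i []) = M := by
  rw [h.fsub_var (fun i => i), Tm.rename_id]

/-- `θ'` is `θ` followed by the hereditary substitution of `N` according to `χ`. -/
structure Follows {k n p : ℕ} (τ : STy) (χ : Fin n → Option (Fin p)) (N : Tm p) (m : Fin k → Mode)
    (θ : Fin k → Tm n) (θ' : Fin k → Tm p) : Prop where
  hsub : ∀ x, Tm.hsub τ χ N (θ x) = some (θ' x)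
  pre : ∀ x, m x = .pre → ∃ y y', θ x = .v y [] ∧ θ' x = .v y' [] ∧ χ y = some y'

theorem Follows.lift {k n p : ℕ} {τ : STy} {χ : Fin n → Option (Fin p)} {N : Tm p}
    {m : Fin k → Mode} {θ : Fin k → Tm n} {θ' : Fin k → Tm p} (h : Follows τ χ N m θ θ') (q : Mode) :
    Follows τ (liftOpt χ) (N.rename Fin.succ) (consMode q m) (liftTm θ) (liftTm θ') where
  hsub x := by
    refine Fin.cases rfl (fun j => ?_) x
    show Tm.hsub τ (liftOpt χ) _ ((θ j).rename Fin.succ) = some ((θ' j).rename Fin.succ)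
    rw [Tm.hsub_rename (θ := χ) τ (fun _ => rfl), h.hsub]; rfl
  pre x := by
    refine Fin.cases (fun _ => ⟨0, 0, rfl, rfl, rfl⟩) (fun j hj => ?_) x
    obtain ⟨y, y', h1, h2, h3⟩ := h.pre j hj
    refine ⟨y.succ, y'.succ, ?_, ?_, ?_⟩
    · show (θ j).rename _ = _
      rw [h1]; rfl
    · show (θ' j).rename _ = _
      rw [h2]; rfl
    · show (χ y).map _ = _
      rw [h3]; rfl

mutual
-- In a first-order term a variable head has an empty spine, so substitution there amounts to
-- looking up `θ`. A prepattern argument must become a variable again, which is the role of the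
-- field `pre` of `Follows`.
theorem FO.hsub_fsub : ∀ {k n p : ℕ} {τ : STy} {χ : Fin n → Option (Fin p)} {N : Tm p}
    {m : Fin k → Mode} {θ : Fin k → Tm n} {θ' : Fin k → Tm p}, Follows τ χ N m θ θ' → ∀ {M : Tm k},
    FO m M → Tm.hsub τ χ N (M.fsub θ) = some (M.fsub θ')
  | _, _, _, _, _, _, _, _, _, h, _, .lam hM => by
      have := FO.hsub_fsub (h.lift .ord) hM
      simp only [Tm.hsub] at this
      simp only [Tm.fsub, Tm.hsub, Tm.hsubWith, this, Option.map_some]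
  | _, _, _, _, _, _, _, _, _, h, _, .var => h.hsub _
  | _, _, _, _, _, _, _, _, _, h, _, .con hS => by
      have := FOs.hsub_fsub h hS
      simp only [Spine.hsub] at this
      simp only [Tm.fsub, Tm.hsub, Tm.hsubWith, this, Option.map_some]
  | _, _, _, _, _, _, _, _, _, h, _, .rc hS => by
      have := FOs.hsub_fsub h hS
      simp only [Spine.hsub] at this
      simp only [Tm.fsub, Tm.hsub, Tm.hsubWith, this, Option.map_some]
theorem FOs.hsub_fsub : ∀ {k n p : ℕ} {τ : STy} {χ : Fin n → Option (Fin p)} {N : Tm p}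
    {m : Fin k → Mode} {θ : Fin k → Tm n} {θ' : Fin k → Tm p}, Follows τ χ N m θ θ' →
    ∀ {S : Spine k}, FOs m S → Spine.hsub τ χ N (S.fsub θ) = some (S.fsub θ')
  | _, _, _, _, _, _, _, _, _, _, _, .nil => rfl
  | _, _, _, _, _, _, _, _, _, h, _, .app hM hS => by
      have h1 := FO.hsub_fsub h hM
      have h2 := FOs.hsub_fsub h hS
      simp only [Tm.hsub] at h1
      simp only [Spine.hsub] at h2
      simp only [Spine.fsub, Spine.hsub, Spine.hsubWith, h1, h2, Option.bind_some, Option.map_some]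
  | _, _, _, _, _, _, _, _, _, h, _, .papp hx hS => by
      have h2 := FOs.hsub_fsub h hS
      obtain ⟨y, y', e, e', e''⟩ := h.pre _ hx
      simp only [Spine.hsub] at h2
      simp only [Spine.fsub, e, e']
      simp only [Tm.v, Spine.ofList, Tm.asArg, Spine.hsub, Spine.hsubWith, h2, e'',
        Option.bind_some, Option.map_some]
end

/-- First-order types. -/
inductive FOTy : {n : ℕ} → (Fin n → Mode) → Ty n → Prop
  | atom {n a : ℕ} {m : Fin n → Mode} {S : Spine n} : FOs m S → FOTy m (.atom a S)
  | pi {n : ℕ} {m : Fin n → Mode} {p : Mode} {A : Ty n} {B : Ty (n + 1)} : FOTy m A →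
      FOTy (consMode p m) B → FOTy m (.pi p A B)

theorem FOTy.hsub_fsub {k : ℕ} {m : Fin k → Mode} {A : Ty k} (hA : FOTy m A) : ∀ {n p : ℕ} {τ : STy}
    {χ : Fin n → Option (Fin p)} {N : Tm p} {θ : Fin k → Tm n} {θ' : Fin k → Tm p},
    Follows τ χ N m θ θ' → Ty.hsub τ χ N (A.fsub θ) = some (A.fsub θ') := by
  induction hA with
  | atom hS =>
    intro n p τ χ N θ θ' h
    simp only [Ty.fsub, Ty.hsub, FOs.hsub_fsub h hS, Option.map_some]
  | pi _ _ ihA ihB =>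
    intro n p τ χ N θ θ' h
    simp only [Ty.fsub, Ty.hsub, ihA h, ihB (h.lift _), Option.bind_some, Option.map_some]

/-- Instantiation of the innermost variable. -/
def consTm {k n : ℕ} (N : Tm n) (θ : Fin k → Tm n) : Fin (k + 1) → Tm n := Fin.cases N θ

/-- The instantiated variable is ordinary, so the requirement on prepattern variables is vacuous for
it; the result of replacing it is neutral, so reduction at the base type returns it unchanged. -/
theorem Follows.inst {k n : ℕ} {m : Fin k → Mode} {θ : Fin k → Tm n} {H : Head n} {S : Spine n}
    (hm : ∀ x, m x = .pre → ∃ y, θ x = .v y []) :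
    Follows .star theta0 (.neu H S) (consMode .ord m) (liftTm θ) (consTm (.neu H S) θ) where
  hsub x := by
    refine Fin.cases ?_ (fun j => ?_) x
    · show Tm.hsub .star theta0 (.neu H S) (.neu (.var 0) .nil) = some (.neu H S)
      simp only [Tm.hsub, Tm.hsubWith, Spine.hsubWith, Option.bind_some]
      rfl
    · exact Tm.hsub_theta0_rename_succ _ _ _
  pre x := by
    refine Fin.cases (fun h => nomatch h) (fun j hj => ?_) x
    obtain ⟨y, hy⟩ := hm j hj
    refine ⟨y.succ, y, ?_, hy, rfl⟩
    show (θ j).rename _ = _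
    rw [hy]; rfl

/-- Hereditary substitution of a neutral term of atomic type. -/
theorem FO.hsub_star {k n : ℕ} {m : Fin k → Mode} {M : Tm k} (hM : FO m M)
    {χ : Fin k → Option (Fin n)} {H : Head n} {S : Spine n} (hm : ∀ x, m x = .pre → χ x ≠ none) :
    Tm.hsub .star χ (.neu H S) M
      = some (M.fsub fun x => (χ x).elim (.neu H S) fun y => .v y []) := by
  conv_lhs => rw [← hM.fsub_v]
  refine FO.hsub_fsub ⟨fun x => ?_, fun x hx => ?_⟩ hM
  · simp only [Tm.v, Spine.ofList, Tm.hsub, Tm.hsubWith, Spine.hsubWith, Option.bind_some]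
    cases χ x <;> rfl
  · obtain ⟨y, hy⟩ := Option.ne_none_iff_exists'.1 (hm x hx)
    exact ⟨x, y, rfl, by rw [hy]; rfl, hy⟩

/-! # Contexts of variables of type `tp` -/

theorem tpCtx_get : ∀ {n : ℕ} (m : Fin n → Mode) (x : Fin n), (tpCtx m).get x = (m x, .tp)
  | 0, _, x => x.elim0
  | n + 1, m, x => by
      refine Fin.cases rfl (fun j => ?_) x
      show (((tpCtx fun i => m i.succ).get j).1, ((tpCtx fun i => m i.succ).get j).2.rename Fin.succ) = _
      rw [tpCtx_get]; rfl

/-! # Closing abstractions -/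

/-- The prepattern spine of the variables `f`, the outermost first, followed by `T`. -/
def pv {n : ℕ} : {k : ℕ} → (Fin k → Fin n) → Spine n → Spine n
  | 0, _, T => T
  | _ + 1, f, T => pv (fun i => f i.succ) (.papp (f 0) T)

theorem foldl_papp {n : ℕ} : ∀ {k : ℕ} (f : Fin k → Fin n) (T : Spine n),
    (List.finRange k).foldl (fun S x => .papp (f x) S) T = pv f T
  | 0, _, _ => rfl
  | k + 1, f, T => by
      rw [List.finRange_succ, List.foldl_cons, List.foldl_map, foldl_papp (fun i => f i.succ)]; rfl

theorem allVars_eq (n : ℕ) : allVars n = pv (fun i : Fin n => i) .nil := foldl_papp _ _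

theorem pv_rename {n n' : ℕ} (ρ : Fin n → Fin n') : ∀ {k : ℕ} (f : Fin k → Fin n) (T : Spine n),
    (pv f T).rename ρ = pv (fun i => ρ (f i)) (T.rename ρ)
  | 0, _, _ => rfl
  | k + 1, f, T => by rw [pv, pv_rename ρ]; rfl

theorem pv_prepat {n : ℕ} : ∀ {k : ℕ} (f : Fin k → Fin n) {T : Spine n}, T.Prepat → (pv f T).Prepat
  | 0, _, _, h => h
  | _ + 1, f, _, h => pv_prepat (fun i => f i.succ) (.papp h)

theorem pv_fOs {n : ℕ} {m : Fin n → Mode} : ∀ {k : ℕ} (f : Fin k → Fin n) {T : Spine n},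
    (∀ x, m (f x) = .pre) → FOs m T → FOs m (pv f T)
  | 0, _, _, _, h => h
  | _ + 1, f, _, hf, h => pv_fOs (fun i => f i.succ) (fun i => hf i.succ) (.papp (hf 0) h)

theorem pv_fsub {n n' : ℕ} (θ : Fin n → Tm n') : ∀ {k : ℕ} (f : Fin k → Fin n)
    (g : Fin k → Fin n') (T : Spine n), (∀ i, θ (f i) = .v (g i) []) →
    (pv f T).fsub θ = pv g (T.fsub θ)
  | 0, _, _, _, _ => rfl
  | k + 1, f, g, T, h => by
      rw [pv, pv_fsub θ _ (fun i => g i.succ) _ (fun i => h i.succ), pv]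
      simp only [Spine.fsub, h]; rfl

theorem liftRen_comp_cases {k n : ℕ} (f : Fin (k + 1) → Fin n) :
    (Fin.cases (f 0) (fun i => f i.succ) : Fin (k + 1) → Fin n) = f := by
  funext i; refine Fin.cases rfl (fun j => rfl) i

/-- Applying a closure to a tuple of variables is the renaming by that tuple: each step instantiates
one abstraction, and the instantiations accumulate in `f`. -/
theorem reduce_close {n : ℕ} : ∀ {k : ℕ} (A : Ty k) (M : Tm k) (f : Fin k → Fin n) (T : Spine n),
    reduce A.close.erase n (pv f T) M.close.ofClosed = reduce A.erase n T (M.rename f)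
  | 0, A, M, f, T => by
      rw [show f = Fin.elim0 from funext fun i => i.elim0]; rfl
  | k + 1, A, M, f, T => by
      rw [Ty.close, Tm.close, pv, reduce_close]
      simp only [Ty.erase, Tm.rename, reduce]
      rw [Tm.rename_liftRen_instRen, liftRen_comp_cases]

section
variable {Ξ Ψ : Sig} {fwd : Prop}

theorem chkSp_papp_tp {n : ℕ} {m : Fin n → Mode} {y : Fin n} {S : Spine n} {A : Ty (n + 1)}
    {P : Ty n} : ChkSp Ξ Ψ fwd (tpCtx m) (.papp y S) (.pi .pre .tp A) P ↔
    m y = .pre ∧ ChkSp Ξ Ψ fwd (tpCtx m) S (A.rename (instRen y)) P := by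
  constructor
  · intro h
    cases h with
    | papp h1 h2 h3 => exact ⟨by rwa [tpCtx_get] at h1, h3⟩
  · rintro ⟨h1, h2⟩
    refine .papp (by rw [tpCtx_get]; exact h1) ?_ h2
    rw [tpCtx_get]; exact EqTy.refl _ _ trivial

theorem chkSp_close {n : ℕ} {m : Fin n → Mode} : ∀ {k : ℕ} (A : Ty k) (f : Fin k → Fin n)
    (T : Spine n) (P : Ty n), ChkSp Ξ Ψ fwd (tpCtx m) (pv f T) A.close.ofClosed P ↔
      (∀ x, m (f x) = .pre) ∧ ChkSp Ξ Ψ fwd (tpCtx m) T (A.rename f) P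
  | 0, A, f, T, P => by
      rw [show f = Fin.elim0 from funext fun i => i.elim0]
      exact ⟨fun h => ⟨fun i => i.elim0, h⟩, fun h => h.2⟩
  | k + 1, A, f, T, P => by
      rw [Ty.close, pv, chkSp_close]
      simp only [Ty.rename]
      rw [show (Ty.tp : Ty k).rename (fun i => f i.succ) = .tp from rfl, chkSp_papp_tp,
        Ty.rename_liftRen_instRen, liftRen_comp_cases, Fin.forall_fin_succ]
      tauto

theorem eqTy_tp_left {n : ℕ} {A : Ty n} (h : EqTy Ψ .tp A) : A = .tp := by
  cases h with
  | atom h => cases h; rfl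

theorem eqTy_tp_right {n : ℕ} {A : Ty n} (h : EqTy Ψ A .tp) : A = .tp := by
  cases h with
  | atom h => cases h; rfl

theorem Ty.eq_tp_of_rename {n k : ℕ} {ρ : Fin n → Fin k} {A : Ty n} (h : A.rename ρ = .tp) :
    A = .tp := by
  cases A with
  | pi m A B => cases h
  | atom a S =>
    cases S with
    | nil => injection h with h1 h2; subst h2; rfl
    | app M S => cases h
    | papp M S => cases h

/-- The type of a recursion constant that is applied in a context of variables of type `tp`. -/
theorem ChkSp.exists_close {n : ℕ} {m : Fin n → Mode} : ∀ {i : ℕ} {A : Ty i}, A.Prepat →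
    ∀ (ρ : Fin i → Fin n) {S : Spine n} {P : Ty n}, ChkSp Ξ Ψ fwd (tpCtx m) S (A.rename ρ) P →
    ∃ (k a : ℕ) (T : Spine k) (f : Fin k → Fin n), A.close = (Ty.atom a T).close ∧
      pv ρ S = pv f .nil ∧ P = .atom a (T.rename f) := by
  intro i A hA
  induction hA with
  | @atom i a T =>
    intro ρ S P h
    cases h
    exact ⟨i, a, T, ρ, rfl, rfl, rfl⟩
  | @pi i A B hB ih =>
    intro ρ S P h
    simp only [Ty.rename] at h
    cases h with
    | @papp _ _ y S _ _ _ h1 h2 h3 =>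
      rw [tpCtx_get] at h2
      obtain rfl := Ty.eq_tp_of_rename (eqTy_tp_left h2)
      rw [Ty.rename_liftRen_instRen] at h3
      obtain ⟨k, a, T, f, h4, h5, h6⟩ := ih _ h3
      exact ⟨k, a, T, f, h4, h5, h6⟩

/-- Only an abstraction has a Π-type, so a body of a closed type is the closure of a term over the
prepattern variables. -/
theorem chkTm_close : ∀ {k : ℕ} {A : Ty k} {M : Tm 0},
    ChkTm Ξ Ψ fwd .nil M A.close ↔ ∃ M₀ : Tm k, M = M₀.close ∧ ChkTm Ξ Ψ fwd (preCtx k) M₀ A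
  | 0, A, M => ⟨fun h => ⟨M, rfl, h⟩, by rintro ⟨_, rfl, h⟩; exact h⟩
  | k + 1, A, M => by
      rw [Ty.close, chkTm_close]
      constructor
      · rintro ⟨M₁, rfl, h⟩
        cases h with
        | lam h => exact ⟨_, rfl, h⟩
      · rintro ⟨M₀, rfl, h⟩
        exact ⟨.lam M₀, rfl, .lam h⟩

theorem chkTy_tp {n : ℕ} {Γ : Ctx n} (h : Ξ[kTp]? = some (.fam .type)) : ChkTy Ξ Ψ fwd Γ .tp :=
  .atom h .nil (.inl rfl)

theorem chkTy_close (h : Ξ[kTp]? = some (.fam .type)) : ∀ {k : ℕ} {A : Ty k},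
    ChkTy Ξ Ψ fwd (preCtx k) A → ChkTy Ξ Ψ fwd .nil A.close
  | 0, _, hA => hA
  | _ + 1, A, hA => chkTy_close (A := .pi .pre .tp A) h (.pi (chkTy_tp h) hA)

end

theorem prepat_close : ∀ {k : ℕ} {A : Ty k}, A.Prepat → A.close.Prepat
  | 0, _, h => h
  | _ + 1, A, h => prepat_close (A := .pi .pre .tp A) (.pi h)

theorem contra_close : ∀ {k : ℕ} {M : Tm k}, M.close.Contra ↔ M.Contra
  | 0, _ => Iff.rfl
  | k + 1, M => by
      rw [Tm.close, contra_close]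
      exact ⟨fun h => h.of_lam, .lam⟩

/-- The number of abstractions. -/
def Ty.arity : {n : ℕ} → Ty n → ℕ
  | _, .atom _ _ => 0
  | _, .pi _ _ B => B.arity + 1

theorem Ty.arity_close : ∀ {k : ℕ} (A : Ty k), A.close.arity = A.arity + k
  | 0, _ => rfl
  | k + 1, A => by rw [Ty.close, Ty.arity_close, Ty.arity]; omega

theorem Ty.close_injective : ∀ {k : ℕ} {A A' : Ty k}, A.close = A'.close → A = A'
  | 0, _, _, h => h
  | _ + 1, _, _, h => (Ty.pi.inj (Ty.close_injective h)).2.2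

/-- The number of abstractions recovers the number of parameters; this aligns two presentations of
the type of one recursion constant. -/
theorem Ty.close_atom_scope {a a' k k' : ℕ} {T : Spine k} {T' : Spine k'}
    (h : (Ty.atom a T).close = (Ty.atom a' T').close) : k = k' := by
  have := congrArg Ty.arity h
  rw [Ty.arity_close, Ty.arity_close] at this
  simpa [Ty.arity] using this

/-! # Guardedness -/

mutual
/-- The recursion constant `s` occurs off the arguments of `inf/arr`. -/
def Tm.Occ (s : ℕ) : {n : ℕ} → Tm n → Prop
  | _, .lam M => M.Occ s
  | _, .neu (.var _) S => S.Occ s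
  | _, .neu (.con c) S => c ≠ kInfArr ∧ S.Occ s
  | _, .neu (.rc r) _ => s = r
def Spine.Occ (s : ℕ) : {n : ℕ} → Spine n → Prop
  | _, .nil => False
  | _, .app M S => M.Occ s ∨ S.Occ s
  | _, .papp _ S => S.Occ s
end

mutual
theorem Tm.occ_rename (s : ℕ) : ∀ {n k : ℕ} (ρ : Fin n → Fin k) (M : Tm n),
    (M.rename ρ).Occ s ↔ M.Occ s
  | _, _, ρ, .lam M => by simp only [Tm.rename, Tm.Occ, Tm.occ_rename s _ M]
  | _, _, ρ, .neu (.var _) S => by simp only [Tm.rename, Head.rename, Tm.Occ, Spine.occ_rename s ρ S]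
  | _, _, ρ, .neu (.con c) S => by simp only [Tm.rename, Head.rename, Tm.Occ, Spine.occ_rename s ρ S]
  | _, _, ρ, .neu (.rc r) _ => by simp only [Tm.rename, Head.rename, Tm.Occ]
theorem Spine.occ_rename (s : ℕ) : ∀ {n k : ℕ} (ρ : Fin n → Fin k) (S : Spine n),
    (S.rename ρ).Occ s ↔ S.Occ s
  | _, _, ρ, .nil => Iff.rfl
  | _, _, ρ, .app M S => by
      simp only [Spine.rename, Spine.Occ, Tm.occ_rename s ρ M, Spine.occ_rename s ρ S]
  | _, _, ρ, .papp x S => by simp only [Spine.rename, Spine.Occ, Spine.occ_rename s ρ S]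
end

theorem Tm.occ_close (s : ℕ) : ∀ {k : ℕ} {M : Tm k}, M.close.Occ s ↔ M.Occ s
  | 0, _ => Iff.rfl
  | k + 1, M => by rw [Tm.close, Tm.occ_close]; rfl

/-- The body of `r` mentions `s` off the arguments of `inf/arr`. -/
def Edge (Ψ : Sig) (r s : ℕ) : Prop := ∃ (A : Ty 0) (M : Tm 0), Ψ[r]? = some (.defn A M) ∧ M.Occ s

/-- There is a path that avoids `Q`. -/
inductive ReachAv (E : ℕ → ℕ → Prop) (r : ℕ) (Q : Finset ℕ) : ℕ → Prop
  | refl : r ∉ Q → ReachAv E r Q r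
  | step {x y : ℕ} : x ∉ Q → E x y → ReachAv E r Q y → ReachAv E r Q x

theorem ReachAv.not_mem {E : ℕ → ℕ → Prop} {r x : ℕ} {Q : Finset ℕ} (h : ReachAv E r Q x) :
    x ∉ Q := by cases h <;> assumption

/-- If the path meets `s`, cut it after the last visit; it does not end there because `r ≠ s`. -/
theorem ReachAv.avoid {E : ℕ → ℕ → Prop} {r s x : ℕ} {Q : Finset ℕ} (hs : r ≠ s)
    (h : ReachAv E r Q x) :
    ReachAv E r (insert s Q) x ∨ ∃ y, E s y ∧ ReachAv E r (insert s Q) y := by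
  induction h with
  | refl hr => exact .inl (.refl (by simp [hs, hr]))
  | @step x y hx hxy _ ih =>
    rcases ih with ih | ih
    · by_cases hxs : x = s
      · subst hxs; exact .inr ⟨y, hxy, ih⟩
      · exact .inl (.step (by simp [hxs, hx]) hxy ih)
    · exact .inr ih

theorem ReachAv.of_transGen {E : ℕ → ℕ → Prop} {r x : ℕ} (h : Relation.ReflTransGen E x r) :
    ReachAv E r ∅ x := by
  induction h using Relation.ReflTransGen.head_induction_on with
  | refl => exact .refl (by simp)
  | head h _ ih => exact .step (by simp) h ih

mutual
-- The guardedness check searches the graph of definitions and never re-explores a constant of `Q`.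
-- While `inf/arr` has not been passed it cannot accept `r`, so a path back to `r` would have to run
-- through `Q`. When a constant is explored and added to `Q`, `ReachAv.avoid` shortens the path so
-- that it avoids the enlarged set.
theorem GuardTm.not_reach {Ψ : Sig} {r : ℕ} (hΨ : ∀ C, ValidTrace Ψ C → kInfArr ∈ C) :
    ∀ {Q C : Finset ℕ} {n : ℕ} {M : Tm n}, GuardTm Ψ r Q C M → kInfArr ∉ C → ∀ s, M.Occ s →
    ¬ ReachAv (Edge Ψ) r Q s
  | _, _, _, _, .lam h, hC, s, hs => GuardTm.not_reach hΨ h hC s hs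
  | _, _, _, _, @GuardTm.con _ _ _ _ _ c _ h, hC, s, hs =>
      GuardSp.not_reach hΨ h (by
        rw [Finset.mem_insert]; rintro (h1 | h1)
        · exact hs.1 h1.symm
        · exact hC h1) s hs.2
  | _, _, _, _, .var h, hC, s, hs => GuardSp.not_reach hΨ h hC s hs
  | _, _, _, _, .seen _ hr', _, s, hs => fun hre => hre.not_mem (by cases hs; exact hr')
  | _, _, _, _, .self hv, hC, _, _ => (hC (hΨ _ hv)).elim
  | _, _, _, _, @GuardTm.explore _ _ _ _ _ r' _ A M hrr hr' hd _ h, hC, s, hs => by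
      intro hre
      cases hs
      rcases hre.avoid hrr with h1 | ⟨y, ⟨A', M', h1, h2⟩, h3⟩
      · exact h1.not_mem (Finset.mem_insert_self _ _)
      · rw [hd] at h1
        cases h1
        exact GuardTm.not_reach hΨ h hC y h2 h3
theorem GuardSp.not_reach {Ψ : Sig} {r : ℕ} (hΨ : ∀ C, ValidTrace Ψ C → kInfArr ∈ C) :
    ∀ {Q C : Finset ℕ} {n : ℕ} {S : Spine n}, GuardSp Ψ r Q C S → kInfArr ∉ C → ∀ s, S.Occ s →
    ¬ ReachAv (Edge Ψ) r Q s
  | _, _, _, _, .nil, _, _, hs => hs.elim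
  | _, _, _, _, .app h h', hC, s, hs => by
      rcases hs with hs | hs
      · exact GuardTm.not_reach hΨ h hC s hs
      · exact GuardSp.not_reach hΨ h' hC s hs
  | _, _, _, _, .papp h, hC, s, hs => GuardSp.not_reach hΨ h hC s hs
end

theorem edge_acyclic {Ψ : Sig} (hΨ : ∀ C, ValidTrace Ψ C → kInfArr ∈ C)
    (hg : ∀ (r : ℕ) (A : Ty 0) (M : Tm 0), Ψ[r]? = some (.defn A M) → GuardTm Ψ r ∅ ∅ M) (r : ℕ) :
    ¬ Relation.TransGen (Edge Ψ) r r := by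
  intro h
  obtain ⟨s, ⟨A, M, h1, h2⟩, h3⟩ := Relation.TransGen.head'_iff.1 h
  exact (hg r A M h1).not_reach hΨ (by simp) s h2 (.of_transGen h3)

/-- Edges leave only defined constants, which are finitely many, and an acyclic relation on a finite
set is well-founded. An index beyond the signature has no successors. -/
theorem edge_wellFounded {Ψ : Sig} (h : ∀ r, ¬ Relation.TransGen (Edge Ψ) r r) :
    WellFounded fun s r => Edge Ψ r s := by
  have wf : WellFounded fun (s r : Fin Ψ.length) => Relation.TransGen (Edge Ψ) r s := by
    have : Std.Irrefl fun (s r : Fin Ψ.length) => Relation.TransGen (Edge Ψ) r s := ⟨fun r => h r⟩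
    have : IsTrans _ fun (s r : Fin Ψ.length) => Relation.TransGen (Edge Ψ) r s :=
      ⟨fun a b c h h' => h'.trans h⟩
    exact Finite.wellFounded_of_trans_of_irrefl _
  have lt : ∀ {r s}, Edge Ψ r s → r < Ψ.length := fun ⟨A, M, h, _⟩ =>
    (List.getElem?_eq_some_iff.1 h).1
  have acc : ∀ r : Fin Ψ.length, Acc (fun s r => Edge Ψ r s) (r : ℕ) := by
    intro r
    induction r using wf.induction with
    | _ r ih =>
      refine ⟨_, fun s hs => ?_⟩
      by_cases hsl : s < Ψ.length
      · exact ih ⟨s, hsl⟩ (.single hs)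
      · exact ⟨_, fun t ht => (hsl (lt ht)).elim⟩
  refine ⟨fun r => ?_⟩
  by_cases hr : r < Ψ.length
  · exact acc ⟨r, hr⟩
  · exact ⟨_, fun t ht => (hr (lt ht)).elim⟩

-- From acyclicity back to guardedness.

mutual
/-- Every recursion constant that occurs is defined and has prepattern arguments. -/
def Tm.Dfd (Ψ : Sig) : {n : ℕ} → Tm n → Prop
  | _, .lam M => M.Dfd Ψ
  | _, .neu (.var _) S => S.Dfd Ψ
  | _, .neu (.con _) S => S.Dfd Ψ
  | _, .neu (.rc r) S => S.Prepat ∧ ∃ A M, Ψ[r]? = some (.defn A M)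
def Spine.Dfd (Ψ : Sig) : {n : ℕ} → Spine n → Prop
  | _, .nil => True
  | _, .app M S => M.Dfd Ψ ∧ S.Dfd Ψ
  | _, .papp _ S => S.Dfd Ψ
end

theorem Tm.dfd_close (Ψ : Sig) : ∀ {k : ℕ} {M : Tm k}, M.close.Dfd Ψ ↔ M.Dfd Ψ
  | 0, _ => Iff.rfl
  | k + 1, M => by rw [Tm.close, Tm.dfd_close]; rfl

section
variable {Ψ : Sig} {r : ℕ}

mutual
-- The traversal of a single body for fixed `Q`, with `ih` handling each newly explored constant.
-- The invariant is that either `inf/arr` has been passed, or nothing that occurs leads back to `r`.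
theorem guardTm_of_explore {Q : Finset ℕ} (hΨ : ∀ C, kInfArr ∈ C → ValidTrace Ψ C)
    (ih : ∀ r', r' < Ψ.length → r' ∉ Q → ∀ (A : Ty 0) (M : Tm 0) (C : Finset ℕ),
      Ψ[r']? = some (.defn A M) →
      (kInfArr ∈ C ∨ ∀ s, M.Occ s → ¬ Relation.ReflTransGen (Edge Ψ) s r) →
      GuardTm Ψ r (insert r' Q) C M) :
    ∀ {n : ℕ} {C : Finset ℕ} (M : Tm n), M.Dfd Ψ →
    (kInfArr ∈ C ∨ ∀ s, M.Occ s → ¬ Relation.ReflTransGen (Edge Ψ) s r) → GuardTm Ψ r Q C M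
  | _, _, .lam M, hM, h => .lam (guardTm_of_explore hΨ ih M hM h)
  | _, _, .neu (.var _) S, hM, h => .var (guardSp_of_explore hΨ ih S hM h)
  | _, C, .neu (.con c) S, hM, h => by
      refine .con (guardSp_of_explore hΨ ih S hM ?_)
      rcases h with h | h
      · exact .inl (Finset.mem_insert_of_mem h)
      · by_cases hc : c = kInfArr
        · exact .inl (by rw [hc]; exact Finset.mem_insert_self _ _)
        · exact .inr fun s hs => h s ⟨hc, hs⟩
  | _, _, .neu (.rc r') S, hM, h => by
      obtain ⟨hS, A, M, hd⟩ := hM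
      by_cases hr : r = r'
      · subst hr
        refine .self (hΨ _ (h.resolve_right fun h => h r rfl .refl))
      · by_cases hQ : r' ∈ Q
        · exact .seen hr hQ
        · refine .explore hr hQ hd hS (ih r' (List.getElem?_eq_some_iff.1 hd).1 hQ A M _ hd ?_)
          exact h.imp_right fun h _ hs hr => h r' rfl (.head ⟨A, M, hd, hs⟩ hr)
theorem guardSp_of_explore {Q : Finset ℕ} (hΨ : ∀ C, kInfArr ∈ C → ValidTrace Ψ C)
    (ih : ∀ r', r' < Ψ.length → r' ∉ Q → ∀ (A : Ty 0) (M : Tm 0) (C : Finset ℕ),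
      Ψ[r']? = some (.defn A M) →
      (kInfArr ∈ C ∨ ∀ s, M.Occ s → ¬ Relation.ReflTransGen (Edge Ψ) s r) →
      GuardTm Ψ r (insert r' Q) C M) :
    ∀ {n : ℕ} {C : Finset ℕ} (S : Spine n), S.Dfd Ψ →
    (kInfArr ∈ C ∨ ∀ s, S.Occ s → ¬ Relation.ReflTransGen (Edge Ψ) s r) → GuardSp Ψ r Q C S
  | _, _, .nil, _, _ => .nil
  | _, _, .app M S, hM, h =>
      .app (guardTm_of_explore hΨ ih M hM.1 (h.imp_right fun h s hs => h s (.inl hs)))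
        (guardSp_of_explore hΨ ih S hM.2 (h.imp_right fun h s hs => h s (.inr hs)))
  | _, _, .papp _ S, hM, h => .papp (guardSp_of_explore hΨ ih S hM h)
end
end

/-- The search terminates because each exploration removes one index from the finite set of
unexplored ones; `N` bounds how many remain. -/
theorem guardTm_of_not_reach {Ψ : Sig} {r : ℕ} (hΨ : ∀ C, kInfArr ∈ C → ValidTrace Ψ C)
    (hd : ∀ (r : ℕ) (A : Ty 0) (M : Tm 0), Ψ[r]? = some (.defn A M) → M.Dfd Ψ) (N : ℕ) :
    ∀ (Q : Finset ℕ), (Finset.range Ψ.length \ Q).card ≤ N → ∀ {n : ℕ} {C : Finset ℕ} (M : Tm n),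
    M.Dfd Ψ → (kInfArr ∈ C ∨ ∀ s, M.Occ s → ¬ Relation.ReflTransGen (Edge Ψ) s r) →
    GuardTm Ψ r Q C M := by
  induction N with
  | zero =>
    intro Q hQ n C M
    refine guardTm_of_explore hΨ (fun r' hl hr' => ?_) M
    have : r' ∈ Finset.range Ψ.length \ Q := by simp [hl, hr']
    rw [Finset.card_eq_zero.1 (Nat.le_zero.1 hQ)] at this
    simp at this
  | succ N ihN =>
    intro Q hQ n C M
    refine guardTm_of_explore hΨ (fun r' hl hr' A M' C hr h => ?_) M
    refine ihN _ ?_ M' (hd r' A M' hr) h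
    have h1 : r' ∈ Finset.range Ψ.length \ Q := by simp [hl, hr']
    have h2 : Finset.range Ψ.length \ insert r' Q = (Finset.range Ψ.length \ Q).erase r' := by
      ext x; simp only [Finset.mem_sdiff, Finset.mem_insert, Finset.mem_erase]; tauto
    rw [h2, Finset.card_erase_of_mem h1]
    omega

theorem guardTm_of_acyclic {Ψ : Sig} (hΨ : ∀ C, kInfArr ∈ C → ValidTrace Ψ C)
    (hd : ∀ (r : ℕ) (A : Ty 0) (M : Tm 0), Ψ[r]? = some (.defn A M) → M.Dfd Ψ)
    (h : ∀ r, ¬ Relation.TransGen (Edge Ψ) r r) {r : ℕ} {A : Ty 0} {M : Tm 0}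
    (hr : Ψ[r]? = some (.defn A M)) : GuardTm Ψ r ∅ ∅ M :=
  guardTm_of_not_reach hΨ hd _ ∅ le_rfl M (hd r A M hr)
    (.inr fun _ hs hsr => h r (Relation.TransGen.head' ⟨A, M, hr, hs⟩ hsr))

/-! # Terms of type `tp` -/

/-- Well-formed terms of type `tp` over variables of type `tp`, where `av r A` says that the recursion
constant `r : A` is available. -/
inductive WTp (av : ℕ → Ty 0 → Prop) : {n : ℕ} → (Fin n → Mode) → Tm n → Prop
  | var {n : ℕ} {m : Fin n → Mode} (x : Fin n) : WTp av m (.v x [])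
  | bot {n : ℕ} {m : Fin n → Mode} : WTp av m (.cst kBot [])
  | top {n : ℕ} {m : Fin n → Mode} : WTp av m (.cst kTop [])
  | arr {n : ℕ} {m : Fin n → Mode} {M N : Tm n} : WTp av m M → WTp av m N →
      WTp av m (.cst kArr [M, N])
  | mu {n : ℕ} {m : Fin n → Mode} {M N : Tm (n + 1)} : WTp av (consMode .ord m) M →
      WTp av (consMode .ord m) N → WTp av m (.cst kMu [.lam M, .lam N])
  | rc {n k r : ℕ} {m : Fin n → Mode} (f : Fin k → Fin n) : av r (Ty.tp : Ty k).close →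
      (∀ x, m (f x) = .pre) → WTp av m (.neu (.rc r) (pv f .nil))

/-- The term represents the recursive type. -/
inductive TpRep (Ψ : Sig) : {n : ℕ} → Tm n → RTy n → Prop
  | var {n : ℕ} (x : Fin n) : TpRep Ψ (.v x []) (.var x)
  | bot {n : ℕ} : TpRep Ψ (.cst kBot [] : Tm n) .bot
  | top {n : ℕ} : TpRep Ψ (.cst kTop [] : Tm n) .top
  | arr {n : ℕ} {M N : Tm n} {σ τ : RTy n} : TpRep Ψ M σ → TpRep Ψ N τ →
      TpRep Ψ (.cst kArr [M, N]) (.arr σ τ)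
  | mu {n : ℕ} {M N : Tm (n + 1)} {σ τ : RTy (n + 1)} : TpRep Ψ M σ → TpRep Ψ N τ →
      TpRep Ψ (.cst kMu [.lam M, .lam N]) (.mu σ τ)
  | rc {n k r : ℕ} {M : Tm k} {σ : RTy k} (f : Fin k → Fin n) :
      Ψ[r]? = some (.defn (Ty.tp : Ty k).close M.close) → M.Contra → TpRep Ψ M σ →
      TpRep Ψ (.neu (.rc r) (pv f .nil)) (σ.rename f)

theorem RTy.enc_rename : ∀ {n k : ℕ} (ρ : Fin n → Fin k) (σ : RTy n),
    (σ.rename ρ).enc = σ.enc.rename ρ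
  | _, _, _, .var _ => rfl
  | _, _, _, .bot => rfl
  | _, _, _, .top => rfl
  | _, _, ρ, .arr a b => by
      simp only [RTy.rename, RTy.enc, RTy.enc_rename ρ a, RTy.enc_rename ρ b]; rfl
  | _, _, ρ, .mu a b => by
      simp only [RTy.rename, RTy.enc, RTy.enc_rename _ a, RTy.enc_rename _ b]; rfl

theorem TpRep.enc (Ψ : Sig) : ∀ {n : ℕ} (σ : RTy n), TpRep Ψ σ.enc σ
  | _, .var x => .var x
  | _, .bot => .bot
  | _, .top => .top
  | _, .arr a b => .arr (TpRep.enc Ψ a) (TpRep.enc Ψ b)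
  | _, .mu a b => .mu (TpRep.enc Ψ a) (TpRep.enc Ψ b)

theorem WTp.enc (av : ℕ → Ty 0 → Prop) : ∀ {n : ℕ} (m : Fin n → Mode) (σ : RTy n), WTp av m σ.enc
  | _, _, .var x => .var x
  | _, _, .bot => .bot
  | _, _, .top => .top
  | _, _, .arr a b => .arr (WTp.enc av _ a) (WTp.enc av _ b)
  | _, _, .mu a b => .mu (WTp.enc av _ a) (WTp.enc av _ b)

theorem WTp.mono {av av' : ℕ → Ty 0 → Prop} (h : ∀ r A, av r A → av' r A) {n : ℕ}
    {m : Fin n → Mode} {M : Tm n} (hM : WTp av m M) : WTp av' m M := by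
  induction hM with
  | var x => exact .var x
  | bot => exact .bot
  | top => exact .top
  | arr _ _ ih ih' => exact .arr ih ih'
  | mu _ _ ih ih' => exact .mu ih ih'
  | rc f h1 h2 => exact .rc f (h _ _ h1) h2

theorem consMode_liftRen {n k : ℕ} {m : Fin n → Mode} {m' : Fin k → Mode} {ρ : Fin n → Fin k}
    (h : ∀ x, m x = .pre → m' (ρ x) = .pre) (p : Mode) (x : Fin (n + 1)) :
    consMode p m x = .pre → consMode p m' (liftRen ρ x) = .pre := by
  refine Fin.cases (fun h => h) (fun j => ?_) x
  exact h j

theorem WTp.rename {av : ℕ → Ty 0 → Prop} {n : ℕ} {m : Fin n → Mode} {M : Tm n}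
    (hM : WTp av m M) : ∀ {k : ℕ} {m' : Fin k → Mode} {ρ : Fin n → Fin k},
    (∀ x, m x = .pre → m' (ρ x) = .pre) → WTp av m' (M.rename ρ) := by
  induction hM with
  | var x => exact fun _ => .var _
  | bot => exact fun _ => .bot
  | top => exact fun _ => .top
  | arr _ _ ih ih' => exact fun h => .arr (ih h) (ih' h)
  | mu _ _ ih ih' =>
    exact fun h => .mu (ih (consMode_liftRen h _)) (ih' (consMode_liftRen h _))
  | rc f h1 h2 =>
    intro k m' ρ h
    simp only [Tm.rename, pv_rename]
    exact .rc _ h1 fun x => h _ (h2 x)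

theorem TpRep.rename {Ψ : Sig} {n : ℕ} {M : Tm n} {σ : RTy n} (h : TpRep Ψ M σ) :
    ∀ {k : ℕ} (ρ : Fin n → Fin k), TpRep Ψ (M.rename ρ) (σ.rename ρ) := by
  induction h with
  | var x => exact fun _ => .var _
  | bot => exact fun _ => .bot
  | top => exact fun _ => .top
  | arr _ _ ih ih' => exact fun ρ => .arr (ih ρ) (ih' ρ)
  | mu _ _ ih ih' => exact fun ρ => .mu (ih _) (ih' _)
  | rc f h1 h2 h3 =>
    intro k ρ
    simp only [Tm.rename, pv_rename, RTy.rename_rename]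
    exact .rc _ h1 h2 h3

theorem TpRep.neu {Ψ : Sig} {n : ℕ} {M : Tm n} {σ : RTy n} (h : TpRep Ψ M σ) :
    ∃ H S, M = .neu H S := by
  cases h <;> exact ⟨_, _, rfl⟩

theorem WTp.neu {av : ℕ → Ty 0 → Prop} {n : ℕ} {m : Fin n → Mode} {M : Tm n} (h : WTp av m M) :
    ∃ H S, M = .neu H S := by
  cases h <;> exact ⟨_, _, rfl⟩

theorem Tm.Contra.whnf {n : ℕ} {H : Head n} {S : Spine n} (h : (Tm.neu H S).Contra) :
    (Tm.neu H S).Whnf := by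
  cases h <;> exact id

theorem reduce_body {n k : ℕ} {A : Ty k} {M : Tm k} (hA : A.erase = .star) (f : Fin k → Fin n)
    (hM : ∃ H S, M = .neu H S) :
    reduce A.close.erase n (pv f .nil) M.close.ofClosed = some (M.rename f) := by
  obtain ⟨H, S, rfl⟩ := hM
  rw [reduce_close, hA]; rfl

theorem expTm_body {Ψ : Sig} {n k r : ℕ} {A : Ty k} {M : Tm k} (hA : A.erase = .star)
    (hr : Ψ[r]? = some (.defn A.close M.close)) (hM : ∃ H S, M = .neu H S) (hc : M.Contra)
    (f : Fin k → Fin n) : BEq Ψ Ψ (.neu (.rc r) (pv f .nil)) (M.rename f) := by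
  have h := reduce_body hA f hM
  obtain ⟨H, S, rfl⟩ := hM
  exact expTm_of_reduce hr h ((hc.rename f).whnf)

/-- The second signature is arbitrary because an encoding mentions no recursion constant, so its
tree does not depend on the definitions. -/
theorem TpRep.bEq {Ψ : Sig} {n : ℕ} {M : Tm n} {σ : RTy n} (h : TpRep Ψ M σ) (Ψ' : Sig) :
    BEq Ψ Ψ' M σ.enc := by
  induction h with
  | var x => exact fun k => by rcases k with _ | _ | k <;> rfl
  | bot => exact BEq.cst_iff.2 ⟨rfl, .nil⟩
  | top => exact BEq.cst_iff.2 ⟨rfl, .nil⟩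
  | arr _ _ ih ih' => exact BEq.cst_iff.2 ⟨rfl, .cons ih (.cons ih' .nil)⟩
  | mu _ _ ih ih' =>
    exact BEq.cst_iff.2 ⟨rfl, .cons (BEq.lam_iff.2 ih) (.cons (BEq.lam_iff.2 ih') .nil)⟩
  | rc f h1 h2 h3 ih =>
    rw [RTy.enc_rename]
    exact (expTm_body rfl h1 h3.neu h2 f).trans (ih.rename f)

theorem BEq.of_pair {Ψ Ψ' : Sig} {n : ℕ} {c : ℕ} {M N M' N' : Tm n}
    (h : BEq Ψ Ψ' (.cst c [M, N]) (.cst c [M', N'])) : BEq Ψ Ψ' M M' ∧ BEq Ψ Ψ' N N' := by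
  have := (BEq.cst_iff.1 h).2
  simpa using this

/-- The tree of depth one already shows the head, which determines the outermost type former. -/
theorem RTy.enc_injective {Ψ Ψ' : Sig} : ∀ {n : ℕ} {σ τ : RTy n}, BEq Ψ Ψ' σ.enc τ.enc → σ = τ
  | _, .var x, τ, h => by
      cases τ with
      | var y => rw [(BTm.var.inj (h 1)).1]
      | _ => exact nomatch h 1
  | _, .bot, τ, h => by
      cases τ with
      | bot => rfl
      | var y => exact nomatch h 1
      | _ => exact nomatch (BEq.cst_iff.1 h).1
  | _, .top, τ, h => by
      cases τ with
      | top => rfl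
      | var y => exact nomatch h 1
      | _ => exact nomatch (BEq.cst_iff.1 h).1
  | _, .arr a b, τ, h => by
      cases τ with
      | arr a' b' =>
        obtain ⟨h1, h2⟩ := h.of_pair
        rw [RTy.enc_injective h1, RTy.enc_injective h2]
      | var y => exact nomatch h 1
      | _ => exact nomatch (BEq.cst_iff.1 h).1
  | _, .mu a b, τ, h => by
      cases τ with
      | mu a' b' =>
        obtain ⟨h1, h2⟩ := h.of_pair
        rw [RTy.enc_injective (BEq.lam_iff.1 h1), RTy.enc_injective (BEq.lam_iff.1 h2)]
      | var y => exact nomatch h 1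
      | _ => exact nomatch (BEq.cst_iff.1 h).1

theorem TpRep.eq_of_bEq {Ψ Ψ' : Sig} {n : ℕ} {M M' : Tm n} {σ σ' : RTy n} (h : TpRep Ψ M σ)
    (h' : TpRep Ψ' M' σ') (hM : BEq Ψ Ψ' M M') : σ = σ' :=
  RTy.enc_injective (((h.bEq Ψ).symm.trans hM).trans (h'.bEq Ψ))

theorem TpRep.unique {Ψ : Sig} {n : ℕ} {M : Tm n} {σ σ' : RTy n} (h : TpRep Ψ M σ)
    (h' : TpRep Ψ M σ') : σ = σ' := h.eq_of_bEq h' fun _ => rfl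

-- Completeness of equality for terms that represent recursive types.

/-- A term with a constructor or a variable as its head that represents the recursive type. -/
inductive TpNf (Ψ : Sig) : {n : ℕ} → Tm n → RTy n → Prop
  | var {n : ℕ} (x : Fin n) : TpNf Ψ (.v x []) (.var x)
  | bot {n : ℕ} : TpNf Ψ (.cst kBot [] : Tm n) .bot
  | top {n : ℕ} : TpNf Ψ (.cst kTop [] : Tm n) .top
  | arr {n : ℕ} {M N : Tm n} {σ τ : RTy n} : TpRep Ψ M σ → TpRep Ψ N τ →
      TpNf Ψ (.cst kArr [M, N]) (.arr σ τ)
  | mu {n : ℕ} {M N : Tm (n + 1)} {σ τ : RTy (n + 1)} : TpRep Ψ M σ → TpRep Ψ N τ →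
      TpNf Ψ (.cst kMu [.lam M, .lam N]) (.mu σ τ)

theorem TpNf.rename {Ψ : Sig} {n : ℕ} {M : Tm n} {σ : RTy n} (h : TpNf Ψ M σ) {k : ℕ}
    (ρ : Fin n → Fin k) : TpNf Ψ (M.rename ρ) (σ.rename ρ) := by
  cases h with
  | var x => exact .var _
  | bot => exact .bot
  | top => exact .top
  | arr h h' => exact .arr (h.rename _) (h'.rename _)
  | mu h h' => exact .mu (h.rename _) (h'.rename _)

theorem TpNf.exists_neu {Ψ : Sig} {n : ℕ} {M : Tm n} {σ : RTy n} (h : TpNf Ψ M σ) :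
    ∃ H S, M = .neu H S ∧ ¬ H.IsRc := by
  cases h <;> exact ⟨_, _, rfl, id⟩

/-- The rule that unfolds a recursion constant applies. -/
def UnfoldsTo (Ψ : Sig) {n : ℕ} (r : ℕ) (S : Spine n) (M' : Tm n) : Prop :=
  ∃ (A : Ty 0) (M : Tm 0), Ψ[r]? = some (.defn A M) ∧ S.Prepat ∧ M.Contra ∧
    reduce A.erase n S M.ofClosed = some M'

/-- A single unfolding suffices, since bodies are contractive and renaming keeps the head. -/
theorem TpRep.nf {Ψ : Sig} {n : ℕ} {M : Tm n} {σ : RTy n} (h : TpRep Ψ M σ) :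
    TpNf Ψ M σ ∨ ∃ r S M', M = .neu (.rc r) S ∧ UnfoldsTo Ψ r S M' ∧ TpNf Ψ M' σ := by
  cases h with
  | var x => exact .inl (.var x)
  | bot => exact .inl .bot
  | top => exact .inl .top
  | arr h h' => exact .inl (.arr h h')
  | mu h h' => exact .inl (.mu h h')
  | rc f h1 h2 h3 =>
    refine .inr ⟨_, _, _, rfl, ⟨_, _, h1, pv_prepat _ .nil, contra_close.2 h2,
      reduce_body rfl f h3.neu⟩, ?_⟩
    cases h3 with
    | var x => exact .var _
    | bot => exact .bot
    | top => exact .top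
    | arr h h' => exact TpNf.rename (.arr h h') _
    | mu h h' => exact TpNf.rename (.mu h h') _
    | rc _ => cases h2

/-- The left side is unfolded before the right, because `unfoldR` requires the left head not to be a
recursion constant. Quantifying over `Δ` in `hnf` absorbs the assumptions that the unfoldings add.
-/
theorem EqTm.of_tpNf {Ψ : Sig} {n : ℕ} {M M' : Tm n} {σ : RTy n} (h : TpRep Ψ M σ)
    (h' : TpRep Ψ M' σ) (hnf : ∀ N N' Δ, TpNf Ψ N σ → TpNf Ψ N' σ → EqTm Ψ Δ N N')
    (Δ : List EqHyp) : EqTm Ψ Δ M M' := by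
  rcases h.nf with h | ⟨r, S, N, rfl, ⟨A, B, hr, hS, hB, hN⟩, h⟩
  · rcases h'.nf with h' | ⟨r', S', N', rfl, ⟨A', B', hr', hS', hB', hN'⟩, h'⟩
    · exact hnf _ _ _ h h'
    · obtain ⟨H, S, rfl, hH⟩ := h.exists_neu
      exact .unfoldR hr' hS' hB' (by rintro _ rfl; exact hH trivial) hN' (hnf _ _ _ h h')
  · rcases h'.nf with h' | ⟨r', S', N', rfl, ⟨A', B', hr', hS', hB', hN'⟩, h'⟩
    · obtain ⟨H, S, rfl, hH⟩ := h'.exists_neu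
      exact .unfoldL hr hS hB hN (hnf _ _ _ h h')
    · obtain ⟨H, S, rfl, hH⟩ := h.exists_neu
      exact .unfoldL hr hS hB hN
        (.unfoldR hr' hS' hB' (by rintro _ rfl; exact hH trivial) hN' (hnf _ _ _ h h'))

/-- Representations of the same recursive type are equal. -/
theorem EqTm.of_tpRep {Ψ : Sig} : ∀ {n : ℕ} (σ : RTy n) {M M' : Tm n}, TpRep Ψ M σ →
    TpRep Ψ M' σ → ∀ Δ, EqTm Ψ Δ M M'
  | _, .var x, _, _, h, h' => EqTm.of_tpNf h h' fun N N' Δ h h' => by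
      cases h; cases h'; exact .var .nil
  | _, .bot, _, _, h, h' => EqTm.of_tpNf h h' fun N N' Δ h h' => by
      cases h; cases h'; exact .con .nil
  | _, .top, _, _, h, h' => EqTm.of_tpNf h h' fun N N' Δ h h' => by
      cases h; cases h'; exact .con .nil
  | _, .arr a b, _, _, h, h' => EqTm.of_tpNf h h' fun N N' Δ h h' => by
      cases h with
      | arr h1 h2 =>
        cases h' with
        | arr h3 h4 =>
          exact .con (.app (EqTm.of_tpRep a h1 h3 _) (.app (EqTm.of_tpRep b h2 h4 _) .nil))
  | _, .mu a b, _, _, h, h' => EqTm.of_tpNf h h' fun N N' Δ h h' => by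
      cases h with
      | mu h1 h2 =>
        cases h' with
        | mu h3 h4 =>
          exact .con (.app (.lam (EqTm.of_tpRep a h1 h3 _))
            (.app (.lam (EqTm.of_tpRep b h2 h4 _)) .nil))

/-! ## Substitution in terms of type `tp` -/

theorem FO.v {n : ℕ} {m : Fin n → Mode} (x : Fin n) : FO m (.v x []) := .var

theorem FOs.of_pair {n : ℕ} {m : Fin n → Mode} {M N : Tm n} (hM : FO m M) (hN : FO m N) :
    FOs m (.ofList [M, N]) := .app hM (.app hN .nil)

theorem WTp.fo {av : ℕ → Ty 0 → Prop} {n : ℕ} {m : Fin n → Mode} {M : Tm n} (h : WTp av m M) :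
    FO m M := by
  induction h with
  | var x => exact .var
  | bot => exact .con .nil
  | top => exact .con .nil
  | arr _ _ ih ih' => exact .con (.of_pair ih ih')
  | mu _ _ ih ih' => exact .con (.of_pair (.lam ih) (.lam ih'))
  | rc f _ h => exact .rc (pv_fOs f h .nil)

theorem WTp.fsub {av : ℕ → Ty 0 → Prop} {n : ℕ} {m : Fin n → Mode} {M : Tm n} (h : WTp av m M) :
    ∀ {k : ℕ} {m' : Fin k → Mode} {θ : Fin n → Tm k}, (∀ x, WTp av m' (θ x)) →
    (∀ x, m x = .pre → ∃ y, θ x = .v y [] ∧ m' y = .pre) → WTp av m' (M.fsub θ) := by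
  have lift : ∀ {n k : ℕ} {m : Fin n → Mode} {m' : Fin k → Mode} {θ : Fin n → Tm k},
      (∀ x, WTp av m' (θ x)) → (∀ x, m x = .pre → ∃ y, θ x = .v y [] ∧ m' y = .pre) →
      (∀ x, WTp av (consMode .ord m') (liftTm θ x)) ∧ ∀ x, consMode .ord m x = .pre →
        ∃ y, liftTm θ x = .v y [] ∧ consMode .ord m' y = .pre := by
    intro n k m m' θ h1 h2
    refine ⟨fun x => ?_, fun x => ?_⟩
    · refine Fin.cases (.var 0) (fun j => ?_) x
      exact (h1 j).rename fun x hx => hx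
    · refine Fin.cases (fun h => nomatch h) (fun j hj => ?_) x
      obtain ⟨y, hy, hy'⟩ := h2 j hj
      refine ⟨y.succ, ?_, hy'⟩
      show (θ j).rename Fin.succ = _
      rw [hy]; rfl
  induction h with
  | var x => exact fun h _ => h x
  | bot => exact fun _ _ => .bot
  | top => exact fun _ _ => .top
  | arr _ _ ih ih' => exact fun h h' => .arr (ih h h') (ih' h h')
  | mu _ _ ih ih' =>
    exact fun h h' => .mu (ih (lift h h').1 (lift h h').2) (ih' (lift h h').1 (lift h h').2)
  | rc f h1 h2 =>
    intro k m' θ h h'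
    choose g hg hg' using fun x => h' (f x) (h2 x)
    -- The arguments of a recursion constant are prepattern variables, which `θ` sends to variables
    -- `g`; the spine stays a tuple of variables.
    simp only [Tm.fsub, pv_fsub θ f g _ hg]
    exact .rc _ h1 hg'

theorem fO_lam_iff {n : ℕ} {m : Fin n → Mode} {M : Tm (n + 1)} :
    FO m (.lam M) ↔ FO (consMode .ord m) M :=
  ⟨fun h => by cases h; assumption, .lam⟩

theorem fO_pair_iff {n c : ℕ} {m : Fin n → Mode} {M N : Tm n} :
    FO m (.cst c [M, N]) ↔ FO m M ∧ FO m N := by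
  constructor
  · intro h
    simp only [Tm.cst, Spine.ofList] at h
    cases h with
    | con h =>
      cases h with
      | app h h' =>
        cases h' with
        | app h' _ => exact ⟨h, h'⟩
  · exact fun h => .con (.of_pair h.1 h.2)

theorem fOs_pv_iff {n : ℕ} {m : Fin n → Mode} : ∀ {k : ℕ} {f : Fin k → Fin n} {T : Spine n},
    FOs m (pv f T) ↔ (∀ x, m (f x) = .pre) ∧ FOs m T
  | 0, _, _ => ⟨fun h => ⟨fun x => x.elim0, h⟩, fun h => h.2⟩
  | k + 1, f, T => by
      rw [pv, fOs_pv_iff, Fin.forall_fin_succ]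
      constructor
      · rintro ⟨h1, h2⟩
        cases h2 with
        | papp h2 h3 => exact ⟨⟨h2, h1⟩, h3⟩
      · rintro ⟨⟨h2, h1⟩, h3⟩
        exact ⟨h1, .papp h2 h3⟩

theorem RTy.rename_eq_subst : ∀ {n k : ℕ} (ρ : Fin n → Fin k) (σ : RTy n),
    σ.rename ρ = σ.subst fun i => .var (ρ i)
  | _, _, _, .var _ => rfl
  | _, _, _, .bot => rfl
  | _, _, _, .top => rfl
  | _, _, ρ, .arr a b => by
      simp only [RTy.rename, RTy.subst, RTy.rename_eq_subst ρ a, RTy.rename_eq_subst ρ b]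
  | _, _, ρ, .mu a b => by
      simp only [RTy.rename, RTy.subst, RTy.rename_eq_subst _ a, RTy.rename_eq_subst _ b]
      rw [show (fun i => RTy.var (liftRen ρ i)) = liftSub fun i => .var (ρ i) from
        funext fun i => by refine Fin.cases rfl (fun j => rfl) i]

/-- `FO m M` ensures that the arguments of recursion constants are prepattern variables. On these
the substitution is a renaming, so definitions are left untouched and only their arguments change.
-/
theorem TpRep.fsub {Ψ : Sig} {n : ℕ} {M : Tm n} {σ : RTy n} (h : TpRep Ψ M σ) :
    ∀ {k : ℕ} {m : Fin n → Mode} {θ : Fin n → Tm k} {s : Fin n → RTy k}, FO m M →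
    (∀ x, TpRep Ψ (θ x) (s x)) → (∀ x, m x = .pre → ∃ y, θ x = .v y []) →
    TpRep Ψ (M.fsub θ) (σ.subst s) := by
  have lift : ∀ {n k : ℕ} {m : Fin n → Mode} {θ : Fin n → Tm k} {s : Fin n → RTy k},
      (∀ x, TpRep Ψ (θ x) (s x)) → (∀ x, m x = .pre → ∃ y, θ x = .v y []) →
      (∀ x, TpRep Ψ (liftTm θ x) (liftSub s x)) ∧ ∀ x, consMode .ord m x = .pre →
        ∃ y, liftTm θ x = .v y [] := by
    intro n k m θ s h1 h2
    refine ⟨fun x => ?_, fun x => ?_⟩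
    · refine Fin.cases (.var 0) (fun j => ?_) x
      exact (h1 j).rename _
    · refine Fin.cases (fun h => nomatch h) (fun j hj => ?_) x
      obtain ⟨y, hy⟩ := h2 j hj
      refine ⟨y.succ, ?_⟩
      show (θ j).rename Fin.succ = _
      rw [hy]; rfl
  induction h with
  | var x => exact fun _ h _ => h x
  | bot => exact fun _ _ _ => .bot
  | top => exact fun _ _ _ => .top
  | arr _ _ ih ih' =>
    exact fun h0 h h' => .arr (ih (fO_pair_iff.1 h0).1 h h') (ih' (fO_pair_iff.1 h0).2 h h')
  | mu _ _ ih ih' =>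
    exact fun h0 h h' => .mu
      (ih (fO_lam_iff.1 (fO_pair_iff.1 h0).1) (lift h h').1 (lift h h').2)
      (ih' (fO_lam_iff.1 (fO_pair_iff.1 h0).2) (lift h h').1 (lift h h').2)
  | @rc n k' r M σ f h1 h2 h3 ih =>
    intro k m θ s h0 h h'
    have hf : ∀ x, m (f x) = .pre := by
      cases h0 with
      | rc h0 => exact (fOs_pv_iff.1 h0).1
    choose g hg using fun x => h' (f x) (hf x)
    simp only [Tm.fsub, pv_fsub θ f g _ hg]
    -- At the arguments `θ` gives variables, and a variable represents only itself, so `s` gives the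
    -- same variables.
    have : (σ.rename f).subst s = σ.rename g := by
      rw [RTy.subst_rename, RTy.rename_eq_subst]
      congr 1; funext x
      have := h (f x)
      rw [hg] at this
      exact this.unique (.var _)
    rw [this]
    exact .rc _ h1 h2 h3

/-! ## Every well-formed term represents a recursive type -/

/-- The type of `r` is `A` in the signature. -/
def Defd (Ψ : Sig) (r : ℕ) (A : Ty 0) : Prop := ∃ M, Ψ[r]? = some (.defn A M)

/-- One step of the well-founded recursion in `Good.exists_tpRep`. Since no constructor of a `tp`
term is `inf/arr`, every recursion constant in it counts as occurring. -/
theorem WTp.exists_tpRep_of {Ψ : Sig} {n : ℕ} {m : Fin n → Mode} {M : Tm n} (h : WTp (Defd Ψ) m M) :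
    (∀ s, M.Occ s → ∀ (k : ℕ) (B : Tm 0), Ψ[s]? = some (.defn (Ty.tp : Ty k).close B) →
      ∃ B₀ : Tm k, B = B₀.close ∧ B₀.Contra ∧ ∃ σ, TpRep Ψ B₀ σ) → ∃ σ, TpRep Ψ M σ := by
  induction h with
  | var x => exact fun _ => ⟨_, .var x⟩
  | bot => exact fun _ => ⟨_, .bot⟩
  | top => exact fun _ => ⟨_, .top⟩
  | arr _ _ ih ih' =>
    intro h
    obtain ⟨σ, hσ⟩ := ih fun s hs => h s ⟨by decide, .inl hs⟩
    obtain ⟨τ, hτ⟩ := ih' fun s hs => h s ⟨by decide, .inr (.inl hs)⟩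
    exact ⟨_, .arr hσ hτ⟩
  | mu _ _ ih ih' =>
    intro h
    obtain ⟨σ, hσ⟩ := ih fun s hs => h s ⟨by decide, .inl hs⟩
    obtain ⟨τ, hτ⟩ := ih' fun s hs => h s ⟨by decide, .inr (.inl hs)⟩
    exact ⟨_, .mu hσ hτ⟩
  | rc f h1 h2 =>
    intro h
    obtain ⟨B, hB⟩ := h1
    obtain ⟨B₀, rfl, hc, σ, hσ⟩ := h _ rfl _ B hB
    exact ⟨_, .rc f hB hc hσ⟩

/-! # Extensions of the signature -/

/-- The extension of the signature by recursive definitions. -/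
def Sig.ext (L : List (Ty 0 × Tm 0)) : Sig := subSig ++ L.map fun d => .defn d.1 d.2

/-- The number 15 is the length of `subSig`; recursive definitions occupy the indices from 15 on. -/
theorem ext_lt (L : List (Ty 0 × Tm 0)) {i : ℕ} (h : i < 15) : (Sig.ext L)[i]? = subSig[i]? :=
  List.getElem?_append_left h

theorem ext_ge (L : List (Ty 0 × Tm 0)) {i : ℕ} (h : 15 ≤ i) :
    (Sig.ext L)[i]? = (L[i - 15]?).map fun d => .defn d.1 d.2 := by
  rw [Sig.ext, List.getElem?_append_right h, List.getElem?_map]; rfl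

theorem ext_con {L : List (Ty 0 × Tm 0)} {c : ℕ} {A : Ty 0} :
    (Sig.ext L)[c]? = some (.con A) ↔ subSig[c]? = some (.con A) := by
  by_cases h : c < 15
  · rw [ext_lt L h]
  · rw [ext_ge L (not_lt.1 h), List.getElem?_eq_none (l := subSig) (not_lt.1 h)]
    cases L[c - 15]? <;> simp

theorem ext_fam {L : List (Ty 0 × Tm 0)} {c : ℕ} {K : Kd 0} :
    (Sig.ext L)[c]? = some (.fam K) ↔ subSig[c]? = some (.fam K) := by
  by_cases h : c < 15
  · rw [ext_lt L h]
  · rw [ext_ge L (not_lt.1 h), List.getElem?_eq_none (l := subSig) (not_lt.1 h)]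
    cases L[c - 15]? <;> simp

theorem ext_defn {L : List (Ty 0 × Tm 0)} {r : ℕ} {A : Ty 0} {M : Tm 0} :
    (Sig.ext L)[r]? = some (.defn A M) ↔ 15 ≤ r ∧ L[r - 15]? = some (A, M) := by
  by_cases h : r < 15
  · rw [ext_lt L h]
    refine ⟨fun h' => ?_, fun h' => by omega⟩
    interval_cases r <;> cases h'
  · rw [ext_ge L (not_lt.1 h)]
    simp only [not_lt.1 h, true_and]
    cases L[r - 15]? with
    | none => simp
    | some d => obtain ⟨B, N⟩ := d; simp

theorem take_ext {L : List (Ty 0 × Tm 0)} {r : ℕ} (h : 15 ≤ r) :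
    (Sig.ext L).take r = Sig.ext (L.take (r - 15)) := by
  rw [Sig.ext, List.take_append, List.take_of_length_le (l := subSig) h, ← List.map_take]; rfl

/-- The types of the constructors. -/
inductive ConTy : ℕ → Ty 0 → Prop
  | bot : ConTy kBot .tp
  | top : ConTy kTop .tp
  | arr : ConTy kArr (.pi .ord .tp (.pi .ord .tp .tp))
  | mu : ConTy kMu (.pi .ord .tpFun (.pi .ord .tpFun .tp))
  | subtpTop : ConTy kSubtpTop (.pi .ord .tp (.subtp (.v 0 []) (.cst kTop [])))
  | subtpBot : ConTy kSubtpBot (.pi .ord .tp (.subtp (.cst kBot []) (.v 0 [])))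
  | refl : ConTy kRefl (.pi .ord .tp (.subtp (.v 0 []) (.v 0 [])))
  | trans : ConTy kTrans (.pi .ord .tp (.pi .ord .tp (.pi .ord .tp
      (.pi .ord (.subtp (.v 2 []) (.v 1 []))
        (.pi .ord (.subtp (.v 2 []) (.v 1 [])) (.subtp (.v 4 []) (.v 2 [])))))))
  | subtpArr : ConTy kSubtpArr (.pi .ord .tp (.pi .ord .tp
      (.pi .ord (.subtpinf (.v 1 []) (.v 0 [])) (.subtp (.v 2 []) (.v 1 [])))))
  | unfold : ConTy kUnfold
      (.pi .ord .tpFun (.pi .ord .tpFun (.subtp (.muVar 1 0) (.unrollVar 1 0))))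
  | fold : ConTy kFold
      (.pi .ord .tpFun (.pi .ord .tpFun (.subtp (.unrollVar 1 0) (.muVar 1 0))))
  | infArr : ConTy kInfArr (.pi .ord .tp (.pi .ord .tp (.pi .ord .tp (.pi .ord .tp
      (.pi .ord (.subtp (.v 3 []) (.v 2 []))
        (.pi .ord (.subtp (.v 2 []) (.v 1 []))
          (.subtpinf (.cst kArr [.v 4 [], .v 3 []]) (.cst kArr [.v 5 [], .v 2 []]))))))))

theorem subSig_con {c : ℕ} {A : Ty 0} : subSig[c]? = some (.con A) ↔ ConTy c A := by
  constructor
  · intro h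
    have hc : c < 15 := (List.getElem?_eq_some_iff.1 h).1
    interval_cases c
    all_goals first
      | (cases h; done)
      | (cases h; constructor)
  · intro h
    cases h <;> rfl

theorem subSig_fam {c : ℕ} {K : Kd 0} (h : subSig[c]? = some (.fam K)) :
    (c = kTp ∧ K = .type) ∨ (c = kSubtp ∧ K = .pi .ord .tp (.pi .ord .tp .type)) ∨
      (c = kSubtpinf ∧ K = .pi .ord .tp (.pi .ord .tp .cotype)) := by
  have hc : c < 15 := (List.getElem?_eq_some_iff.1 h).1
  interval_cases c <;> cases h <;> simp

/-- `inf/arr` is the only constructor whose target is a cotype, and that target is the last family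
declared, so no other constructor exceeds it in priority. -/
theorem validTrace_iff {L : List (Ty 0 × Tm 0)} {C : Finset ℕ} :
    ValidTrace (Sig.ext L) C ↔ kInfArr ∈ C := by
  constructor
  · rintro ⟨c, hc, A, K, h1, h2, h3, -⟩
    rw [ext_con, subSig_con] at h1
    rw [ext_fam] at h2
    cases h1
    case infArr => exact hc
    all_goals
      rcases subSig_fam h2 with ⟨h, rfl⟩ | ⟨h, rfl⟩ | ⟨h, rfl⟩
      · exact h3.elim
      · exact h3.elim
      · cases h
  · intro h
    refine ⟨kInfArr, h, _, _, ext_con.2 (subSig_con.2 .infArr), ext_fam.2 rfl, trivial, ?_⟩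
    intro c' _ A' h'
    rw [ext_con, subSig_con] at h'
    cases h' <;> decide

/-! # Spines of ordinary arguments -/

theorem Ty.target_rename : ∀ {n k : ℕ} (ρ : Fin n → Fin k) (A : Ty n),
    (A.rename ρ).target = A.target
  | _, _, _, .atom _ _ => rfl
  | _, _, _, .pi _ _ B => Ty.target_rename _ B

theorem Ty.target_hsub (τ : STy) : ∀ {k n : ℕ} {θ : Fin k → Option (Fin n)} {N : Tm n} {A : Ty k}
    {B : Ty n}, Ty.hsub τ θ N A = some B → B.target = A.target
  | _, _, _, _, .atom a S, _, h => by
      simp only [Ty.hsub, Option.map_eq_some_iff] at h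
      obtain ⟨_, _, rfl⟩ := h; rfl
  | _, _, _, _, .pi m A B, _, h => by
      simp only [Ty.hsub, Option.bind_eq_some_iff, Option.map_eq_some_iff] at h
      obtain ⟨_, _, _, h, rfl⟩ := h
      have := Ty.target_hsub τ h
      exact this

/-- Substitution does not change the family at the end of a type. This discards constructors of the
wrong family in the inversions of typing. -/
theorem ChkSp.target_eq {Ξ Ψ : Sig} {fwd : Prop} : ∀ {n : ℕ} {Γ : Ctx n} {S : Spine n} {A P : Ty n},
    ChkSp Ξ Ψ fwd Γ S A P → P.target = A.target
  | _, _, _, _, _, .nil => rfl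
  | _, _, _, _, _, @ChkSp.app _ _ _ _ _ _ _ _ B _ _ _ h h' =>
      (ChkSp.target_eq h').trans (Ty.target_hsub (A := B) _ h)
  | _, _, _, _, _, .papp _ _ h' => (ChkSp.target_eq h').trans (Ty.target_rename _ _)

section
variable {Ξ Ψ : Sig} {fwd : Prop} {n : ℕ} {Γ : Ctx n}

theorem chkSp_atom_iff {a : ℕ} {T S : Spine n} {P : Ty n} :
    ChkSp Ξ Ψ fwd Γ S (.atom a T) P ↔ S = .nil ∧ P = .atom a T := by
  constructor
  · intro h; cases h; exact ⟨rfl, rfl⟩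
  · rintro ⟨rfl, rfl⟩; exact .nil

theorem ChkTm.neu_of_atom {a : ℕ} {T : Spine n} {M : Tm n} (h : ChkTm Ξ Ψ fwd Γ M (.atom a T)) :
    ∃ H S, M = .neu H S := by
  cases h; exact ⟨_, _, rfl⟩

theorem consMode_ord (k : ℕ) : consMode .ord (fun _ : Fin k => Mode.ord) = fun _ => .ord := by
  funext i; refine Fin.cases rfl (fun j => rfl) i

/-- A constructor's type is kept fixed under a growing substitution `θ`. An argument of atomic type
is neutral, so the hereditary substitution it triggers merely extends `θ`, and a spine is checked by
reading the telescope. -/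
theorem chkSp_pi_iff {k a : ℕ} {T : Spine k} {B : Ty (k + 1)} (hB : FOTy (fun _ => .ord) B)
    {θ : Fin k → Tm n} {S : Spine n} {P : Ty n} :
    ChkSp Ξ Ψ fwd Γ S ((Ty.pi .ord (.atom a T) B).fsub θ) P ↔
      ∃ M S', S = .app M S' ∧ ChkTm Ξ Ψ fwd Γ M ((Ty.atom a T).fsub θ) ∧
        ChkSp Ξ Ψ fwd Γ S' (B.fsub (consTm M θ)) P := by
  have key : ∀ {M : Tm n}, ChkTm Ξ Ψ fwd Γ M ((Ty.atom a T).fsub θ) →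
      Ty.hsub .star theta0 M (B.fsub (liftTm θ)) = some (B.fsub (consTm M θ)) := by
    intro M hM
    obtain ⟨H, S, rfl⟩ := hM.neu_of_atom
    refine hB.hsub_fsub ?_
    rw [← consMode_ord]
    exact Follows.inst fun x h => nomatch h
  constructor
  · intro h
    simp only [Ty.fsub] at h
    cases h with
    | app h1 h2 h3 =>
      have := key h1
      rw [show (Ty.atom a (T.fsub θ)).erase = .star from rfl, this] at h2
      cases h2
      exact ⟨_, _, rfl, h1, h3⟩
  · rintro ⟨M, S', rfl, h1, h2⟩
    exact .app h1 (key h1) h2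

theorem FOTy.fsub_var {k : ℕ} {m : Fin k → Mode} {A : Ty k} (h : FOTy m A) :
    ∀ {n : ℕ} (ρ : Fin k → Fin n), A.rename ρ = A.fsub fun i => .v (ρ i) [] := by
  induction h with
  | atom h => intro n ρ; rw [Ty.rename, Ty.fsub, FOs.fsub_var ρ h]
  | pi _ _ ih ih' => intro n ρ; rw [Ty.rename, Ty.fsub, ih, ih', liftTm_var]

theorem FOTy.ofClosed {m : Fin 0 → Mode} {A : Ty 0} (h : FOTy m A) :
    (A.ofClosed : Ty n) = A.fsub Fin.elim0 := by
  rw [Ty.ofClosed, h.fsub_var]; congr 1; funext i; exact i.elim0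

theorem FOTy.tp {k : ℕ} {m : Fin k → Mode} : FOTy m .tp := .atom .nil

theorem FOTy.subtp {k : ℕ} {m : Fin k → Mode} {M N : Tm k} (hM : FO m M) (hN : FO m N) :
    FOTy m (.subtp M N) := .atom (.of_pair hM hN)

theorem FOTy.subtpinf {k : ℕ} {m : Fin k → Mode} {M N : Tm k} (hM : FO m M) (hN : FO m N) :
    FOTy m (.subtpinf M N) := .atom (.of_pair hM hN)

theorem FOTy.pi_ord {k : ℕ} {A : Ty k} {B : Ty (k + 1)} (hA : FOTy (fun _ => .ord) A)
    (hB : FOTy (fun _ => .ord) B) : FOTy (fun _ => .ord) (.pi .ord A B) :=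
  .pi hA (by rw [consMode_ord]; exact hB)

theorem chkSp_arr_iff {S : Spine n} {P : Ty n} :
    ChkSp Ξ Ψ fwd Γ S (Ty.pi .ord .tp (.pi .ord .tp .tp)).ofClosed P ↔
      ∃ M N, S = .ofList [M, N] ∧ ChkTm Ξ Ψ fwd Γ M .tp ∧ ChkTm Ξ Ψ fwd Γ N .tp ∧ P = .tp := by
  rw [(FOTy.pi_ord .tp (.pi_ord .tp .tp)).ofClosed]
  constructor
  · intro h
    obtain ⟨M, S, rfl, hM, h⟩ := (chkSp_pi_iff (.pi_ord .tp .tp)).1 h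
    obtain ⟨N, S, rfl, hN, h⟩ := (chkSp_pi_iff .tp).1 h
    obtain ⟨rfl, rfl⟩ := chkSp_atom_iff.1 h
    exact ⟨M, N, rfl, hM, hN, rfl⟩
  · rintro ⟨M, N, rfl, hM, hN, rfl⟩
    exact (chkSp_pi_iff (.pi_ord .tp .tp)).2 ⟨M, _, rfl, hM,
      (chkSp_pi_iff .tp).2 ⟨N, _, rfl, hN, .nil⟩⟩

theorem chkTm_tpFun_iff {m : Fin n → Mode} {M : Tm n} :
    ChkTm Ξ Ψ fwd (tpCtx m) M .tpFun ↔
      ∃ M', M = .lam M' ∧ ChkTm Ξ Ψ fwd (tpCtx (consMode .ord m)) M' .tp := by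
  constructor
  · intro h
    rw [Ty.tpFun] at h
    cases h with
    | lam h => exact ⟨_, rfl, h⟩
  · rintro ⟨M', rfl, h⟩
    exact .lam h

theorem chkSp_mu_iff {S : Spine n} {P : Ty n} :
    ChkSp Ξ Ψ fwd Γ S (Ty.pi .ord .tpFun (.pi .ord .tpFun .tp)).ofClosed P ↔
      ∃ M N, S = .ofList [M, N] ∧ ChkTm Ξ Ψ fwd Γ M .tpFun ∧ ChkTm Ξ Ψ fwd Γ N .tpFun ∧
        P = .tp := by
  constructor
  · intro h
    rw [show (Ty.pi .ord .tpFun (.pi .ord .tpFun .tp)).ofClosed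
      = (Ty.pi .ord .tpFun (.pi .ord .tpFun .tp) : Ty n) from rfl] at h
    cases h with
    | app h1 h2 h3 =>
      cases h2
      change ChkSp _ _ _ _ _ (Ty.pi .ord .tpFun .tp) _ at h3
      cases h3 with
      | app h4 h5 h6 =>
        cases h5
        obtain ⟨rfl, rfl⟩ := chkSp_atom_iff.1 h6
        exact ⟨_, _, rfl, h1, h4, rfl⟩
  · rintro ⟨M, N, rfl, hM, hN, rfl⟩
    exact .app hM rfl (.app hN rfl .nil)

end

/-! # Typing of terms of type `tp` -/

/-- The availability of a recursion constant. -/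
def Avail (Ξ Ψ : Sig) (fwd : Prop) (r : ℕ) (A : Ty 0) : Prop :=
  ∃ M, Ξ[r]? = some (.defn A M) ∨ (fwd ∧ Ψ[r]? = some (.defn A M))

section
variable {L : List (Ty 0 × Tm 0)} {Ψ : Sig} {fwd : Prop}

theorem chkSp_rc_iff {Ξ : Sig} {n : ℕ} {m : Fin n → Mode} {A : Ty 0} (hA : A.Prepat) {S : Spine n}
    {P : Ty n} : ChkSp Ξ Ψ fwd (tpCtx m) S A.ofClosed P ↔
      ∃ (k a : ℕ) (T : Spine k) (f : Fin k → Fin n), A = (Ty.atom a T).close ∧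
        (∀ x, m (f x) = .pre) ∧ S = pv f .nil ∧ P = .atom a (T.rename f) := by
  constructor
  · intro h
    obtain ⟨k, a, T, f, h1, h2, h3⟩ := ChkSp.exists_close hA _ h
    change S = _ at h2
    change A = _ at h1
    subst h1 h2 h3
    exact ⟨k, a, T, f, rfl, ((chkSp_close _ f _ _).1 h).1, rfl, rfl⟩
  · rintro ⟨k, a, T, f, rfl, hf, rfl, rfl⟩
    exact (chkSp_close _ f _ _).2 ⟨hf, .nil⟩

theorem Spine.eq_nil_of_rename {k n : ℕ} {f : Fin k → Fin n} {T : Spine k}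
    (h : T.rename f = .nil) : T = .nil := by
  cases T with
  | nil => rfl
  | _ => cases h

/-- The induction is on a bound for the size, because the subterms come from inverting the typing of
spines. The hypothesis `hav` ensures that recursion constants take only prepattern variables. -/
theorem WTp.of_chkTm_le (hav : ∀ r A, Avail (Sig.ext L) Ψ fwd r A → A.Prepat) (N : ℕ) :
    ∀ {n : ℕ} {m : Fin n → Mode} {M : Tm n}, sizeOf M < N →
    ChkTm (Sig.ext L) Ψ fwd (tpCtx m) M .tp → WTp (Avail (Sig.ext L) Ψ fwd) m M := by
  induction N with
  | zero => intro n m M hN; exact (Nat.not_lt_zero _ hN).elim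
  | succ N ih =>
    intro n m M hN h
    rw [Ty.tp] at h
    cases h with
    | neu h1 h2 =>
      obtain rfl := eqTy_tp_right h2
      cases h1 with
      | @var _ _ x _ _ h3 =>
        rw [tpCtx_get] at h3
        obtain ⟨rfl, -⟩ := chkSp_atom_iff.1 h3
        exact .var x
      | @rc _ r _ A M _ _ h3 h4 =>
        obtain ⟨k, a, T, f, rfl, hf, rfl, h5⟩ := (chkSp_rc_iff (hav r A ⟨M, h3⟩)).1 h4
        cases h6 : T.rename f with
        | nil =>
          obtain rfl := Spine.eq_nil_of_rename h6
          cases h5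
          exact .rc f ⟨M, h3⟩ hf
        | _ => rw [h6] at h5; cases h5
      | con h3 h4 =>
        rw [ext_con, subSig_con] at h3
        have h5 := h4.target_eq
        cases h3
        case bot => obtain ⟨rfl, -⟩ := chkSp_atom_iff.1 h4; exact .bot
        case top => obtain ⟨rfl, -⟩ := chkSp_atom_iff.1 h4; exact .top
        case arr =>
          obtain ⟨M, M', rfl, hM, hM', -⟩ := chkSp_arr_iff.1 h4
          simp only [Spine.ofList, Tm.neu.sizeOf_spec, Spine.app.sizeOf_spec] at hN
          exact .arr (ih (by omega) hM) (ih (by omega) hM')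
        case mu =>
          obtain ⟨M, M', rfl, hM, hM', -⟩ := chkSp_mu_iff.1 h4
          obtain ⟨M, rfl, hM₀⟩ := chkTm_tpFun_iff.1 hM
          obtain ⟨M', rfl, hM₀'⟩ := chkTm_tpFun_iff.1 hM'
          simp only [Spine.ofList, Tm.neu.sizeOf_spec, Spine.app.sizeOf_spec,
            Tm.lam.sizeOf_spec] at hN
          exact .mu (ih (by omega) hM₀) (ih (by omega) hM₀')
        -- The remaining constructors target `subtp` or `subtpinf`.
        all_goals cases h5

theorem WTp.of_chkTm (hav : ∀ r A, Avail (Sig.ext L) Ψ fwd r A → A.Prepat) {n : ℕ}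
    {m : Fin n → Mode} {M : Tm n} (h : ChkTm (Sig.ext L) Ψ fwd (tpCtx m) M .tp) :
    WTp (Avail (Sig.ext L) Ψ fwd) m M := WTp.of_chkTm_le hav _ (Nat.lt_succ_self _) h

theorem WTp.chkTm {n : ℕ} {m : Fin n → Mode} {M : Tm n} (h : WTp (Avail (Sig.ext L) Ψ fwd) m M) :
    ChkTm (Sig.ext L) Ψ fwd (tpCtx m) M .tp := by
  have tp_refl : ∀ {n : ℕ}, EqTy Ψ (Ty.tp : Ty n) .tp := EqTy.refl _ _ trivial
  induction h with
  | var x => exact .neu (.var (by rw [tpCtx_get]; exact .nil)) tp_refl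
  | bot => exact .neu (.con (ext_con.2 (subSig_con.2 .bot)) .nil) tp_refl
  | top => exact .neu (.con (ext_con.2 (subSig_con.2 .top)) .nil) tp_refl
  | arr _ _ ih ih' =>
    exact .neu (.con (ext_con.2 (subSig_con.2 .arr)) (chkSp_arr_iff.2 ⟨_, _, rfl, ih, ih', rfl⟩))
      tp_refl
  | mu _ _ ih ih' =>
    exact .neu (.con (ext_con.2 (subSig_con.2 .mu))
      (chkSp_mu_iff.2 ⟨_, _, rfl, chkTm_tpFun_iff.2 ⟨_, rfl, ih⟩, chkTm_tpFun_iff.2 ⟨_, rfl, ih'⟩,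
        rfl⟩)) tp_refl
  | @rc n k r m f h1 h2 =>
    obtain ⟨M, hM⟩ := h1
    exact .neu (.rc hM ((chkSp_close _ f _ _).2 ⟨h2, .nil⟩)) tp_refl

end

/-! # Hereditary substitution of functions on `tp` -/

theorem Tm.hsub_pair {k n c : ℕ} {τ : STy} {χ : Fin k → Option (Fin n)} {N : Tm n} {X Y : Tm k}
    {X' Y' : Tm n} (hX : Tm.hsub τ χ N X = some X') (hY : Tm.hsub τ χ N Y = some Y') :
    Tm.hsub τ χ N (.cst c [X, Y]) = some (.cst c [X', Y']) := by
  simp only [Tm.hsub] at hX hY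
  simp only [Tm.cst, Spine.ofList, Tm.hsub, Tm.hsubWith, Spine.hsubWith, hX, hY, Option.bind_some,
    Option.map_some]

theorem Ty.hsub_pair {k n a : ℕ} {τ : STy} {χ : Fin k → Option (Fin n)} {N : Tm n} {X Y : Tm k}
    {X' Y' : Tm n} (hX : Tm.hsub τ χ N X = some X') (hY : Tm.hsub τ χ N Y = some Y') :
    Ty.hsub τ χ N (.atom a (.ofList [X, Y])) = some (.atom a (.ofList [X', Y'])) := by
  simp only [Tm.hsub] at hX hY
  simp only [Spine.ofList, Ty.hsub, Spine.hsub, Spine.hsubWith, hX, hY, Option.bind_some,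
    Option.map_some]

theorem FO.fsub_neu {k n : ℕ} {θ : Fin k → Tm n} (hθ : ∀ x, ∃ H S, θ x = .neu H S) {M : Tm k}
    (hM : ∃ H S, M = .neu H S) : ∃ H S, M.fsub θ = .neu H S := by
  obtain ⟨H, S, rfl⟩ := hM
  cases H with
  | var x => exact hθ x
  | con c => exact ⟨_, _, rfl⟩
  | rc r => exact ⟨_, _, rfl⟩

/-- The variable `F` of type `tp → tp` in long form. -/
def Tm.eta {n : ℕ} (F : Fin n) : Tm n := .lam (.v F.succ [.v 0 []])

/-- The instantiation of the innermost variable. -/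
def Tm.inst {n : ℕ} (M : Tm (n + 1)) (N : Tm n) : Tm n := M.fsub (consTm N fun i => .v i [])

section
variable {k n : ℕ} {m : Fin n → Mode} {χ : Fin k → Option (Fin n)} {M : Tm (n + 1)} {F : Fin k}

theorem hsub_app_some {N : Tm n} {τ : STy} {F' : Fin n} {U : Tm k} {U' : Tm n} (hF : χ F = some F')
    (hU : Tm.hsub τ χ N U = some U') : Tm.hsub τ χ N (.v F [U]) = some (.v F' [U']) := by
  simp only [Tm.hsub] at hU
  simp only [Tm.v, Spine.ofList, Tm.hsub, Tm.hsubWith, Spine.hsubWith, hU, hF, Option.bind_some,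
    Option.map_some]

theorem hsub_eta_some {N : Tm n} {τ : STy} {F' : Fin n} (hF : χ F = some F') :
    Tm.hsub τ χ N (.eta F) = some (.eta F') := by
  have := hsub_app_some (χ := liftOpt χ) (τ := τ) (N := N.rename Fin.succ) (F := F.succ)
    (F' := F'.succ) (U := .v 0 []) (U' := .v 0 [])
    (by show (χ F).map Fin.succ = _; rw [hF]; rfl) rfl
  simp only [Tm.hsub] at this
  simp only [Tm.eta, Tm.hsub, Tm.hsubWith, this, Option.map_some]

theorem WTp.inst_neu {av : ℕ → Ty 0 → Prop} (hM : WTp av (consMode .ord m) M) {U : Tm n}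
    (hU : ∃ H S, U = .neu H S) : ∃ H S, M.inst U = .neu H S :=
  FO.fsub_neu (fun x => by refine Fin.cases hU (fun j => ⟨_, _, rfl⟩) x) hM.neu

/-- The only kind of redex met at type `tp → tp`. Contracting it substitutes at the base type, which
is first-order substitution and creates no further redex. -/
theorem hsub_app_none {av : ℕ → Ty 0 → Prop} (hM : WTp av (consMode .ord m) M)
    {U : Tm k} {U' : Tm n} (hF : χ F = none) (hU : Tm.hsub (.arr .star .star) χ (.lam M) U = some U')
    (hU' : ∃ H S, U' = .neu H S) :
    Tm.hsub (.arr .star .star) χ (.lam M) (.v F [U]) = some (M.inst U') := by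
  obtain ⟨H', S', h⟩ := hM.inst_neu hU'
  obtain ⟨H, S, rfl⟩ := hU'
  have key : Tm.hsub .star theta0 (.neu H S) M = some (M.inst (.neu H S)) := by
    have := Follows.inst (H := H) (S := S) (m := m) (θ := fun i => Tm.v i [])
      (fun x _ => ⟨x, rfl⟩)
    rw [liftTm_var (fun i => i), liftRen_id] at this
    have := FO.hsub_fsub this hM.fo
    rwa [hM.fo.fsub_v] at this
  simp only [Tm.hsub] at hU key
  simp only [Tm.v, Spine.ofList, Tm.hsub, Tm.hsubWith, Spine.hsubWith, hU, hF, Option.bind_some,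
    Option.map_some, reduce, key]
  -- Reduction with the empty remaining spine at the base type succeeds because the contractum is
  -- neutral.
  rw [h]; rfl

theorem inst_rename_v_zero {m : Fin (n + 1) → Mode} (hM : FO m M) :
    (M.rename (liftRen Fin.succ)).inst (.v 0 []) = M := by
  rw [Tm.inst, Tm.fsub_of_rename]
  conv_rhs => rw [← hM.fsub_v]
  congr 1; funext i; refine Fin.cases rfl (fun j => rfl) i

/-- Below the abstraction the function is applied to the bound variable, and contracting that redex
restores its body. -/
theorem hsub_eta_none {av : ℕ → Ty 0 → Prop} (hM : WTp av (consMode .ord m) M) (hF : χ F = none) :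
    Tm.hsub (.arr .star .star) χ (.lam M) (.eta F) = some (.lam M) := by
  have h1 : WTp av (consMode .ord (consMode .ord m)) (M.rename (liftRen Fin.succ)) :=
    hM.rename (consMode_liftRen (m := m) (m' := consMode .ord m) (ρ := Fin.succ) (fun _ h => h) _)
  have := hsub_app_none (χ := liftOpt χ) (M := M.rename (liftRen Fin.succ)) (F := F.succ)
    (U := .v 0 []) (U' := .v 0 []) h1
    (by show (χ F).map Fin.succ = _; rw [hF]; rfl) rfl ⟨_, _, rfl⟩
  rw [inst_rename_v_zero hM.fo] at this
  simp only [Tm.hsub] at this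
  simp only [Tm.eta, Tm.hsub, Tm.hsubWith, Tm.rename, this, Option.map_some]

end

/-- The term `mu (λ x. M) (λ x. N)`. -/
def Tm.muTm {n : ℕ} (M N : Tm (n + 1)) : Tm n := .cst kMu [.lam M, .lam N]

/-- The unrolling of `mu (λ x. M) (λ x. N)`. -/
def Tm.unrollTm {n : ℕ} (M N : Tm (n + 1)) : Tm n :=
  .cst kArr [M.inst (.muTm M N), N.inst (.muTm M N)]

section
variable {n : ℕ} {m : Fin n → Mode} {M N : Tm (n + 1)} {av : ℕ → Ty 0 → Prop}

/-- The term `mu (λ x. M) G` for a variable `G`. -/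
def Tm.muHalf (M : Tm (n + 1)) : Tm (n + 1) :=
  .cst kMu [.lam (M.rename (liftRen Fin.succ)), .eta 0]

/-- The unrolling of `mu (λ x. M) G`. -/
def Tm.unrollHalf (M : Tm (n + 1)) : Tm (n + 1) :=
  .cst kArr [(M.rename (liftRen Fin.succ)).inst M.muHalf, .v 0 [M.muHalf]]

/-- The two functional arguments of `unfold` and `fold` are substituted one after the other. The
`Half` terms are the intermediate results, in which the second argument is still a variable. -/
theorem hsub_muVar (hM : WTp av (consMode .ord m) M) :
    Tm.hsub (.arr .star .star) (liftOpt theta0) ((Tm.lam M).rename Fin.succ)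
      (.muVar (Fin.succ 0) 0) = some M.muHalf := by
  have h1 : WTp av (consMode .ord (consMode .ord m)) (M.rename (liftRen Fin.succ)) :=
    hM.rename (consMode_liftRen (m := m) (m' := consMode .ord m) (ρ := Fin.succ) (fun _ h => h) _)
  exact Tm.hsub_pair (hsub_eta_none h1 rfl) (hsub_eta_some rfl)

theorem hsub_unrollVar (hM : WTp av (consMode .ord m) M) :
    Tm.hsub (.arr .star .star) (liftOpt theta0) ((Tm.lam M).rename Fin.succ)
      (.unrollVar (Fin.succ 0) 0) = some M.unrollHalf := by
  have h1 : WTp av (consMode .ord (consMode .ord m)) (M.rename (liftRen Fin.succ)) :=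
    hM.rename (consMode_liftRen (m := m) (m' := consMode .ord m) (ρ := Fin.succ) (fun _ h => h) _)
  exact Tm.hsub_pair (hsub_app_none h1 rfl (hsub_muVar hM) ⟨_, _, rfl⟩)
    (hsub_app_some rfl (hsub_muVar hM))

theorem hsub_muHalf (hN : WTp av (consMode .ord m) N) :
    Tm.hsub (.arr .star .star) theta0 (.lam N) M.muHalf = some (.muTm M N) :=
  Tm.hsub_pair (Tm.hsub_theta0_rename_succ _ _ (.lam M)) (hsub_eta_none hN rfl)

theorem hsub_unrollHalf (hM : WTp av (consMode .ord m) M) (hN : WTp av (consMode .ord m) N) :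
    Tm.hsub (.arr .star .star) theta0 (.lam N) M.unrollHalf = some (.unrollTm M N) := by
  refine Tm.hsub_pair ?_ (hsub_app_none hN rfl (hsub_muHalf hN) ⟨_, _, rfl⟩)
  rw [Tm.inst, Tm.fsub_of_rename]
  refine FO.hsub_fsub ⟨fun x => ?_, fun x => ?_⟩ hM.fo
  · refine Fin.cases (hsub_muHalf hN) (fun j => rfl) x
  · refine Fin.cases (fun h => nomatch h) (fun j hj => ⟨j.succ, j, rfl, rfl, rfl⟩) x

end

/-! # Spines of the constructors -/

theorem FO.cst_nil {n c : ℕ} {m : Fin n → Mode} : FO m (.cst c []) := .con .nil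

section
variable {L : List (Ty 0 × Tm 0)} {Ψ : Sig} {fwd : Prop} {n : ℕ} {m : Fin n → Mode}
  {S : Spine n} {P : Ty n}

local notation "Chk" => ChkTm (Sig.ext L) Ψ fwd (tpCtx m)
local notation "Sp" => ChkSp (Sig.ext L) Ψ fwd (tpCtx m)

theorem chkSp_subtpTop_iff :
    Sp S (Ty.pi .ord .tp (.subtp (.v 0 []) (.cst kTop []))).ofClosed P ↔
      ∃ T, S = .ofList [T] ∧ Chk T .tp ∧ P = .subtp T (.cst kTop []) := by
  have h0 : FOTy (fun _ => Mode.ord) (Ty.subtp (.v 0 []) (.cst kTop []) : Ty 1) :=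
    .subtp (.v _) .cst_nil
  rw [(FOTy.pi_ord .tp h0).ofClosed]
  refine (chkSp_pi_iff h0).trans ?_
  constructor
  · rintro ⟨T, S, rfl, hT, h⟩
    obtain ⟨rfl, rfl⟩ := chkSp_atom_iff.1 h
    exact ⟨T, rfl, hT, rfl⟩
  · rintro ⟨T, rfl, hT, rfl⟩
    exact ⟨T, _, rfl, hT, .nil⟩

theorem chkSp_subtpBot_iff :
    Sp S (Ty.pi .ord .tp (.subtp (.cst kBot []) (.v 0 []))).ofClosed P ↔
      ∃ T, S = .ofList [T] ∧ Chk T .tp ∧ P = .subtp (.cst kBot []) T := by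
  have h0 : FOTy (fun _ => Mode.ord) (Ty.subtp (.cst kBot []) (.v 0 []) : Ty 1) :=
    .subtp .cst_nil (.v _)
  rw [(FOTy.pi_ord .tp h0).ofClosed]
  refine (chkSp_pi_iff h0).trans ?_
  constructor
  · rintro ⟨T, S, rfl, hT, h⟩
    obtain ⟨rfl, rfl⟩ := chkSp_atom_iff.1 h
    exact ⟨T, rfl, hT, rfl⟩
  · rintro ⟨T, rfl, hT, rfl⟩
    exact ⟨T, _, rfl, hT, .nil⟩

theorem chkSp_refl_iff :
    Sp S (Ty.pi .ord .tp (.subtp (.v 0 []) (.v 0 []))).ofClosed P ↔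
      ∃ T, S = .ofList [T] ∧ Chk T .tp ∧ P = .subtp T T := by
  have h0 : FOTy (fun _ => Mode.ord) (Ty.subtp (.v 0 []) (.v 0 []) : Ty 1) :=
    .subtp (.v _) (.v _)
  rw [(FOTy.pi_ord .tp h0).ofClosed]
  refine (chkSp_pi_iff h0).trans ?_
  constructor
  · rintro ⟨T, S, rfl, hT, h⟩
    obtain ⟨rfl, rfl⟩ := chkSp_atom_iff.1 h
    exact ⟨T, rfl, hT, rfl⟩
  · rintro ⟨T, rfl, hT, rfl⟩
    exact ⟨T, _, rfl, hT, .nil⟩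

theorem chkSp_trans_iff :
    Sp S (Ty.pi .ord .tp (.pi .ord .tp (.pi .ord .tp
      (.pi .ord (.subtp (.v 2 []) (.v 1 []))
        (.pi .ord (.subtp (.v 2 []) (.v 1 [])) (.subtp (.v 4 []) (.v 2 []))))))).ofClosed P ↔
      ∃ T₁ T₂ T₃ D E, S = .ofList [T₁, T₂, T₃, D, E] ∧ Chk T₁ .tp ∧ Chk T₂ .tp ∧ Chk T₃ .tp ∧
        Chk D (.subtp T₁ T₂) ∧ Chk E (.subtp T₂ T₃) ∧ P = .subtp T₁ T₃ := by
  have h5 : FOTy (fun _ => Mode.ord) (Ty.subtp (.v 4 []) (.v 2 []) : Ty 5) := .subtp (.v _) (.v _)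
  have h4 := FOTy.pi_ord (.subtp (.v 2) (.v 1)) h5
  have h3 := FOTy.pi_ord (.subtp (.v 2) (.v 1)) h4
  have h2 := FOTy.pi_ord .tp h3
  have h1 := FOTy.pi_ord .tp h2
  rw [(FOTy.pi_ord .tp h1).ofClosed]
  refine (chkSp_pi_iff h1).trans ?_
  constructor
  · rintro ⟨T₁, S, rfl, hT₁, h⟩
    obtain ⟨T₂, S, rfl, hT₂, h⟩ := (chkSp_pi_iff h2).1 h
    obtain ⟨T₃, S, rfl, hT₃, h⟩ := (chkSp_pi_iff h3).1 h
    obtain ⟨D, S, rfl, hD, h⟩ := (chkSp_pi_iff h4).1 h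
    obtain ⟨E, S, rfl, hE, h⟩ := (chkSp_pi_iff h5).1 h
    obtain ⟨rfl, rfl⟩ := chkSp_atom_iff.1 h
    exact ⟨T₁, T₂, T₃, D, E, rfl, hT₁, hT₂, hT₃, hD, hE, rfl⟩
  · rintro ⟨T₁, T₂, T₃, D, E, rfl, hT₁, hT₂, hT₃, hD, hE, rfl⟩
    exact ⟨T₁, _, rfl, hT₁, (chkSp_pi_iff h2).2 ⟨T₂, _, rfl, hT₂, (chkSp_pi_iff h3).2
      ⟨T₃, _, rfl, hT₃, (chkSp_pi_iff h4).2 ⟨D, _, rfl, hD, (chkSp_pi_iff h5).2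
        ⟨E, _, rfl, hE, .nil⟩⟩⟩⟩⟩

theorem chkSp_subtpArr_iff :
    Sp S (Ty.pi .ord .tp (.pi .ord .tp
      (.pi .ord (.subtpinf (.v 1 []) (.v 0 [])) (.subtp (.v 2 []) (.v 1 []))))).ofClosed P ↔
      ∃ T₁ T₂ D, S = .ofList [T₁, T₂, D] ∧ Chk T₁ .tp ∧ Chk T₂ .tp ∧
        Chk D (.subtpinf T₁ T₂) ∧ P = .subtp T₁ T₂ := by
  have h3 : FOTy (fun _ => Mode.ord) (Ty.subtp (.v 2 []) (.v 1 []) : Ty 3) := .subtp (.v _) (.v _)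
  have h2 := FOTy.pi_ord (.subtpinf (.v 1) (.v 0)) h3
  have h1 := FOTy.pi_ord .tp h2
  rw [(FOTy.pi_ord .tp h1).ofClosed]
  refine (chkSp_pi_iff h1).trans ?_
  constructor
  · rintro ⟨T₁, S, rfl, hT₁, h⟩
    obtain ⟨T₂, S, rfl, hT₂, h⟩ := (chkSp_pi_iff h2).1 h
    obtain ⟨D, S, rfl, hD, h⟩ := (chkSp_pi_iff h3).1 h
    obtain ⟨rfl, rfl⟩ := chkSp_atom_iff.1 h
    exact ⟨T₁, T₂, D, rfl, hT₁, hT₂, hD, rfl⟩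
  · rintro ⟨T₁, T₂, D, rfl, hT₁, hT₂, hD, rfl⟩
    exact ⟨T₁, _, rfl, hT₁, (chkSp_pi_iff h2).2 ⟨T₂, _, rfl, hT₂, (chkSp_pi_iff h3).2
      ⟨D, _, rfl, hD, .nil⟩⟩⟩

theorem chkSp_infArr_iff :
    Sp S (Ty.pi .ord .tp (.pi .ord .tp (.pi .ord .tp (.pi .ord .tp
      (.pi .ord (.subtp (.v 3 []) (.v 2 []))
        (.pi .ord (.subtp (.v 2 []) (.v 1 []))
          (.subtpinf (.cst kArr [.v 4 [], .v 3 []])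
            (.cst kArr [.v 5 [], .v 2 []])))))))).ofClosed P ↔
      ∃ T₁ S₁ S₂ T₂ D E, S = .ofList [T₁, S₁, S₂, T₂, D, E] ∧ Chk T₁ .tp ∧ Chk S₁ .tp ∧
        Chk S₂ .tp ∧ Chk T₂ .tp ∧ Chk D (.subtp T₁ S₁) ∧ Chk E (.subtp S₂ T₂) ∧
        P = .subtpinf (.cst kArr [S₁, S₂]) (.cst kArr [T₁, T₂]) := by
  have h6 : FOTy (fun _ => Mode.ord)
      (Ty.subtpinf (.cst kArr [.v 4 [], .v 3 []]) (.cst kArr [.v 5 [], .v 2 []]) : Ty 6) :=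
    .subtpinf (.con (.of_pair (.v _) (.v _))) (.con (.of_pair (.v _) (.v _)))
  have h5 := FOTy.pi_ord (.subtp (.v 2) (.v 1)) h6
  have h4 := FOTy.pi_ord (.subtp (.v 3) (.v 2)) h5
  have h3 := FOTy.pi_ord .tp h4
  have h2 := FOTy.pi_ord .tp h3
  have h1 := FOTy.pi_ord .tp h2
  rw [(FOTy.pi_ord .tp h1).ofClosed]
  refine (chkSp_pi_iff h1).trans ?_
  constructor
  · rintro ⟨T₁, S, rfl, hT₁, h⟩
    obtain ⟨S₁, S, rfl, hS₁, h⟩ := (chkSp_pi_iff h2).1 h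
    obtain ⟨S₂, S, rfl, hS₂, h⟩ := (chkSp_pi_iff h3).1 h
    obtain ⟨T₂, S, rfl, hT₂, h⟩ := (chkSp_pi_iff h4).1 h
    obtain ⟨D, S, rfl, hD, h⟩ := (chkSp_pi_iff h5).1 h
    obtain ⟨E, S, rfl, hE, h⟩ := (chkSp_pi_iff h6).1 h
    obtain ⟨rfl, rfl⟩ := chkSp_atom_iff.1 h
    exact ⟨T₁, S₁, S₂, T₂, D, E, rfl, hT₁, hS₁, hS₂, hT₂, hD, hE, rfl⟩
  · rintro ⟨T₁, S₁, S₂, T₂, D, E, rfl, hT₁, hS₁, hS₂, hT₂, hD, hE, rfl⟩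
    exact ⟨T₁, _, rfl, hT₁, (chkSp_pi_iff h2).2 ⟨S₁, _, rfl, hS₁, (chkSp_pi_iff h3).2
      ⟨S₂, _, rfl, hS₂, (chkSp_pi_iff h4).2 ⟨T₂, _, rfl, hT₂, (chkSp_pi_iff h5).2
        ⟨D, _, rfl, hD, (chkSp_pi_iff h6).2 ⟨E, _, rfl, hE, .nil⟩⟩⟩⟩⟩⟩

/-- A constructor with two arguments of type `tp → tp`. -/
theorem chkSp_tpFun_tpFun_iff (hav : ∀ r A, Avail (Sig.ext L) Ψ fwd r A → A.Prepat) {a : ℕ}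
    {X Y : Tm 2} {X' Y' : Tm (n + 1) → Tm (n + 1)} {X'' Y'' : Tm (n + 1) → Tm (n + 1) → Tm n}
    (hX : ∀ {M}, WTp (Avail (Sig.ext L) Ψ fwd) (consMode .ord m) M →
      Tm.hsub (.arr .star .star) (liftOpt theta0) ((Tm.lam M).rename Fin.succ)
        (X.rename (liftRen (liftRen Fin.elim0))) = some (X' M))
    (hY : ∀ {M}, WTp (Avail (Sig.ext L) Ψ fwd) (consMode .ord m) M →
      Tm.hsub (.arr .star .star) (liftOpt theta0) ((Tm.lam M).rename Fin.succ)
        (Y.rename (liftRen (liftRen Fin.elim0))) = some (Y' M))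
    (hX' : ∀ {M N}, WTp (Avail (Sig.ext L) Ψ fwd) (consMode .ord m) M →
      WTp (Avail (Sig.ext L) Ψ fwd) (consMode .ord m) N →
      Tm.hsub (.arr .star .star) theta0 (.lam N) (X' M) = some (X'' M N))
    (hY' : ∀ {M N}, WTp (Avail (Sig.ext L) Ψ fwd) (consMode .ord m) M →
      WTp (Avail (Sig.ext L) Ψ fwd) (consMode .ord m) N →
      Tm.hsub (.arr .star .star) theta0 (.lam N) (Y' M) = some (Y'' M N)) :
    Sp S (Ty.pi .ord .tpFun (.pi .ord .tpFun (.atom a (.ofList [X, Y])))).ofClosed P ↔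
      ∃ M N, S = .ofList [.lam M, .lam N] ∧
        WTp (Avail (Sig.ext L) Ψ fwd) (consMode .ord m) M ∧
        WTp (Avail (Sig.ext L) Ψ fwd) (consMode .ord m) N ∧
        P = .atom a (.ofList [X'' M N, Y'' M N]) := by
  have h1 : ∀ {M}, WTp (Avail (Sig.ext L) Ψ fwd) (consMode .ord m) M →
      Ty.hsub (Ty.tpFun : Ty n).erase theta0 (.lam M)
        (.pi .ord .tpFun (.atom a (.ofList [X.rename (liftRen (liftRen Fin.elim0)),
          Y.rename (liftRen (liftRen Fin.elim0))])))
        = some (.pi .ord .tpFun (.atom a (.ofList [X' M, Y' M]))) := by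
    intro M hM
    rw [Ty.hsub, show Ty.hsub (Ty.tpFun : Ty n).erase theta0 (.lam M) .tpFun = some .tpFun from rfl,
      show (Ty.tpFun : Ty n).erase = .arr .star .star from rfl, Ty.hsub_pair (hX hM) (hY hM)]
    rfl
  constructor
  · intro h
    change Sp S (.pi .ord .tpFun (.pi .ord .tpFun
      (.atom a (.ofList [X.rename (liftRen (liftRen Fin.elim0)),
        Y.rename (liftRen (liftRen Fin.elim0))])))) P at h
    cases h with
    | app h2 h3 h4 =>
      obtain ⟨M, rfl, hM⟩ := chkTm_tpFun_iff.1 h2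
      have hM := WTp.of_chkTm hav hM
      rw [h1 hM] at h3
      cases h3
      cases h4 with
      | app h5 h6 h7 =>
        obtain ⟨N, rfl, hN⟩ := chkTm_tpFun_iff.1 h5
        have hN := WTp.of_chkTm hav hN
        rw [show (Ty.tpFun : Ty n).erase = .arr .star .star from rfl,
          Ty.hsub_pair (hX' hM hN) (hY' hM hN)] at h6
        cases h6
        obtain ⟨rfl, rfl⟩ := chkSp_atom_iff.1 h7
        exact ⟨M, N, rfl, hM, hN, rfl⟩
  · rintro ⟨M, N, rfl, hM, hN, rfl⟩
    change Sp _ (.pi .ord .tpFun (.pi .ord .tpFun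
      (.atom a (.ofList [X.rename (liftRen (liftRen Fin.elim0)),
        Y.rename (liftRen (liftRen Fin.elim0))])))) _
    exact .app (chkTm_tpFun_iff.2 ⟨M, rfl, hM.chkTm⟩) (h1 hM)
      (.app (chkTm_tpFun_iff.2 ⟨N, rfl, hN.chkTm⟩) (Ty.hsub_pair (hX' hM hN) (hY' hM hN)) .nil)

theorem chkSp_unfold_iff (hav : ∀ r A, Avail (Sig.ext L) Ψ fwd r A → A.Prepat) :
    Sp S (Ty.pi .ord .tpFun (.pi .ord .tpFun (.subtp (.muVar 1 0) (.unrollVar 1 0)))).ofClosed P ↔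
      ∃ M N, S = .ofList [.lam M, .lam N] ∧
        WTp (Avail (Sig.ext L) Ψ fwd) (consMode .ord m) M ∧
        WTp (Avail (Sig.ext L) Ψ fwd) (consMode .ord m) N ∧
        P = .subtp (.muTm M N) (.unrollTm M N) :=
  chkSp_tpFun_tpFun_iff hav (fun hM => hsub_muVar hM) (fun hM => hsub_unrollVar hM)
    (fun _ hN => hsub_muHalf hN) (fun hM hN => hsub_unrollHalf hM hN)

theorem chkSp_fold_iff (hav : ∀ r A, Avail (Sig.ext L) Ψ fwd r A → A.Prepat) :
    Sp S (Ty.pi .ord .tpFun (.pi .ord .tpFun (.subtp (.unrollVar 1 0) (.muVar 1 0)))).ofClosed P ↔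
      ∃ M N, S = .ofList [.lam M, .lam N] ∧
        WTp (Avail (Sig.ext L) Ψ fwd) (consMode .ord m) M ∧
        WTp (Avail (Sig.ext L) Ψ fwd) (consMode .ord m) N ∧
        P = .subtp (.unrollTm M N) (.muTm M N) :=
  chkSp_tpFun_tpFun_iff hav (fun hM => hsub_unrollVar hM) (fun hM => hsub_muVar hM)
    (fun hM hN => hsub_unrollHalf hM hN) (fun _ hN => hsub_muHalf hN)

end

/-! # Valid signatures -/

/-- The consequences of validity for an extension of the signature. -/
structure Good (Ψ : Sig) : Prop where
  ext : ∃ L, Ψ = Sig.ext L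
  prepat : ∀ {r : ℕ} {A : Ty 0} {M : Tm 0}, Ψ[r]? = some (.defn A M) → A.Prepat
  contra : ∀ {r : ℕ} {A : Ty 0} {M : Tm 0}, Ψ[r]? = some (.defn A M) → M.Contra
  chkTy : ∀ {r : ℕ} {A : Ty 0} {M : Tm 0}, Ψ[r]? = some (.defn A M) → ChkTy (Ψ.take r) Ψ False .nil A
  chkTm : ∀ {r : ℕ} {A : Ty 0} {M : Tm 0}, Ψ[r]? = some (.defn A M) → ChkTm (Ψ.take r) Ψ True .nil M A
  acyclic : ∀ r, ¬ Relation.TransGen (Edge Ψ) r r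

theorem LocalSig.defn_inv {Ψ Ξ : Sig} (h : LocalSig Ψ Ξ) : ∀ {r : ℕ} {A : Ty 0} {M : Tm 0},
    Ξ[r]? = some (.defn A M) → ChkTy (Ξ.take r) Ψ False .nil A ∧ A.Prepat ∧ M.Contra ∧
      GuardTm Ψ r ∅ ∅ M := by
  have step : ∀ {Ξ : Sig} {d : Decl}, (∀ {r : ℕ} {A : Ty 0} {M : Tm 0},
      Ξ[r]? = some (.defn A M) → ChkTy (Ξ.take r) Ψ False .nil A ∧ A.Prepat ∧ M.Contra ∧
        GuardTm Ψ r ∅ ∅ M) →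
      (∀ {A M}, d = .defn A M → ChkTy Ξ Ψ False .nil A ∧ A.Prepat ∧ M.Contra ∧
        GuardTm Ψ Ξ.length ∅ ∅ M) →
      ∀ {r : ℕ} {A : Ty 0} {M : Tm 0}, (Ξ ++ [d])[r]? = some (.defn A M) →
        ChkTy ((Ξ ++ [d]).take r) Ψ False .nil A ∧ A.Prepat ∧ M.Contra ∧ GuardTm Ψ r ∅ ∅ M := by
    intro Ξ d ih hd r A M hr
    rcases Nat.lt_trichotomy r Ξ.length with hlt | rfl | hlt
    · rw [List.getElem?_append_left hlt] at hr
      rw [List.take_append_of_le_length hlt.le]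
      exact ih hr
    · rw [List.getElem?_append_right le_rfl] at hr
      simp only [Nat.sub_self, List.getElem?_cons_zero, Option.some.injEq] at hr
      rw [List.take_left]
      exact hd hr
    · rw [List.getElem?_eq_none (by simp; omega)] at hr
      cases hr
  induction h with
  | nil => intro r A M h; simp at h
  | fam _ _ ih => exact step ih (fun h => by cases h)
  | con _ _ ih => exact step ih (fun h => by cases h)
  | defn _ h1 h2 h3 h4 ih => exact step ih (fun h => by cases h; exact ⟨h1, h2, h3, h4⟩)

theorem Good.of_valid {L : List (Ty 0 × Tm 0)} (h : (Sig.ext L).Valid) : Good (Sig.ext L) where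
  ext := ⟨L, rfl⟩
  prepat hr := (h.1.defn_inv hr).2.1
  contra hr := (h.1.defn_inv hr).2.2.1
  chkTy hr := (h.1.defn_inv hr).1
  chkTm hr := h.2 _ _ _ hr
  acyclic := edge_acyclic (fun _ hC => validTrace_iff.1 hC) fun _ _ _ hr => (h.1.defn_inv hr).2.2.2

section
variable {Ψ : Sig}

theorem avail_self : Avail Ψ Ψ False = Defd Ψ := by
  funext r A
  simp only [Avail, Defd, false_and, or_false]

theorem getElem?_of_take {r s : ℕ} {d : Decl} (h : (Ψ.take r)[s]? = some d) : Ψ[s]? = some d := by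
  rw [List.getElem?_take] at h
  split at h
  · exact h
  · cases h

theorem avail_take_true (r : ℕ) : Avail (Ψ.take r) Ψ True = Defd Ψ := by
  funext s A
  simp only [Avail, Defd, true_and]
  refine propext ⟨?_, fun ⟨M, h⟩ => ⟨M, .inr h⟩⟩
  rintro ⟨M, h | h⟩
  · exact ⟨M, getElem?_of_take h⟩
  · exact ⟨M, h⟩

/-- Classifiers see only earlier declarations, so here there is just an implication, whereas bodies,
checked with forward references, give the equality `avail_take_true`. -/
theorem avail_take_false {r s : ℕ} {A : Ty 0} (h : Avail (Ψ.take r) Ψ False s A) : Defd Ψ s A := by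
  obtain ⟨M, h | h⟩ := h
  · exact ⟨M, getElem?_of_take h⟩
  · exact h.1.elim

theorem Good.take_ext (hΨ : Good Ψ) {r : ℕ} {A : Ty 0} {M : Tm 0}
    (hr : Ψ[r]? = some (.defn A M)) : ∃ L, Ψ.take r = Sig.ext L := by
  obtain ⟨L, rfl⟩ := hΨ.ext
  exact ⟨_, CoLF.take_ext (ext_defn.1 hr).1⟩

theorem Good.prepat_of_defd (hΨ : Good Ψ) {r : ℕ} {A : Ty 0} (h : Defd Ψ r A) : A.Prepat :=
  hΨ.prepat h.choose_spec

/-- The body of a recursive definition whose type abstracts over variables of type `tp`. -/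
theorem Good.body (hΨ : Good Ψ) {r k : ℕ} {A : Ty k} {B : Tm 0}
    (hr : Ψ[r]? = some (.defn A.close B)) : ∃ B₀ : Tm k, B = B₀.close ∧ B₀.Contra ∧
      ChkTm (Ψ.take r) Ψ True (preCtx k) B₀ A := by
  obtain ⟨B₀, rfl, h⟩ := chkTm_close.1 (hΨ.chkTm hr)
  exact ⟨B₀, rfl, contra_close.1 (hΨ.contra hr), h⟩

/-- Every well-formed term of type `tp` represents a recursive type. -/
theorem Good.exists_tpRep (hΨ : Good Ψ) {n : ℕ} {m : Fin n → Mode} {M : Tm n}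
    (hM : WTp (Defd Ψ) m M) : ∃ σ, TpRep Ψ M σ := by
  have key : ∀ (s k : ℕ) (B : Tm 0), Ψ[s]? = some (.defn (Ty.tp : Ty k).close B) →
      ∃ B₀ : Tm k, B = B₀.close ∧ B₀.Contra ∧ ∃ σ, TpRep Ψ B₀ σ := by
    intro s
    -- Every recursion constant in a body of type `tp` is a successor in the graph, so acyclicity
    -- makes the unfolding terminate.
    induction s using (edge_wellFounded hΨ.acyclic).induction with
    | _ s ih =>
      intro k B hs
      obtain ⟨B₀, rfl, hc, hB⟩ := hΨ.body hs
      refine ⟨B₀, rfl, hc, ?_⟩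
      obtain ⟨L, hL⟩ := hΨ.take_ext hs
      have hav := avail_take_true (Ψ := Ψ) s
      rw [hL] at hB hav
      have hB := WTp.of_chkTm (fun r A h => hΨ.prepat_of_defd (by rwa [hav] at h)) hB
      rw [hav] at hB
      exact hB.exists_tpRep_of fun t ht k' B' hB' => ih t ⟨_, _, hs, (Tm.occ_close t).2 ht⟩ k' B' hB'
  exact hM.exists_tpRep_of fun s _ => key s

/-- A well-formed term that represents the recursive type. -/
def WRep (Ψ : Sig) {n : ℕ} (m : Fin n → Mode) (M : Tm n) (σ : RTy n) : Prop :=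
  WTp (Defd Ψ) m M ∧ TpRep Ψ M σ

theorem WRep.enc (Ψ : Sig) {n : ℕ} (m : Fin n → Mode) (σ : RTy n) : WRep Ψ m σ.enc σ :=
  ⟨.enc _ _ _, .enc _ _⟩

theorem WRep.rename {n k : ℕ} {m : Fin n → Mode} {M : Tm n} {σ : RTy n} (h : WRep Ψ m M σ)
    {m' : Fin k → Mode} {ρ : Fin n → Fin k} (hρ : ∀ x, m x = .pre → m' (ρ x) = .pre) :
    WRep Ψ m' (M.rename ρ) (σ.rename ρ) := ⟨h.1.rename hρ, h.2.rename ρ⟩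

theorem WRep.inst {n : ℕ} {m : Fin n → Mode} {M : Tm (n + 1)} {N : Tm n} {σ : RTy (n + 1)}
    {τ : RTy n} (hM : WRep Ψ (consMode .ord m) M σ) (hN : WRep Ψ m N τ) :
    WRep Ψ m (M.inst N) (RTy.inst τ σ) := by
  constructor
  · refine hM.1.fsub (fun x => ?_) fun x => ?_
    · refine Fin.cases hN.1 (fun j => .var j) x
    · refine Fin.cases (fun h => nomatch h) (fun j hj => ⟨j, rfl, hj⟩) x
  · refine hM.2.fsub hM.1.fo (fun x => ?_) fun x => ?_
    · refine Fin.cases hN.2 (fun j => .var j) x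
    · refine Fin.cases (fun h => nomatch h) (fun j hj => ⟨j, rfl⟩) x

theorem WRep.arr {n : ℕ} {m : Fin n → Mode} {M N : Tm n} {σ τ : RTy n}
    (hM : WRep Ψ m M σ) (hN : WRep Ψ m N τ) : WRep Ψ m (.cst kArr [M, N]) (.arr σ τ) :=
  ⟨.arr hM.1 hN.1, .arr hM.2 hN.2⟩

theorem WRep.muTm {n : ℕ} {m : Fin n → Mode} {M N : Tm (n + 1)} {σ τ : RTy (n + 1)}
    (hM : WRep Ψ (consMode .ord m) M σ) (hN : WRep Ψ (consMode .ord m) N τ) :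
    WRep Ψ m (.muTm M N) (.mu σ τ) := ⟨.mu hM.1 hN.1, .mu hM.2 hN.2⟩

theorem WRep.unrollTm {n : ℕ} {m : Fin n → Mode} {M N : Tm (n + 1)} {σ τ : RTy (n + 1)}
    (hM : WRep Ψ (consMode .ord m) M σ) (hN : WRep Ψ (consMode .ord m) N τ) :
    WRep Ψ m (.unrollTm M N) (RTy.unroll σ τ) :=
  .arr (hM.inst (hM.muTm hN)) (hN.inst (hM.muTm hN))

end

/-! # Terms of subtyping types -/

/-- The families `subtp` and `subtpinf`. -/
def subFam : Bool → ℕ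
  | false => kSubtp
  | true => kSubtpinf

/-- The type `subtp M N`, or `subtpinf M N`. -/
def Ty.sub {n : ℕ} (b : Bool) (M N : Tm n) : Ty n := .atom (subFam b) (.ofList [M, N])

/-- Well-formed terms of type `subtp σ τ` or, with `b = true`, of type `subtpinf σ τ`. -/
inductive WSub (Ψ : Sig) {n : ℕ} (m : Fin n → Mode) : Bool → Tm n → RTy n → RTy n → Prop
  | top {T : Tm n} {τ : RTy n} : WRep Ψ m T τ → WSub Ψ m false (.cst kSubtpTop [T]) τ .top
  | bot {T : Tm n} {τ : RTy n} : WRep Ψ m T τ → WSub Ψ m false (.cst kSubtpBot [T]) .bot τ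
  | refl {T : Tm n} {τ : RTy n} : WRep Ψ m T τ → WSub Ψ m false (.cst kRefl [T]) τ τ
  | trans {T₁ T₂ T₃ D E : Tm n} {τ₁ τ₂ τ₃ : RTy n} : WRep Ψ m T₁ τ₁ → WRep Ψ m T₂ τ₂ →
      WRep Ψ m T₃ τ₃ → WSub Ψ m false D τ₁ τ₂ → WSub Ψ m false E τ₂ τ₃ →
      WSub Ψ m false (.cst kTrans [T₁, T₂, T₃, D, E]) τ₁ τ₃
  | subtpArr {T₁ T₂ D : Tm n} {τ₁ τ₂ : RTy n} : WRep Ψ m T₁ τ₁ → WRep Ψ m T₂ τ₂ →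
      WSub Ψ m true D τ₁ τ₂ → WSub Ψ m false (.cst kSubtpArr [T₁, T₂, D]) τ₁ τ₂
  | unfold {M N : Tm (n + 1)} {a b : RTy (n + 1)} : WRep Ψ (consMode .ord m) M a →
      WRep Ψ (consMode .ord m) N b →
      WSub Ψ m false (.cst kUnfold [.lam M, .lam N]) (.mu a b) (.unroll a b)
  | fold {M N : Tm (n + 1)} {a b : RTy (n + 1)} : WRep Ψ (consMode .ord m) M a →
      WRep Ψ (consMode .ord m) N b →
      WSub Ψ m false (.cst kFold [.lam M, .lam N]) (.unroll a b) (.mu a b)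
  | infArr {T₁ S₁ S₂ T₂ D E : Tm n} {τ₁ σ₁ σ₂ τ₂ : RTy n} : WRep Ψ m T₁ τ₁ → WRep Ψ m S₁ σ₁ →
      WRep Ψ m S₂ σ₂ → WRep Ψ m T₂ τ₂ → WSub Ψ m false D τ₁ σ₁ → WSub Ψ m false E σ₂ τ₂ →
      WSub Ψ m true (.cst kInfArr [T₁, S₁, S₂, T₂, D, E]) (.arr σ₁ σ₂) (.arr τ₁ τ₂)
  | rc {b : Bool} {r k : ℕ} {T₁ T₂ : Tm k} {τ₁ τ₂ : RTy k} (f : Fin k → Fin n) :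
      Defd Ψ r (Ty.sub b T₁ T₂).close → (∀ x, m (f x) = .pre) → WRep Ψ (fun _ => .pre) T₁ τ₁ →
      WRep Ψ (fun _ => .pre) T₂ τ₂ →
      WSub Ψ m b (.neu (.rc r) (pv f .nil)) (τ₁.rename f) (τ₂.rename f)

theorem eqTy_sub_iff {Ψ : Sig} {n : ℕ} {b : Bool} {P : Ty n} {U₁ U₂ : Tm n} :
    EqTy Ψ P (.sub b U₁ U₂) ↔
      ∃ P₁ P₂, P = .sub b P₁ P₂ ∧ EqTm Ψ [] P₁ U₁ ∧ EqTm Ψ [] P₂ U₂ := by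
  constructor
  · intro h
    rw [Ty.sub, Spine.ofList, Spine.ofList, Spine.ofList] at h
    cases h with
    | atom h =>
      cases h with
      | app h1 h =>
        cases h with
        | app h2 h =>
          cases h
          exact ⟨_, _, rfl, h1, h2⟩
  · rintro ⟨P₁, P₂, rfl, h1, h2⟩
    exact .atom (.app h1 (.app h2 .nil))

theorem Ty.subtp_eq_sub {n : ℕ} {b : Bool} {X Y U V : Tm n} (h : Ty.subtp X Y = .sub b U V) :
    b = false ∧ X = U ∧ Y = V := by
  cases b with
  | true => cases h
  | false => cases h; exact ⟨rfl, rfl, rfl⟩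

theorem Ty.subtpinf_eq_sub {n : ℕ} {b : Bool} {X Y U V : Tm n} (h : Ty.subtpinf X Y = .sub b U V) :
    b = true ∧ X = U ∧ Y = V := by
  cases b with
  | false => cases h
  | true => cases h; exact ⟨rfl, rfl, rfl⟩

theorem Spine.eq_pair_of_rename {n k : ℕ} {f : Fin k → Fin n} {T : Spine k} {U V : Tm n}
    (h : T.rename f = .ofList [U, V]) :
    ∃ T₁ T₂, T = .ofList [T₁, T₂] ∧ T₁.rename f = U ∧ T₂.rename f = V := by
  rw [Spine.ofList, Spine.ofList, Spine.ofList] at h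
  cases T with
  | nil => cases h
  | papp x S => cases h
  | app T₁ S =>
    rw [Spine.rename, Spine.app.injEq] at h
    obtain ⟨h1, h⟩ := h
    cases S with
    | nil => cases h
    | papp x S => cases h
    | app T₂ S =>
      rw [Spine.rename, Spine.app.injEq] at h
      obtain ⟨h2, h⟩ := h
      obtain rfl := Spine.eq_nil_of_rename h
      exact ⟨T₁, T₂, rfl, h1, h2⟩

theorem ChkTy.sub_inv {L : List (Ty 0 × Tm 0)} {Ψ : Sig} {fwd : Prop} {n : ℕ} {Γ : Ctx n} {b : Bool}
    {U V : Tm n} (h : ChkTy (Sig.ext L) Ψ fwd Γ (.sub b U V)) :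
    ChkTm (Sig.ext L) Ψ fwd Γ U .tp ∧ ChkTm (Sig.ext L) Ψ fwd Γ V .tp := by
  rw [Ty.sub, Spine.ofList, Spine.ofList, Spine.ofList] at h
  cases h with
  | atom h1 h2 h3 =>
    rw [ext_fam] at h1
    have key : ∀ {K : Kd n} {K' : Kd n}, (K = .type ∨ K = .cotype) →
        ChkSpKd (Sig.ext L) Ψ fwd Γ (.app U (.app V .nil)) (.pi .ord .tp (.pi .ord .tp
          (K.rename (fun i => i.succ.succ)))) K' →
        ChkTm (Sig.ext L) Ψ fwd Γ U .tp ∧ ChkTm (Sig.ext L) Ψ fwd Γ V .tp := by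
      intro K K' hK h
      cases h with
      | app h4 h5 h6 =>
        rcases hK with rfl | rfl
        all_goals
          cases h5
          change ChkSpKd _ _ _ _ _ (.pi .ord .tp _) _ at h6
          cases h6 with
          | app h7 _ _ => exact ⟨h4, h7⟩
    rcases subSig_fam h1 with ⟨h, rfl⟩ | ⟨h, rfl⟩ | ⟨h, rfl⟩
    · cases b <;> cases h
    · exact key (.inl rfl) h2
    · exact key (.inr rfl) h2

section
variable {L : List (Ty 0 × Tm 0)} {Ψ : Sig} {fwd : Prop}

theorem Good.wRep (hΨ : Good Ψ) (hav : Avail (Sig.ext L) Ψ fwd = Defd Ψ) {n : ℕ}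
    {m : Fin n → Mode} {M : Tm n} (h : ChkTm (Sig.ext L) Ψ fwd (tpCtx m) M .tp) :
    ∃ σ, WRep Ψ m M σ := by
  have h := WTp.of_chkTm (fun r A h => hΨ.prepat_of_defd (by rwa [hav] at h)) h
  rw [hav] at h
  obtain ⟨σ, hσ⟩ := hΨ.exists_tpRep h
  exact ⟨σ, h, hσ⟩

/-- The declared type of a definition has been checked over the earlier declarations; opening its
abstractions shows both sides to be terms of type `tp`, and such terms represent recursive types. -/
theorem Good.wRep_of_chkTy (hΨ : Good Ψ) {r k : ℕ} {b : Bool} {T₁ T₂ : Tm k}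
    (h : Defd Ψ r (Ty.sub b T₁ T₂).close) :
    (∃ τ₁, WRep Ψ (fun _ => .pre) T₁ τ₁) ∧ ∃ τ₂, WRep Ψ (fun _ => .pre) T₂ τ₂ := by
  obtain ⟨M, hM⟩ := h
  obtain ⟨L, hL⟩ := hΨ.take_ext hM
  have h1 := hΨ.chkTy hM
  have inv : ∀ {k : ℕ} {A : Ty k}, ChkTy (Ψ.take r) Ψ False .nil A.close →
      ChkTy (Ψ.take r) Ψ False (preCtx k) A := by
    intro k
    induction k with
    | zero => exact fun h => h
    | succ k ih =>
      intro A h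
      have := ih (A := .pi .pre .tp A) h
      cases this with
      | pi _ h => exact h
  have h2 := inv h1
  rw [hL] at h2
  obtain ⟨h3, h4⟩ := h2.sub_inv
  have hav : ∀ s A, Avail (Sig.ext L) Ψ False s A → Defd Ψ s A := by
    rw [← hL]; exact fun s A => avail_take_false
  have h3 := (WTp.of_chkTm (fun s A h => hΨ.prepat_of_defd (hav s A h)) h3).mono hav
  have h4 := (WTp.of_chkTm (fun s A h => hΨ.prepat_of_defd (hav s A h)) h4).mono hav
  obtain ⟨τ₁, h5⟩ := hΨ.exists_tpRep h3
  obtain ⟨τ₂, h6⟩ := hΨ.exists_tpRep h4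
  exact ⟨⟨τ₁, h3, h5⟩, τ₂, h4, h6⟩

/-- The expected type is known only up to equality of terms. Soundness of equality shows that
synthesized and expected sides represent the same recursive types, so these serve as indices. -/
theorem WSub.of_chkTm_le (hΨ : Good Ψ) (hav : Avail (Sig.ext L) Ψ fwd = Defd Ψ) (N : ℕ) {n : ℕ}
    {m : Fin n → Mode} : ∀ {b : Bool} {M U₁ U₂ : Tm n} {σ τ : RTy n}, sizeOf M < N →
    ChkTm (Sig.ext L) Ψ fwd (tpCtx m) M (.sub b U₁ U₂) → TpRep Ψ U₁ σ → TpRep Ψ U₂ τ →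
    WSub Ψ m b M σ τ := by
  have hpre : ∀ r A, Avail (Sig.ext L) Ψ fwd r A → A.Prepat :=
    fun r A h => hΨ.prepat_of_defd (by rwa [hav] at h)
  induction N with
  | zero => intro b M U₁ U₂ σ τ hN; exact (Nat.not_lt_zero _ hN).elim
  | succ N ih =>
    intro b M U₁ U₂ σ τ hN h hU₁ hU₂
    rw [Ty.sub] at h
    cases h with
    | neu h1 h2 =>
      obtain ⟨P₁, P₂, rfl, e₁, e₂⟩ := eqTy_sub_iff.1 h2
      have eq₁ : ∀ {σ'}, TpRep Ψ P₁ σ' → σ' = σ := fun h => h.eq_of_bEq hU₁ e₁.bEq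
      have eq₂ : ∀ {τ'}, TpRep Ψ P₂ τ' → τ' = τ := fun h => h.eq_of_bEq hU₂ e₂.bEq
      cases h1 with
      | @var _ _ x _ _ h3 =>
        rw [tpCtx_get] at h3
        obtain ⟨-, h⟩ := chkSp_atom_iff.1 h3
        cases b <;> cases h
      | @rc _ r _ A M _ _ h3 h4 =>
        have hd : Avail (Sig.ext L) Ψ fwd r A := ⟨M, h3⟩
        obtain ⟨k, a, T, f, rfl, hf, rfl, h5⟩ := (chkSp_rc_iff (hpre r A hd)).1 h4
        rw [Ty.sub, Ty.atom.injEq] at h5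
        obtain ⟨rfl, h5⟩ := h5
        obtain ⟨T₁, T₂, rfl, rfl, rfl⟩ := Spine.eq_pair_of_rename h5.symm
        rw [hav] at hd
        obtain ⟨⟨τ₁, hτ₁⟩, τ₂, hτ₂⟩ := hΨ.wRep_of_chkTy hd
        obtain rfl := eq₁ (hτ₁.2.rename f)
        obtain rfl := eq₂ (hτ₂.2.rename f)
        exact .rc f hd hf hτ₁ hτ₂
      | con h3 h4 =>
        rw [ext_con, subSig_con] at h3
        have h5 := h4.target_eq
        cases h3
        case subtpTop =>
          obtain ⟨T, rfl, hT, h⟩ := chkSp_subtpTop_iff.1 h4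
          obtain ⟨rfl, rfl, rfl⟩ := Ty.subtp_eq_sub h.symm
          obtain ⟨τ', hT⟩ := hΨ.wRep hav hT
          obtain rfl := eq₁ hT.2
          obtain rfl := eq₂ .top
          exact .top hT
        case subtpBot =>
          obtain ⟨T, rfl, hT, h⟩ := chkSp_subtpBot_iff.1 h4
          obtain ⟨rfl, rfl, rfl⟩ := Ty.subtp_eq_sub h.symm
          obtain ⟨τ', hT⟩ := hΨ.wRep hav hT
          obtain rfl := eq₁ .bot
          obtain rfl := eq₂ hT.2
          exact .bot hT
        case refl =>
          obtain ⟨T, rfl, hT, h⟩ := chkSp_refl_iff.1 h4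
          obtain ⟨rfl, rfl, rfl⟩ := Ty.subtp_eq_sub h.symm
          obtain ⟨τ', hT⟩ := hΨ.wRep hav hT
          obtain rfl := eq₁ hT.2
          obtain rfl := eq₂ hT.2
          exact .refl hT
        case trans =>
          obtain ⟨T₁, T₂, T₃, D, E, rfl, hT₁, hT₂, hT₃, hD, hE, h⟩ := chkSp_trans_iff.1 h4
          obtain ⟨rfl, rfl, rfl⟩ := Ty.subtp_eq_sub h.symm
          obtain ⟨τ₁, hT₁⟩ := hΨ.wRep hav hT₁
          obtain ⟨τ₂, hT₂⟩ := hΨ.wRep hav hT₂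
          obtain ⟨τ₃, hT₃⟩ := hΨ.wRep hav hT₃
          obtain rfl := eq₁ hT₁.2
          obtain rfl := eq₂ hT₃.2
          simp only [Spine.ofList, Tm.neu.sizeOf_spec, Spine.app.sizeOf_spec] at hN
          exact .trans hT₁ hT₂ hT₃ (ih (b := false) (by omega) hD hT₁.2 hT₂.2)
            (ih (b := false) (by omega) hE hT₂.2 hT₃.2)
        case subtpArr =>
          obtain ⟨T₁, T₂, D, rfl, hT₁, hT₂, hD, h⟩ := chkSp_subtpArr_iff.1 h4
          obtain ⟨rfl, rfl, rfl⟩ := Ty.subtp_eq_sub h.symm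
          obtain ⟨τ₁, hT₁⟩ := hΨ.wRep hav hT₁
          obtain ⟨τ₂, hT₂⟩ := hΨ.wRep hav hT₂
          obtain rfl := eq₁ hT₁.2
          obtain rfl := eq₂ hT₂.2
          simp only [Spine.ofList, Tm.neu.sizeOf_spec, Spine.app.sizeOf_spec] at hN
          exact .subtpArr hT₁ hT₂ (ih (b := true) (by omega) hD hT₁.2 hT₂.2)
        case unfold =>
          obtain ⟨M, M', rfl, hM, hM', h⟩ := (chkSp_unfold_iff hpre).1 h4
          obtain ⟨rfl, rfl, rfl⟩ := Ty.subtp_eq_sub h.symm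
          rw [hav] at hM hM'
          obtain ⟨s, hs⟩ := hΨ.exists_tpRep hM
          obtain ⟨t, ht⟩ := hΨ.exists_tpRep hM'
          have hs : WRep Ψ (consMode .ord m) M s := ⟨hM, hs⟩
          have ht : WRep Ψ (consMode .ord m) M' t := ⟨hM', ht⟩
          obtain rfl := eq₁ (hs.muTm ht).2
          obtain rfl := eq₂ (hs.unrollTm ht).2
          exact .unfold hs ht
        case fold =>
          obtain ⟨M, M', rfl, hM, hM', h⟩ := (chkSp_fold_iff hpre).1 h4
          obtain ⟨rfl, rfl, rfl⟩ := Ty.subtp_eq_sub h.symm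
          rw [hav] at hM hM'
          obtain ⟨s, hs⟩ := hΨ.exists_tpRep hM
          obtain ⟨t, ht⟩ := hΨ.exists_tpRep hM'
          have hs : WRep Ψ (consMode .ord m) M s := ⟨hM, hs⟩
          have ht : WRep Ψ (consMode .ord m) M' t := ⟨hM', ht⟩
          obtain rfl := eq₂ (hs.muTm ht).2
          obtain rfl := eq₁ (hs.unrollTm ht).2
          exact .fold hs ht
        case infArr =>
          obtain ⟨T₁, S₁, S₂, T₂, D, E, rfl, hT₁, hS₁, hS₂, hT₂, hD, hE, h⟩ :=
            chkSp_infArr_iff.1 h4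
          obtain ⟨rfl, rfl, rfl⟩ := Ty.subtpinf_eq_sub h.symm
          obtain ⟨τ₁, hT₁⟩ := hΨ.wRep hav hT₁
          obtain ⟨σ₁, hS₁⟩ := hΨ.wRep hav hS₁
          obtain ⟨σ₂, hS₂⟩ := hΨ.wRep hav hS₂
          obtain ⟨τ₂, hT₂⟩ := hΨ.wRep hav hT₂
          obtain rfl := eq₁ (hS₁.arr hS₂).2
          obtain rfl := eq₂ (hT₁.arr hT₂).2
          simp only [Spine.ofList, Tm.neu.sizeOf_spec, Spine.app.sizeOf_spec] at hN
          exact .infArr hT₁ hS₁ hS₂ hT₂ (ih (b := false) (by omega) hD hT₁.2 hS₁.2)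
            (ih (b := false) (by omega) hE hS₂.2 hT₂.2)
        -- The remaining constructors target `tp`.
        all_goals cases b <;> cases h5

theorem WSub.of_chkTm (hΨ : Good Ψ) (hav : Avail (Sig.ext L) Ψ fwd = Defd Ψ) {n : ℕ}
    {m : Fin n → Mode} {b : Bool} {M U₁ U₂ : Tm n} {σ τ : RTy n}
    (h : ChkTm (Sig.ext L) Ψ fwd (tpCtx m) M (.sub b U₁ U₂)) (hU₁ : TpRep Ψ U₁ σ)
    (hU₂ : TpRep Ψ U₂ τ) : WSub Ψ m b M σ τ :=
  WSub.of_chkTm_le hΨ hav _ (Nat.lt_succ_self _) h hU₁ hU₂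

/-- Any representatives `U₁`, `U₂` may be used, because representations of the same recursive type
are provably equal (`EqTm.of_tpRep`). -/
theorem WSub.chkTm (hpre : ∀ r A, Defd Ψ r A → A.Prepat)
    (hav : Avail (Sig.ext L) Ψ fwd = Defd Ψ) {n : ℕ} {m : Fin n → Mode} {b : Bool} {M : Tm n}
    {σ τ : RTy n} (h : WSub Ψ m b M σ τ) : ∀ {U₁ U₂ : Tm n}, TpRep Ψ U₁ σ → TpRep Ψ U₂ τ →
    ChkTm (Sig.ext L) Ψ fwd (tpCtx m) M (.sub b U₁ U₂) := by
  rw [← hav] at hpre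
  have chk : ∀ {n : ℕ} {m : Fin n → Mode} {M : Tm n} {σ : RTy n}, WRep Ψ m M σ →
      ChkTm (Sig.ext L) Ψ fwd (tpCtx m) M .tp := fun h => WTp.chkTm (by rw [hav]; exact h.1)
  have con : ∀ {b : Bool} {c : ℕ} {A : Ty 0} {l : List (Tm n)} {P₁ P₂ U₁ U₂ : Tm n} {σ τ : RTy n},
      ConTy c A → ChkSp (Sig.ext L) Ψ fwd (tpCtx m) (.ofList l) A.ofClosed (.sub b P₁ P₂) →
      TpRep Ψ P₁ σ → TpRep Ψ P₂ τ → TpRep Ψ U₁ σ → TpRep Ψ U₂ τ →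
      ChkTm (Sig.ext L) Ψ fwd (tpCtx m) (.cst c l) (.sub b U₁ U₂) :=
    fun hc hs h1 h2 h3 h4 => .neu (.con (ext_con.2 (subSig_con.2 hc)) hs)
      (eqTy_sub_iff.2 ⟨_, _, rfl, .of_tpRep _ h1 h3 _, .of_tpRep _ h2 h4 _⟩)
  induction h with
  | top h =>
    exact con (b := false) .subtpTop (chkSp_subtpTop_iff.2 ⟨_, rfl, chk h, rfl⟩) h.2 .top
  | bot h =>
    exact con (b := false) .subtpBot (chkSp_subtpBot_iff.2 ⟨_, rfl, chk h, rfl⟩) .bot h.2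
  | refl h =>
    exact con (b := false) .refl (chkSp_refl_iff.2 ⟨_, rfl, chk h, rfl⟩) h.2 h.2
  | trans h1 h2 h3 _ _ ih1 ih2 =>
    exact con (b := false) .trans (chkSp_trans_iff.2 ⟨_, _, _, _, _, rfl, chk h1, chk h2, chk h3,
      ih1 h1.2 h2.2, ih2 h2.2 h3.2, rfl⟩) h1.2 h3.2
  | subtpArr h1 h2 _ ih =>
    exact con (b := false) .subtpArr (chkSp_subtpArr_iff.2 ⟨_, _, _, rfl, chk h1, chk h2,
      ih h1.2 h2.2, rfl⟩) h1.2 h2.2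
  | unfold h1 h2 =>
    exact con (b := false) .unfold ((chkSp_unfold_iff hpre).2 ⟨_, _, rfl, by rw [hav]; exact h1.1,
      by rw [hav]; exact h2.1, rfl⟩) (h1.muTm h2).2 (h1.unrollTm h2).2
  | fold h1 h2 =>
    exact con (b := false) .fold ((chkSp_fold_iff hpre).2 ⟨_, _, rfl, by rw [hav]; exact h1.1,
      by rw [hav]; exact h2.1, rfl⟩) (h1.unrollTm h2).2 (h1.muTm h2).2
  | infArr h1 h2 h3 h4 _ _ ih1 ih2 =>
    exact con (b := true) .infArr (chkSp_infArr_iff.2 ⟨_, _, _, _, _, _, rfl, chk h1, chk h2, chk h3,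
      chk h4, ih1 h1.2 h2.2, ih2 h3.2 h4.2, rfl⟩) (h2.arr h3).2 (h1.arr h4).2
  | rc f h1 h2 h3 h4 =>
    intro U₁ U₂ hU₁ hU₂
    rw [← hav] at h1
    obtain ⟨M, hM⟩ := h1
    exact .neu (.rc hM ((chkSp_close _ f _ _).2 ⟨h2, .nil⟩))
      (eqTy_sub_iff.2 ⟨_, _, rfl, .of_tpRep _ (h3.2.rename f) hU₁ _,
        .of_tpRep _ (h4.2.rename f) hU₂ _⟩)

end

theorem WSub.rename {Ψ : Sig} {n k : ℕ} {m : Fin n → Mode} {m' : Fin k → Mode} {b : Bool} {M : Tm n}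
    {σ τ : RTy n} {ρ : Fin n → Fin k} (hρ : ∀ x, m x = .pre → m' (ρ x) = .pre)
    (h : WSub Ψ m b M σ τ) : WSub Ψ m' b (M.rename ρ) (σ.rename ρ) (τ.rename ρ) := by
  induction h with
  | top h => exact .top (h.rename hρ)
  | bot h => exact .bot (h.rename hρ)
  | refl h => exact .refl (h.rename hρ)
  | trans h1 h2 h3 _ _ ih1 ih2 =>
    exact .trans (h1.rename hρ) (h2.rename hρ) (h3.rename hρ) ih1 ih2
  | subtpArr h1 h2 _ ih => exact .subtpArr (h1.rename hρ) (h2.rename hρ) ih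
  | unfold h1 h2 =>
    rw [RTy.rename_unroll]
    exact .unfold (h1.rename (consMode_liftRen hρ _)) (h2.rename (consMode_liftRen hρ _))
  | fold h1 h2 =>
    rw [RTy.rename_unroll]
    exact .fold (h1.rename (consMode_liftRen hρ _)) (h2.rename (consMode_liftRen hρ _))
  | infArr h1 h2 h3 h4 _ _ ih1 ih2 =>
    exact .infArr (h1.rename hρ) (h2.rename hρ) (h3.rename hρ) (h4.rename hρ) ih1 ih2
  | rc f h1 h2 h3 h4 =>
    simp only [Tm.rename, pv_rename, RTy.rename_rename]
    exact .rc _ h1 (fun x => hρ _ (h2 x)) h3 h4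

/-! # Validity of the signature -/

section
variable {Ξ Ψ : Sig} {fwd : Prop} {n : ℕ} {Γ : Ctx n}

theorem chkTy_tpFun (h : Ξ[kTp]? = some (.fam .type)) : ChkTy Ξ Ψ fwd Γ .tpFun :=
  .pi (chkTy_tp h) (chkTy_tp h)

theorem ChkTm.v_tp {x : Fin n} (h : (Γ.get x).2 = .tp) : ChkTm Ξ Ψ fwd Γ (.v x []) .tp :=
  .neu (.var (by rw [h]; exact .nil)) (.atom .nil)

theorem ChkTm.v_tpFun {x : Fin n} {M : Tm n} (h : (Γ.get x).2 = .tpFun)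
    (hM : ChkTm Ξ Ψ fwd Γ M .tp) : ChkTm Ξ Ψ fwd Γ (.v x [M]) .tp :=
  .neu (.var (by rw [h]; exact .app (B' := .tp) hM rfl .nil)) (.atom .nil)

theorem ChkTm.cst_tp {c : ℕ} (h : Ξ[c]? = some (.con .tp)) : ChkTm Ξ Ψ fwd Γ (.cst c []) .tp :=
  .neu (.con h .nil) (.atom .nil)

theorem ChkTm.cst_arr (h : Ξ[kArr]? = some (.con (.pi .ord .tp (.pi .ord .tp .tp)))) {M N : Tm n}
    (hM : ChkTm Ξ Ψ fwd Γ M .tp) (hN : ChkTm Ξ Ψ fwd Γ N .tp) :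
    ChkTm Ξ Ψ fwd Γ (.cst kArr [M, N]) .tp :=
  .neu (.con h (chkSp_arr_iff.2 ⟨M, N, rfl, hM, hN, rfl⟩)) (.atom .nil)

theorem ChkTm.muVar (h : Ξ[kMu]? = some (.con (.pi .ord .tpFun (.pi .ord .tpFun .tp))))
    {F G : Fin n} (hF : (Γ.get F).2 = .tpFun) (hG : (Γ.get G).2 = .tpFun) :
    ChkTm Ξ Ψ fwd Γ (.muVar F G) .tp := by
  have key : ∀ {F : Fin n}, (Γ.get F).2 = .tpFun →
      ChkTm Ξ Ψ fwd Γ (.lam (.v F.succ [.v 0 []])) .tpFun := fun {F} hF =>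
    .lam (.v_tpFun (by show (Γ.get F).2.rename Fin.succ = _; rw [hF]; rfl) (.v_tp rfl))
  exact .neu (.con h (chkSp_mu_iff.2 ⟨_, _, rfl, key hF, key hG, rfl⟩)) (.atom .nil)

theorem ChkTm.unrollVar (h : Ξ[kArr]? = some (.con (.pi .ord .tp (.pi .ord .tp .tp))))
    (h' : Ξ[kMu]? = some (.con (.pi .ord .tpFun (.pi .ord .tpFun .tp))))
    {F G : Fin n} (hF : (Γ.get F).2 = .tpFun) (hG : (Γ.get G).2 = .tpFun) :
    ChkTm Ξ Ψ fwd Γ (.unrollVar F G) .tp :=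
  .cst_arr h (.v_tpFun hF (.muVar h' hF hG)) (.v_tpFun hG (.muVar h' hF hG))

theorem chkTy_subtp (h : Ξ[kSubtp]? = some (.fam (.pi .ord .tp (.pi .ord .tp .type)))) {M N : Tm n}
    (hM : ChkTm Ξ Ψ fwd Γ M .tp) (hN : ChkTm Ξ Ψ fwd Γ N .tp) : ChkTy Ξ Ψ fwd Γ (.subtp M N) :=
  .atom h (.app (K' := .pi .ord .tp .type) hM rfl (.app (K' := .type) hN rfl .nil)) (.inl rfl)

theorem chkTy_subtpinf (h : Ξ[kSubtpinf]? = some (.fam (.pi .ord .tp (.pi .ord .tp .cotype))))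
    {M N : Tm n} (hM : ChkTm Ξ Ψ fwd Γ M .tp) (hN : ChkTm Ξ Ψ fwd Γ N .tp) :
    ChkTy Ξ Ψ fwd Γ (.subtpinf M N) :=
  .atom h (.app (K' := .pi .ord .tp .cotype) hM rfl (.app (K' := .cotype) hN rfl .nil)) (.inr rfl)

end

/-- The global signature is arbitrary because `subSig` contains no recursive definitions and
checking it unfolds none. -/
theorem localSig_subSig (Ψ : Sig) : LocalSig Ψ subSig := by
  have h1 : LocalSig Ψ (subSig.take 1) := .fam (Ξ := []) .nil .type
  have h2 : LocalSig Ψ (subSig.take 2) := .con h1 (chkTy_tp rfl)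
  have h3 : LocalSig Ψ (subSig.take 3) := .con h2 (chkTy_tp rfl)
  have h4 : LocalSig Ψ (subSig.take 4) :=
    .con h3 (.pi (chkTy_tp rfl) (.pi (chkTy_tp rfl) (chkTy_tp rfl)))
  have h5 : LocalSig Ψ (subSig.take 5) :=
    .con h4 (.pi (chkTy_tpFun rfl) (.pi (chkTy_tpFun rfl) (chkTy_tp rfl)))
  have h6 : LocalSig Ψ (subSig.take 6) :=
    .fam h5 (.pi (chkTy_tp rfl) (.pi (chkTy_tp rfl) .type))
  have h7 : LocalSig Ψ (subSig.take 7) :=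
    .fam h6 (.pi (chkTy_tp rfl) (.pi (chkTy_tp rfl) .cotype))
  have h8 : LocalSig Ψ (subSig.take 8) :=
    .con h7 (.pi (chkTy_tp rfl) (chkTy_subtp rfl (.v_tp rfl) (.cst_tp rfl)))
  have h9 : LocalSig Ψ (subSig.take 9) :=
    .con h8 (.pi (chkTy_tp rfl) (chkTy_subtp rfl (.cst_tp rfl) (.v_tp rfl)))
  have h10 : LocalSig Ψ (subSig.take 10) :=
    .con h9 (.pi (chkTy_tp rfl) (chkTy_subtp rfl (.v_tp rfl) (.v_tp rfl)))
  have h11 : LocalSig Ψ (subSig.take 11) :=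
    .con h10 (.pi (chkTy_tp rfl) (.pi (chkTy_tp rfl) (.pi (chkTy_tp rfl)
      (.pi (chkTy_subtp rfl (.v_tp rfl) (.v_tp rfl)) (.pi (chkTy_subtp rfl (.v_tp rfl) (.v_tp rfl))
        (chkTy_subtp rfl (.v_tp rfl) (.v_tp rfl)))))))
  have h12 : LocalSig Ψ (subSig.take 12) :=
    .con h11 (.pi (chkTy_tp rfl) (.pi (chkTy_tp rfl)
      (.pi (chkTy_subtpinf rfl (.v_tp rfl) (.v_tp rfl)) (chkTy_subtp rfl (.v_tp rfl) (.v_tp rfl)))))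
  have h13 : LocalSig Ψ (subSig.take 13) :=
    .con h12 (.pi (chkTy_tpFun rfl) (.pi (chkTy_tpFun rfl)
      (chkTy_subtp rfl (.muVar rfl rfl rfl) (.unrollVar rfl rfl rfl rfl))))
  have h14 : LocalSig Ψ (subSig.take 14) :=
    .con h13 (.pi (chkTy_tpFun rfl) (.pi (chkTy_tpFun rfl)
      (chkTy_subtp rfl (.unrollVar rfl rfl rfl rfl) (.muVar rfl rfl rfl))))
  exact .con h14 (.pi (chkTy_tp rfl) (.pi (chkTy_tp rfl) (.pi (chkTy_tp rfl) (.pi (chkTy_tp rfl)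
    (.pi (chkTy_subtp rfl (.v_tp rfl) (.v_tp rfl)) (.pi (chkTy_subtp rfl (.v_tp rfl) (.v_tp rfl))
      (chkTy_subtpinf rfl (.cst_arr rfl (.v_tp rfl) (.v_tp rfl))
        (.cst_arr rfl (.v_tp rfl) (.v_tp rfl)))))))))

theorem localSig_ext (Ψ : Sig) (L : List (Ty 0 × Tm 0)) : (∀ i A M, L[i]? = some (A, M) →
    ChkTy (Sig.ext (L.take i)) Ψ False .nil A ∧ A.Prepat ∧ M.Contra ∧ GuardTm Ψ (15 + i) ∅ ∅ M) →
    LocalSig Ψ (Sig.ext L) := by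
  induction L using List.reverseRecOn with
  | nil => exact fun _ => localSig_subSig Ψ
  | append_singleton L d ih =>
    intro h
    have h1 := h L.length d.1 d.2 (by simp)
    rw [List.take_left] at h1
    have : Sig.ext (L ++ [d]) = Sig.ext L ++ [.defn d.1 d.2] := by
      simp only [Sig.ext, List.map_append, List.map_cons, List.map_nil, List.append_assoc]
    rw [this]
    refine .defn (ih fun i A M hi => ?_) h1.1 h1.2.1 h1.2.2.1 ?_
    · have hlt : i < L.length := (List.getElem?_eq_some_iff.1 hi).1
      have h2 := h i A M (by rw [List.getElem?_append_left hlt]; exact hi)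
      rwa [List.take_append_of_le_length hlt.le] at h2
    · have : (Sig.ext L).length = 15 + L.length := by
        simp only [Sig.ext, List.length_append, List.length_map]; rfl
      rw [this]
      exact h1.2.2.2

theorem Sig.valid_ext {L : List (Ty 0 × Tm 0)}
    (hTy : ∀ i A M, L[i]? = some (A, M) → ChkTy (Sig.ext (L.take i)) (Sig.ext L) False .nil A ∧
      A.Prepat ∧ M.Contra ∧ M.Dfd (Sig.ext L))
    (hTm : ∀ i A M, L[i]? = some (A, M) →
      ChkTm (Sig.ext (L.take i)) (Sig.ext L) True .nil M A)
    (h : ∀ r, ¬ Relation.TransGen (Edge (Sig.ext L)) r r) : (Sig.ext L).Valid := by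
  refine ⟨localSig_ext _ L fun i A M hi => ?_, fun r A M hr => ?_⟩
  · obtain ⟨h1, h2, h3, -⟩ := hTy i A M hi
    refine ⟨h1, h2, h3, guardTm_of_acyclic (fun C => validTrace_iff.2) (fun r A M hr => ?_) h
      (A := A) (ext_defn.2 ⟨by omega, by rwa [Nat.add_sub_cancel_left]⟩)⟩
    exact (hTy _ A M (ext_defn.1 hr).2).2.2.2
  · obtain ⟨h1, h2⟩ := ext_defn.1 hr
    rw [take_ext h1]
    exact hTm _ _ _ h2

/-! # Canonical terms of type `tp` -/

theorem CTm.good {n : ℕ} {Γ : Ctx n} {A : Ty n} (M : CTm Γ A) : Good M.sig :=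
  Good.of_valid (L := M.defs) M.sig_valid

theorem Good.avail {Ψ : Sig} (hΨ : Good Ψ) {r : ℕ} {A : Ty 0} (h : Avail Ψ Ψ False r A) : A.Prepat := by
  rw [avail_self] at h
  exact hΨ.prepat_of_defd h

theorem CTm.wTp {n : ℕ} {m : Fin n → Mode} (M : CTm (tpCtx m) .tp) : WTp (Defd M.sig) m M.tm := by
  rw [← avail_self]
  exact WTp.of_chkTm (L := M.defs) (Ψ := M.sig) (fun r A h => M.good.avail h) M.typed

/-- The canonical term over the definitions of a canonical term. -/
def CTm.ofWTp {k : ℕ} {Γ : Ctx k} {A : Ty k} (M : CTm Γ A) {n : ℕ} {m : Fin n → Mode} (N : Tm n)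
    (h : WTp (Defd M.sig) m N) : CTm (tpCtx m) .tp where
  defs := M.defs
  tm := N
  sig_valid := M.sig_valid
  typed := WTp.chkTm (L := M.defs) (Ψ := M.sig) (by
    show WTp (Avail M.sig M.sig False) m N
    rwa [avail_self])

/-- The encoding of a recursive type as a canonical term. -/
def CTm.ofRTy {n : ℕ} (m : Fin n → Mode) (σ : RTy n) : CTm (tpCtx m) .tp where
  defs := []
  tm := σ.enc
  sig_valid := Sig.valid_ext (L := []) (fun i A M h => by simp at h) (fun i A M h => by simp at h)
    fun r h => by
      obtain ⟨b, ⟨A, M, hr, -⟩, -⟩ := Relation.TransGen.head'_iff.1 h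
      have := (ext_defn.1 hr).2
      simp at this
  typed := WTp.chkTm (L := []) (.enc _ _ _)

/-- Equality in the quotient becomes representation. Bijectivity and compositionality for `tp` are
then statements about `TpRep`. -/
theorem CTm.eq_ofRTy_iff {n : ℕ} {m : Fin n → Mode} {M : CTm (tpCtx m) .tp} {σ : RTy n} :
    (Quotient.mk (CTm.setoid (tpCtx m) .tp) (CTm.ofRTy m σ)) = Quotient.mk _ M ↔
      TpRep M.sig M.tm σ := by
  rw [Quotient.eq]
  constructor
  · intro h
    obtain ⟨τ, hτ⟩ := M.good.exists_tpRep M.wTp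
    have := TpRep.eq_of_bEq (.enc _ σ) hτ h
    rwa [this]
  · exact fun h => (h.bEq _).symm

theorem CTm.ofRTy_bijective {n : ℕ} (m : Fin n → Mode) : Function.Bijective fun σ : RTy n =>
    Quotient.mk (CTm.setoid (tpCtx m) .tp) (CTm.ofRTy m σ) := by
  constructor
  · intro σ τ h
    exact (CTm.eq_ofRTy_iff.1 h).unique (.enc _ τ)
  · intro q
    induction q using Quotient.inductionOn with
    | _ M =>
      obtain ⟨τ, hτ⟩ := M.good.exists_tpRep M.wTp
      exact ⟨τ, CTm.eq_ofRTy_iff.2 hτ⟩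

/-- The bijection between recursive types and canonical terms of type `tp`. -/
noncomputable def tpEquiv (n : ℕ) (m : Fin n → Mode) : RTy n ≃ Quotient (CTm.setoid (tpCtx m) .tp) :=
  Equiv.ofBijective _ (CTm.ofRTy_bijective m)

theorem tpEquiv_eq_iff {n : ℕ} {m : Fin n → Mode} {M : CTm (tpCtx m) .tp} {σ : RTy n} :
    tpEquiv n m σ = Quotient.mk _ M ↔ TpRep M.sig M.tm σ := CTm.eq_ofRTy_iff

/-- `finSuccEquiv' X` sends `X` to `none` and closes the gap among the other variables, as a
description of the replaced variable must. As `X` is ordinary, no prepattern argument is affected.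
-/
theorem tpEquiv_substAt {n : ℕ} {m : Fin (n + 1) → Mode} {X : Fin (n + 1)} {σ : RTy (n + 1)}
    {τ : RTy n} {M : CTm (tpCtx m) Ty.tp} {N : CTm (tpCtx fun i => m (X.succAbove i)) Ty.tp}
    (hX : m X = Mode.ord) (hMN : M.defs = N.defs) (hM : tpEquiv (n + 1) m σ = Quotient.mk _ M)
    (hN : tpEquiv n _ τ = Quotient.mk _ N) :
    ∃ L : CTm (tpCtx fun i => m (X.succAbove i)) Ty.tp, L.defs = M.defs ∧
      Tm.hsub STy.star (finSuccEquiv' X) N.tm M.tm = some L.tm ∧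
      tpEquiv n _ (RTy.substAt X τ σ) = Quotient.mk _ L := by
  have hs : N.sig = M.sig := by rw [CTm.sig, CTm.sig, hMN]
  rw [tpEquiv_eq_iff] at hM hN
  have hw := N.wTp
  rw [hs] at hN hw
  obtain ⟨H, S, hHS⟩ := hN.neu
  have hpre : ∀ x, m x = .pre → ∃ i, x = X.succAbove i := fun x hx => by
    rcases Fin.eq_self_or_eq_succAbove X x with rfl | h
    · rw [hX] at hx; cases hx
    · exact h
  have h1 := FO.hsub_star M.wTp.fo (χ := finSuccEquiv' X) (H := H) (S := S) fun x hx => by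
    obtain ⟨i, rfl⟩ := hpre x hx
    rw [finSuccEquiv'_succAbove]; exact Option.some_ne_none _
  rw [← hHS] at h1
  refine ⟨M.ofWTp _ (M.wTp.fsub (fun x => ?_) fun x hx => ?_), rfl, h1, ?_⟩
  · rcases Fin.eq_self_or_eq_succAbove X x with rfl | ⟨i, rfl⟩
    · rw [finSuccEquiv'_at]; exact hw
    · rw [finSuccEquiv'_succAbove]; exact .var i
  · obtain ⟨i, rfl⟩ := hpre x hx
    rw [finSuccEquiv'_succAbove]; exact ⟨i, rfl, hx⟩
  · refine tpEquiv_eq_iff.2 (hM.fsub M.wTp.fo (fun x => ?_) fun x hx => ?_)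
    · rcases Fin.eq_self_or_eq_succAbove X x with rfl | ⟨i, rfl⟩
      · rw [finSuccEquiv'_at, Fin.insertNth_apply_same]; exact hN
      · rw [finSuccEquiv'_succAbove, Fin.insertNth_apply_succAbove]; exact .var i
    · obtain ⟨i, rfl⟩ := hpre x hx
      rw [finSuccEquiv'_succAbove]; exact ⟨i, rfl⟩

theorem tpEquiv_rename {n n' : ℕ} {m : Fin n → Mode} {m' : Fin n' → Mode} {ρ : Fin n → Fin n'}
    {σ : RTy n} {M : CTm (tpCtx m) Ty.tp} (hρ : ∀ i, m i = Mode.pre → m' (ρ i) = Mode.pre)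
    (hM : tpEquiv n m σ = Quotient.mk _ M) :
    ∃ L : CTm (tpCtx m') Ty.tp, L.defs = M.defs ∧ L.tm = M.tm.rename ρ ∧
      tpEquiv n' m' (σ.rename ρ) = Quotient.mk _ L :=
  ⟨M.ofWTp _ (M.wTp.rename hρ), rfl, rfl, tpEquiv_eq_iff.2 ((tpEquiv_eq_iff.1 hM).rename ρ)⟩

/-! # Encodings of derivations -/

theorem BEq.refl (Ψ : Sig) {n : ℕ} (M : Tm n) : BEq Ψ Ψ M M := fun _ => rfl

theorem RTy.rename_id : ∀ {n : ℕ} (σ : RTy n), σ.rename (fun i => i) = σ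
  | _, .var _ => rfl
  | _, .bot => rfl
  | _, .top => rfl
  | _, .arr a b => by simp only [RTy.rename, RTy.rename_id a, RTy.rename_id b]
  | _, .mu a b => by simp only [RTy.rename, liftRen_id, RTy.rename_id a, RTy.rename_id b]

theorem RTy.enc_bEq (Ψ Ψ' : Sig) {n : ℕ} (σ : RTy n) : BEq Ψ Ψ' σ.enc σ.enc :=
  (TpRep.enc Ψ σ).bEq Ψ'

theorem RTy.not_occ_enc (s : ℕ) : ∀ {n : ℕ} (σ : RTy n), ¬ σ.enc.Occ s
  | _, .var _, h => h
  | _, .bot, h => h.2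
  | _, .top, h => h.2
  | _, .arr a b, h => by
      rcases h.2 with h | h | h
      · exact RTy.not_occ_enc s a h
      · exact RTy.not_occ_enc s b h
      · exact h
  | _, .mu a b, h => by
      rcases h.2 with h | h | h
      · exact RTy.not_occ_enc s a h
      · exact RTy.not_occ_enc s b h
      · exact h

theorem RTy.enc_dfd (Ψ : Sig) : ∀ {n : ℕ} (σ : RTy n), σ.enc.Dfd Ψ
  | _, .var _ => trivial
  | _, .bot => trivial
  | _, .top => trivial
  | _, .arr a b => ⟨RTy.enc_dfd Ψ a, RTy.enc_dfd Ψ b, trivial⟩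
  | _, .mu a b => ⟨RTy.enc_dfd Ψ a, RTy.enc_dfd Ψ b, trivial⟩

namespace Deriv

section
variable {n N : ℕ} {lhs rhs : Fin N → RTy n}

/-- The encoding of derivation trees, a reference becoming the term that `nm` assigns to it. -/
def encWith (nm : Fin N → Tm n) : {σ τ : RTy n} → Deriv lhs rhs σ τ → Tm n
  | _, _, .ref i => nm i
  | _, _, .bot τ => .cst kSubtpBot [τ.enc]
  | _, _, .top τ => .cst kSubtpTop [τ.enc]
  | _, _, .unfold a b _ => .cst kUnfold [.lam a.enc, .lam b.enc]
  | _, _, .fold a b _ => .cst kFold [.lam a.enc, .lam b.enc]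
  | _, _, .refl τ => .cst kRefl [τ.enc]
  | _, _, @Deriv.arr _ _ _ _ σ₁ σ₂ τ₁ τ₂ D E =>
      .cst kSubtpArr [(RTy.arr σ₁ σ₂).enc, (RTy.arr τ₁ τ₂).enc,
        .cst kInfArr [τ₁.enc, σ₁.enc, σ₂.enc, τ₂.enc, D.encWith nm, E.encWith nm]]
  | _, _, @Deriv.trans _ _ _ _ τ₁ τ₂ τ₃ D E =>
      .cst kTrans [τ₁.enc, τ₂.enc, τ₃.enc, D.encWith nm, E.encWith nm]

theorem enc_eq_encWith {σ τ : RTy n} (D : Deriv lhs rhs σ τ) :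
    D.enc = D.encWith fun i => .neu (.rc (15 + i)) (pv (fun j => j) .nil) := by
  induction D with
  | ref i => rw [enc, encWith, allVars_eq]; rfl
  | arr D E ihD ihE => rw [enc, encWith, ihD, ihE]
  | trans D E ihD ihE => rw [enc, encWith, ihD, ihE]
  | _ => rfl

/-- A renamed encoding need not be an encoding, since its references carry the tuple `ρ` instead of
all variables. This is one reason for letting the names vary in `encWith`. -/
theorem enc_rename {m : ℕ} (ρ : Fin n → Fin m) {σ τ : RTy n} (D : Deriv lhs rhs σ τ) :
    D.enc.rename ρ = (D.rename ρ).encWith fun i => .neu (.rc (15 + i)) (pv ρ .nil) := by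
  induction D with
  | ref i => rw [enc, rename, encWith, allVars_eq, Tm.rename, pv_rename]; rfl
  | arr D E ihD ihE =>
    simp only [rename, encWith, RTy.enc, RTy.enc_rename, ← ihD, ← ihE]; rfl
  | trans D E ihD ihE =>
    simp only [rename, encWith, RTy.enc_rename, ← ihD, ← ihE]; rfl
  | _ => simp only [rename, encWith, RTy.enc_rename]; rfl

theorem enc_dfd {Ψ : Sig} (hΨ : ∀ i : Fin N, ∃ A M, Ψ[15 + (i : ℕ)]? = some (.defn A M)) {σ τ : RTy n}
    (D : Deriv lhs rhs σ τ) : D.enc.Dfd Ψ := by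
  induction D with
  | ref i => exact ⟨by rw [allVars_eq]; exact pv_prepat _ .nil, hΨ i⟩
  | bot τ => exact ⟨τ.enc_dfd Ψ, trivial⟩
  | top τ => exact ⟨τ.enc_dfd Ψ, trivial⟩
  | refl τ => exact ⟨τ.enc_dfd Ψ, trivial⟩
  | unfold a b _ => exact ⟨a.enc_dfd Ψ, b.enc_dfd Ψ, trivial⟩
  | fold a b _ => exact ⟨a.enc_dfd Ψ, b.enc_dfd Ψ, trivial⟩
  | arr D E ihD ihE =>
    exact ⟨RTy.enc_dfd Ψ _, RTy.enc_dfd Ψ _, ⟨RTy.enc_dfd Ψ _, RTy.enc_dfd Ψ _, RTy.enc_dfd Ψ _,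
      RTy.enc_dfd Ψ _, ihD, ihE, trivial⟩, trivial⟩
  | trans D E ihD ihE =>
    exact ⟨RTy.enc_dfd Ψ _, RTy.enc_dfd Ψ _, RTy.enc_dfd Ψ _, ihD, ihE, trivial⟩

/-- Occurrence stops at `inf/arr` just where exposure stops at (arr), and encoded types mention no
recursion constant. -/
theorem exposes_of_occ {s : ℕ} {σ τ : RTy n} (D : Deriv lhs rhs σ τ) (h : D.enc.Occ s) :
    ∃ j : Fin N, s = 15 + j ∧ D.Exposes j := by
  induction D with
  | ref i => exact ⟨i, h, rfl⟩
  | trans D E ihD ihE =>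
    rcases h.2 with h | h | h | h | h | h
    · exact (RTy.not_occ_enc _ _ h).elim
    · exact (RTy.not_occ_enc _ _ h).elim
    · exact (RTy.not_occ_enc _ _ h).elim
    · obtain ⟨j, hj, h⟩ := ihD h; exact ⟨j, hj, .inl h⟩
    · obtain ⟨j, hj, h⟩ := ihE h; exact ⟨j, hj, .inr h⟩
    · exact h.elim
  | arr D E ihD ihE =>
    rcases h.2 with h | h | h | h
    · exact (RTy.not_occ_enc _ _ h).elim
    · exact (RTy.not_occ_enc _ _ h).elim
    · exact (h.1 rfl).elim
    · exact h.elim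
  | unfold a b _ =>
    rcases h.2 with h | h | h
    · exact (RTy.not_occ_enc _ a h).elim
    · exact (RTy.not_occ_enc _ b h).elim
    · exact h.elim
  | fold a b _ =>
    rcases h.2 with h | h | h
    · exact (RTy.not_occ_enc _ a h).elim
    · exact (RTy.not_occ_enc _ b h).elim
    · exact h.elim
  | _ =>
    rcases h.2 with h | h
    · exact (RTy.not_occ_enc _ _ h).elim
    · exact h.elim

theorem enc_contra {σ τ : RTy n} {D : Deriv lhs rhs σ τ} (h : ¬ D.IsRef) : D.enc.Contra := by
  cases D with
  | ref i => exact (h trivial).elim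
  | _ => exact .con

theorem enc_neu {σ τ : RTy n} (D : Deriv lhs rhs σ τ) : ∃ H S, D.enc = .neu H S := by
  cases D <;> exact ⟨_, _, rfl⟩

theorem enc_wSub {Ψ : Sig}
    (hΨ : ∀ i : Fin N, Defd Ψ (15 + i) (Ty.subtp (lhs i).enc (rhs i).enc).close) {σ τ : RTy n}
    (D : Deriv lhs rhs σ τ) : WSub Ψ (fun _ => .pre) false D.enc σ τ := by
  induction D with
  | ref i =>
    have := WSub.rc (m := fun _ : Fin n => Mode.pre) (b := false) (fun j => j) (hΨ i)
      (fun _ => rfl) (.enc _ _ _) (.enc _ _ _)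
    rw [RTy.rename_id, RTy.rename_id] at this
    rw [enc, allVars_eq]
    exact this
  | bot τ => exact .bot (.enc _ _ _)
  | top τ => exact .top (.enc _ _ _)
  | refl τ => exact .refl (.enc _ _ _)
  | unfold a b h => subst h; exact .unfold (.enc _ _ _) (.enc _ _ _)
  | fold a b h => subst h; exact .fold (.enc _ _ _) (.enc _ _ _)
  | trans D E ihD ihE => exact .trans (.enc _ _ _) (.enc _ _ _) (.enc _ _ _) ihD ihE
  | arr D E ihD ihE =>
    exact .subtpArr (.enc _ _ _) (.enc _ _ _) (.infArr (.enc _ _ _) (.enc _ _ _) (.enc _ _ _)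
      (.enc _ _ _) ihD ihE)

/-- Terms that solve the same system of definitions are equal. -/
theorem encWith_bEq {Ψ Ψ' : Sig} {nm nm' : Fin N → Tm n}
    {body : (i : Fin N) → Deriv lhs rhs (lhs i) (rhs i)} (hb : ∀ i, ¬ (body i).IsRef)
    (h : ∀ i, BEq Ψ Ψ (nm i) ((body i).encWith nm))
    (h' : ∀ i, BEq Ψ' Ψ' (nm' i) ((body i).encWith nm')) {σ τ : RTy n} (D : Deriv lhs rhs σ τ) :
    BEq Ψ Ψ' (D.encWith nm) (D.encWith nm') := by
  intro k
  induction k using Nat.strong_induction_on generalizing σ τ with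
  | _ k ih =>
    -- A derivation that ends in a rule spends depth before its premises are reached. A reference is
    -- first replaced, at the same depth, by its body, which ends in a rule.
    have step : ∀ {σ τ : RTy n} (D : Deriv lhs rhs σ τ), ¬ D.IsRef →
        expTm Ψ k (D.encWith nm) = expTm Ψ' k (D.encWith nm') := by
      intro σ τ D hD
      cases k with
      | zero => rfl
      | succ k =>
        cases D with
        | ref i => exact (hD trivial).elim
        | trans D E =>
          exact expTm_cst_congr _ _ _ _ (.cons (RTy.enc_bEq _ _ _ _) (.cons (RTy.enc_bEq _ _ _ _)
            (.cons (RTy.enc_bEq _ _ _ _) (.cons (ih k (Nat.lt_succ_self k) D)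
              (.cons (ih k (Nat.lt_succ_self k) E) .nil)))))
        | arr D E =>
          refine expTm_cst_congr _ _ _ _ (.cons (RTy.enc_bEq _ _ _ _)
            (.cons (RTy.enc_bEq _ _ _ _) (.cons ?_ .nil)))
          cases k with
          | zero => rfl
          | succ k =>
            exact expTm_cst_congr _ _ _ _ (.cons (RTy.enc_bEq _ _ _ _)
              (.cons (RTy.enc_bEq _ _ _ _) (.cons (RTy.enc_bEq _ _ _ _)
                (.cons (RTy.enc_bEq _ _ _ _) (.cons (ih k (by omega) D)
                  (.cons (ih k (by omega) E) .nil))))))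
        | unfold a b _ =>
          exact expTm_cst_congr _ _ _ _ (.cons (BEq.lam_iff.2 (RTy.enc_bEq _ _ _) _)
            (.cons (BEq.lam_iff.2 (RTy.enc_bEq _ _ _) _) .nil))
        | fold a b _ =>
          exact expTm_cst_congr _ _ _ _ (.cons (BEq.lam_iff.2 (RTy.enc_bEq _ _ _) _)
            (.cons (BEq.lam_iff.2 (RTy.enc_bEq _ _ _) _) .nil))
        | _ => exact expTm_cst_congr _ _ _ _ (.cons (RTy.enc_bEq _ _ _ _) .nil)
    by_cases hD : D.IsRef
    · cases D with
      | ref i => exact (h i k).trans ((step _ (hb i)).trans (h' i k).symm)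
      | _ => exact hD.elim
    · exact step D hD

theorem not_isRef_resolve {body : (i : Fin N) → Deriv lhs rhs (lhs i) (rhs i)}
    (hb : ∀ i, ¬ (body i).IsRef) {σ τ : RTy n} (D : Deriv lhs rhs σ τ) :
    ¬ (D.resolve body).IsRef := by
  cases D with
  | ref i => exact hb i
  | _ => exact id

end

-- Unfoldings of derivations against Böhm trees of their encodings.

section
variable {n N N' : ℕ} {lhs rhs : Fin N → RTy n} {lhs' rhs' : Fin N' → RTy n}

/-- The head constructor determines the last rule, and the explicit type arguments determine the
conclusions of the rule and of its premises. An (arr) is read from two nested constructors, and the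
inner one already shows all four types. -/
theorem layer_eq_of_bEq {Ψ Ψ' : Sig} {f : {σ τ : RTy n} → Deriv lhs rhs σ τ → DTree n}
    {g : {σ τ : RTy n} → Deriv lhs' rhs' σ τ → DTree n}
    (hfg : ∀ {σ τ σ' τ' : RTy n} (D : Deriv lhs rhs σ τ) (E : Deriv lhs' rhs' σ' τ'),
      BEq Ψ Ψ' D.enc E.enc → f D = g E)
    {σ τ σ' τ' : RTy n} {D : Deriv lhs rhs σ τ} {E : Deriv lhs' rhs' σ' τ'} (hD : ¬ D.IsRef)
    (hE : ¬ E.IsRef) (h : BEq Ψ Ψ' D.enc E.enc) : D.layer f = E.layer g := by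
  have inj : ∀ {k : ℕ} {a b : RTy k}, BEq Ψ Ψ' a.enc b.enc → a = b := fun h => RTy.enc_injective h
  have injLam : ∀ {k : ℕ} {a b : RTy (k + 1)}, BEq Ψ Ψ' (.lam a.enc) (.lam b.enc) → a = b :=
    fun h => RTy.enc_injective (BEq.lam_iff.1 h)
  cases D <;> cases E
  case bot.bot | top.top | refl.refl =>
    obtain ⟨-, _ | ⟨h1, -⟩⟩ := BEq.cst_iff.1 h
    obtain rfl := inj h1
    rfl
  case unfold.unfold h1 _ _ h2 | fold.fold h1 _ _ h2 =>
    obtain ⟨-, _ | ⟨h3, _ | ⟨h4, -⟩⟩⟩ := BEq.cst_iff.1 h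
    obtain rfl := injLam h3
    obtain rfl := injLam h4
    subst h1 h2
    rfl
  case trans.trans =>
    obtain ⟨-, _ | ⟨h1, _ | ⟨h2, _ | ⟨h3, _ | ⟨h4, _ | ⟨h5, -⟩⟩⟩⟩⟩⟩ := BEq.cst_iff.1 h
    obtain rfl := inj h1
    obtain rfl := inj h2
    obtain rfl := inj h3
    simp only [layer, hfg _ _ h4, hfg _ _ h5]
  case arr.arr =>
    obtain ⟨-, _ | ⟨-, _ | ⟨-, _ | ⟨h, -⟩⟩⟩⟩ := BEq.cst_iff.1 h
    obtain ⟨-, _ | ⟨h1, _ | ⟨h2, _ | ⟨h3, _ | ⟨h4, _ | ⟨h5, _ | ⟨h6, -⟩⟩⟩⟩⟩⟩⟩ := BEq.cst_iff.1 h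
    obtain rfl := inj h1
    obtain rfl := inj h2
    obtain rfl := inj h3
    obtain rfl := inj h4
    simp only [layer, hfg _ _ h5, hfg _ _ h6]
  all_goals first
    | exact (hD trivial).elim
    | exact (hE trivial).elim
    | exact absurd (BEq.cst_iff.1 h).1 (by decide)

/-- A node of an unfolding shows only its own conclusion, whereas the constructor of (trans) also
carries the middle type. That type is recovered from the conclusions of the premises, which is why
`hfg` yields equality of judgments and why agreement is assumed at all depths `K`. -/
theorem expTm_eq_of_layer {Ψ Ψ' : Sig} {k : ℕ}
    {f : ℕ → {σ τ : RTy n} → Deriv lhs rhs σ τ → DTree n}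
    {g : ℕ → {σ τ : RTy n} → Deriv lhs' rhs' σ τ → DTree n}
    (hfg : ∀ {σ τ σ' τ' : RTy n} (D : Deriv lhs rhs σ τ) (E : Deriv lhs' rhs' σ' τ'),
      (∀ K, f K D = g K E) → σ = σ' ∧ τ = τ' ∧ ∀ j ≤ k, expTm Ψ j D.enc = expTm Ψ' j E.enc)
    {σ τ σ' τ' : RTy n} {D : Deriv lhs rhs σ τ} {E : Deriv lhs' rhs' σ' τ'} (hD : ¬ D.IsRef)
    (hE : ¬ E.IsRef) (h : ∀ K, D.layer (f K) = E.layer (g K)) :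
    expTm Ψ (k + 1) D.enc = expTm Ψ' (k + 1) E.enc := by
  cases D <;> cases E
  case bot.bot | top.top | refl.refl =>
    cases h 0
    exact expTm_cst_congr _ _ _ _ (.cons (RTy.enc_bEq _ _ _ _) .nil)
  case unfold.unfold | fold.fold =>
    have h0 := DTree.ax.inj (h 0)
    first
      | obtain ⟨rfl, rfl⟩ := RTy.mu.inj h0.2.1
      | obtain ⟨rfl, rfl⟩ := RTy.mu.inj h0.2.2
    exact expTm_cst_congr _ _ _ _ (.cons (BEq.lam_iff.2 (RTy.enc_bEq _ _ _) _)
      (.cons (BEq.lam_iff.2 (RTy.enc_bEq _ _ _) _) .nil))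
  case trans.trans D₁ D₂ _ E₁ E₂ =>
    obtain ⟨rfl, rfl, h1⟩ := hfg D₁ E₁ fun K => (DTree.trans.inj (h K)).2.2.1
    obtain ⟨-, rfl, h2⟩ := hfg D₂ E₂ fun K => (DTree.trans.inj (h K)).2.2.2
    exact expTm_cst_congr _ _ _ _ (.cons (RTy.enc_bEq _ _ _ _) (.cons (RTy.enc_bEq _ _ _ _)
      (.cons (RTy.enc_bEq _ _ _ _) (.cons (h1 k le_rfl) (.cons (h2 k le_rfl) .nil)))))
  case arr.arr D₁ D₂ _ _ _ _ E₁ E₂ =>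
    obtain ⟨rfl, rfl, h1⟩ := hfg D₁ E₁ fun K => (DTree.arr.inj (h K)).2.2.1
    obtain ⟨rfl, rfl, h2⟩ := hfg D₂ E₂ fun K => (DTree.arr.inj (h K)).2.2.2
    refine expTm_cst_congr _ _ _ _ (.cons (RTy.enc_bEq _ _ _ _)
      (.cons (RTy.enc_bEq _ _ _ _) (.cons ?_ .nil)))
    cases k with
    | zero => rfl
    | succ k =>
      exact expTm_cst_congr _ _ _ _ (.cons (RTy.enc_bEq _ _ _ _)
        (.cons (RTy.enc_bEq _ _ _ _) (.cons (RTy.enc_bEq _ _ _ _)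
          (.cons (RTy.enc_bEq _ _ _ _) (.cons (h1 k (Nat.le_succ k))
            (.cons (h2 k (Nat.le_succ k)) .nil))))))
  all_goals first
    | exact (hD trivial).elim
    | exact (hE trivial).elim
    | cases h 0

end

end Deriv

/-- The conclusion at the root. -/
def DTree.concl {n : ℕ} : DTree n → Option (RTy n × RTy n)
  | .cut => none
  | .ax _ σ τ => some (σ, τ)
  | .arr σ τ _ _ => some (σ, τ)
  | .trans σ τ _ _ => some (σ, τ)

theorem Deriv.concl_layer {n N : ℕ} {lhs rhs : Fin N → RTy n}
    {f : {σ τ : RTy n} → Deriv lhs rhs σ τ → DTree n} {σ τ : RTy n} {D : Deriv lhs rhs σ τ}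
    (hD : ¬ D.IsRef) : (D.layer f).concl = some (σ, τ) := by
  cases D with
  | ref i => exact (hD trivial).elim
  | _ => rfl

/-! # Canonical terms of type `subtp` -/

namespace CycDeriv

variable {n : ℕ} {σ τ : RTy n} (D : CycDeriv σ τ)

/-- The signature over which a cyclic derivation is encoded. -/
def sig : Sig := Sig.ext D.encDefs

theorem getElem?_encDefs {i : ℕ} {A : Ty 0} {M : Tm 0} : D.encDefs[i]? = some (A, M) ↔
    ∃ j : Fin D.N, i = j ∧ A = (Ty.subtp (D.lhs j).enc (D.rhs j).enc).close ∧
      M = (D.body j).enc.close := by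
  rw [encDefs, List.getElem?_ofFn]
  constructor
  · intro h
    split at h
    · next hi => cases h; exact ⟨⟨i, hi⟩, rfl, rfl, rfl⟩
    · cases h
  · rintro ⟨j, rfl, rfl, rfl⟩
    rw [dif_pos j.2]

theorem sig_defn {r : ℕ} {A : Ty 0} {M : Tm 0} : D.sig[r]? = some (.defn A M) ↔
    ∃ j : Fin D.N, r = 15 + j ∧ A = (Ty.subtp (D.lhs j).enc (D.rhs j).enc).close ∧
      M = (D.body j).enc.close := by
  rw [sig, ext_defn, getElem?_encDefs]
  constructor
  · rintro ⟨h, j, hj, h'⟩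
    exact ⟨j, by omega, h'⟩
  · rintro ⟨j, rfl, h'⟩
    exact ⟨by omega, j, by omega, h'⟩

theorem defd (j : Fin D.N) :
    Defd D.sig (15 + j) (Ty.subtp (D.lhs j).enc (D.rhs j).enc).close :=
  ⟨_, D.sig_defn.2 ⟨j, rfl, rfl, rfl⟩⟩

theorem prepat_of_defd {r : ℕ} {A : Ty 0} (h : Defd D.sig r A) : A.Prepat := by
  obtain ⟨M, h⟩ := h
  obtain ⟨j, -, rfl, -⟩ := D.sig_defn.1 h
  exact prepat_close .atom

theorem wSub {a b : RTy n} (X : Deriv D.lhs D.rhs a b) :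
    WSub D.sig (fun _ => .pre) false X.enc a b := X.enc_wSub D.defd

/-- Each edge comes from an exposed reference with indices shifted by 15, so a cycle of edges would
be a cycle of references avoiding (arr). -/
theorem acyclic (r : ℕ) : ¬ Relation.TransGen (Edge D.sig) r r := by
  have step : ∀ {r s : ℕ}, Edge D.sig r s →
      ∃ i j : Fin D.N, r = 15 + i ∧ s = 15 + j ∧ (D.body i).Exposes j := by
    rintro r s ⟨A, M, h, h'⟩
    obtain ⟨i, rfl, rfl, rfl⟩ := D.sig_defn.1 h
    obtain ⟨j, rfl, hj⟩ := (D.body i).exposes_of_occ ((Tm.occ_close s).1 h')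
    exact ⟨i, j, rfl, rfl, hj⟩
  have key : ∀ {r s : ℕ}, Relation.TransGen (Edge D.sig) r s → ∃ i j : Fin D.N, r = 15 + i ∧
      s = 15 + j ∧ Relation.TransGen (fun i j => (D.body i).Exposes j) i j := by
    intro r s h
    induction h with
    | single h =>
      obtain ⟨i, j, h1, h2, h3⟩ := step h
      exact ⟨i, j, h1, h2, .single h3⟩
    | tail _ h ih =>
      obtain ⟨i, j, h1, h2, h3⟩ := ih
      obtain ⟨j', k, h4, h5, h6⟩ := step h
      obtain rfl : j = j' := Fin.ext (by omega)
      exact ⟨i, k, h1, h5, h3.tail h6⟩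
  intro h
  obtain ⟨i, j, h1, h2, h3⟩ := key h
  obtain rfl : i = j := Fin.ext (by omega)
  exact D.valid i h3

theorem sig_valid : D.sig.Valid := by
  refine Sig.valid_ext (fun i A M h => ?_) (fun i A M h => ?_) D.acyclic
  · obtain ⟨j, rfl, rfl, rfl⟩ := D.getElem?_encDefs.1 h
    refine ⟨?_, prepat_close .atom, contra_close.2 (Deriv.enc_contra (D.body_rule j)),
      (Tm.dfd_close _).2 (Deriv.enc_dfd (fun i => ⟨_, D.defd i⟩) _)⟩
    exact chkTy_close (ext_fam.2 rfl) (chkTy_subtp (ext_fam.2 rfl) (WTp.chkTm (.enc _ _ _))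
      (WTp.chkTm (.enc _ _ _)))
  · obtain ⟨j, rfl, rfl, rfl⟩ := D.getElem?_encDefs.1 h
    have hav := avail_take_true (Ψ := D.sig) (15 + j)
    rw [sig, take_ext (by omega), Nat.add_sub_cancel_left] at hav
    exact chkTm_close.2 ⟨_, rfl, WSub.chkTm (b := false) (fun _ _ => D.prepat_of_defd) hav
      (D.wSub (D.body j)) (.enc _ _) (.enc _ _)⟩

/-- The encoding of a cyclic derivation as a canonical term. -/
def toCTm : CTm (preCtx n) (subtpEnc σ τ) where
  defs := D.encDefs
  tm := D.main.enc
  sig_valid := D.sig_valid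
  typed := WSub.chkTm (b := false) (L := D.encDefs) (Ψ := D.sig) (fun _ _ => D.prepat_of_defd)
    avail_self (D.wSub D.main) (.enc _ _) (.enc _ _)

theorem bEq_ref {m : ℕ} (ρ : Fin n → Fin m) (i : Fin D.N) :
    BEq D.sig D.sig (.neu (.rc (15 + i)) (pv ρ .nil)) ((D.body i).enc.rename ρ) :=
  expTm_body rfl (D.sig_defn.2 ⟨i, rfl, rfl, rfl⟩) (Deriv.enc_neu _)
    (Deriv.enc_contra (D.body_rule i)) ρ

theorem bEq_name (i : Fin D.N) : BEq D.sig D.sig (.neu (.rc (15 + i)) (pv (fun j => j) .nil))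
    ((D.body i).encWith fun i => .neu (.rc (15 + i)) (pv (fun j => j) .nil)) := by
  have := D.bEq_ref (fun j => j) i
  rwa [Tm.rename_id, Deriv.enc_eq_encWith] at this

theorem bEq_resolve {a b : RTy n} (X : Deriv D.lhs D.rhs a b) :
    BEq D.sig D.sig X.enc (X.resolve D.body).enc := by
  cases X with
  | ref i =>
    rw [Deriv.enc_eq_encWith, Deriv.enc_eq_encWith]
    exact D.bEq_name i
  | _ => exact .refl _ _

/-- The encoding of derivations is determined by the system of definitions. -/
theorem bEq_encWith {Ψ : Sig} {nm : Fin D.N → Tm n}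
    (h : ∀ i, BEq Ψ Ψ (nm i) ((D.body i).encWith nm)) {a b : RTy n} (X : Deriv D.lhs D.rhs a b) :
    BEq D.sig Ψ X.enc (X.encWith nm) := by
  rw [Deriv.enc_eq_encWith]
  exact Deriv.encWith_bEq D.body_rule D.bEq_name h X

variable {σ' τ' : RTy n} (E : CycDeriv σ' τ')

theorem unf_eq_of_bEq (k : ℕ) : ∀ {a b a' b' : RTy n} (X : Deriv D.lhs D.rhs a b)
    (Y : Deriv E.lhs E.rhs a' b'), BEq D.sig E.sig X.enc Y.enc → X.unf D.body k = Y.unf E.body k := by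
  induction k with
  | zero => exact fun _ _ _ => rfl
  | succ k ih =>
    intro a b a' b' X Y h
    exact Deriv.layer_eq_of_bEq ih (Deriv.not_isRef_resolve D.body_rule X)
      (Deriv.not_isRef_resolve E.body_rule Y)
      (((D.bEq_resolve X).symm.trans h).trans (E.bEq_resolve Y))

theorem bEq_of_unf_eq {a b a' b' : RTy n} (X : Deriv D.lhs D.rhs a b) (Y : Deriv E.lhs E.rhs a' b')
    (h : ∀ K, X.unf D.body K = Y.unf E.body K) : BEq D.sig E.sig X.enc Y.enc := by
  intro k
  induction k using Nat.strong_induction_on generalizing a b a' b' with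
  | _ k ih =>
    cases k with
    | zero => rfl
    | succ k =>
      rw [D.bEq_resolve X, E.bEq_resolve Y]
      refine Deriv.expTm_eq_of_layer (f := fun K => Deriv.unf D.body K)
        (g := fun K => Deriv.unf E.body K) (fun {s t s' t'} X Y h => ?_)
        (Deriv.not_isRef_resolve D.body_rule X) (Deriv.not_isRef_resolve E.body_rule Y)
        fun K => h (K + 1)
      -- Depth one is the first at which the root, and so the conclusion, is visible.
      have h1 := congrArg DTree.concl (h 1)
      simp only [Deriv.unf] at h1
      rw [Deriv.concl_layer (Deriv.not_isRef_resolve D.body_rule X),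
        Deriv.concl_layer (Deriv.not_isRef_resolve E.body_rule Y)] at h1
      cases h1
      exact ⟨rfl, rfl, fun j hj => ih j (Nat.lt_succ_of_le hj) X Y h⟩

end CycDeriv

/-! # Every canonical term of type `subtp` encodes a cyclic derivation -/

theorem pv_injective {n : ℕ} : ∀ {k : ℕ} {f g : Fin k → Fin n} {S T : Spine n},
    pv f S = pv g T → f = g ∧ S = T
  | 0, _, _, _, _, h => ⟨funext fun i => i.elim0, h⟩
  | k + 1, f, g, S, T, h => by
      obtain ⟨h1, h2⟩ := pv_injective (k := k) h
      obtain ⟨h3, rfl⟩ := Spine.papp.inj h2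
      refine ⟨funext fun i => Fin.cases h3 (fun j => congrFun h1 j) i, rfl⟩

section
variable {Ψ : Sig} {n : ℕ} {m : Fin n → Mode}

theorem WSub.neu {b : Bool} {M : Tm n} {σ τ : RTy n} (h : WSub Ψ m b M σ τ) :
    ∃ H S, M = .neu H S := by
  cases h <;> exact ⟨_, _, rfl⟩

theorem WSub.rc_inv {b : Bool} {r : ℕ} {S : Spine n} {σ τ : RTy n}
    (h : WSub Ψ m b (.neu (.rc r) S) σ τ) :
    ∃ (k : ℕ) (f : Fin k → Fin n) (T₁ T₂ : Tm k) (τ₁ τ₂ : RTy k),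
      Defd Ψ r (Ty.sub b T₁ T₂).close ∧ (∀ x, m (f x) = .pre) ∧ TpRep Ψ T₁ τ₁ ∧ TpRep Ψ T₂ τ₂ ∧
      S = pv f .nil ∧ σ = τ₁.rename f ∧ τ = τ₂.rename f := by
  generalize hM : Tm.neu (.rc r) S = M at h
  cases h with
  | rc f h1 h2 h3 h4 =>
    obtain ⟨h5, h6⟩ := Tm.neu.inj hM
    cases h5
    exact ⟨_, f, _, _, _, _, h1, h2, h3.2, h4.2, h6, rfl, rfl⟩
  | _ => cases hM

/-- The declared type fixes the number of parameters and, with the argument tuple, the judgment. So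
an applied recursion constant can serve as the name of a single judgment. -/
theorem WSub.rc_unique {b b' : Bool} {r : ℕ} {S : Spine n} {σ τ σ' τ' : RTy n}
    (h : WSub Ψ m b (.neu (.rc r) S) σ τ) (h' : WSub Ψ m b' (.neu (.rc r) S) σ' τ') :
    σ = σ' ∧ τ = τ' := by
  obtain ⟨k, f, T₁, T₂, τ₁, τ₂, ⟨M, hM⟩, -, h1, h2, rfl, rfl, rfl⟩ := h.rc_inv
  obtain ⟨k', f', T₁', T₂', τ₁', τ₂', ⟨M', hM'⟩, -, h1', h2', hS, rfl, rfl⟩ := h'.rc_inv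
  have e : (Ty.sub b T₁ T₂).close = (Ty.sub b' T₁' T₂').close := by
    rw [hM] at hM'
    exact (Decl.defn.inj (Option.some.inj hM')).1
  obtain rfl := Ty.close_atom_scope e
  obtain ⟨rfl, -⟩ := pv_injective hS
  have e := (Ty.atom.inj (Ty.close_injective e)).2
  simp only [Spine.ofList, Spine.app.injEq, and_true] at e
  obtain ⟨rfl, rfl⟩ := e
  rw [h1.unique h1', h2.unique h2']
  exact ⟨rfl, rfl⟩

/-- A recursion constant of subtyping type is equal to the body of its definition. -/
theorem Good.exists_body (hΨ : Good Ψ) {b : Bool} {r : ℕ} {S : Spine n} {σ τ : RTy n}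
    (h : WSub Ψ m b (.neu (.rc r) S) σ τ) : ∃ B : Tm n, WSub Ψ m b B σ τ ∧ B.Contra ∧
      BEq Ψ Ψ (.neu (.rc r) S) B ∧ ∀ s, B.Occ s → Edge Ψ r s := by
  obtain ⟨k, f, T₁, T₂, τ₁, τ₂, ⟨M, hM⟩, hf, h1, h2, rfl, rfl, rfl⟩ := h.rc_inv
  obtain ⟨B, rfl, hc, hB⟩ := hΨ.body hM
  obtain ⟨L, hL⟩ := hΨ.take_ext hM
  have hav := avail_take_true (Ψ := Ψ) r
  rw [hL] at hB hav
  have hW := WSub.of_chkTm hΨ hav hB h1 h2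
  exact ⟨B.rename f, hW.rename fun x _ => hf x, hc.rename f, expTm_body rfl hM hW.neu hc f,
    fun s hs => ⟨_, _, hM, (Tm.occ_close s).2 ((Tm.occ_rename s f B).1 hs)⟩⟩

/-- There are finitely many constants, each with a fixed number of parameters, and every argument is
one of `n` variables. -/
theorem finite_rc_wSub (Ψ : Sig) (m : Fin n → Mode) (b : Bool) : Set.Finite {M : Tm n |
    ∃ r S σ τ, M = .neu (.rc r) S ∧ WSub Ψ m b M σ τ} := by
  have key : ∀ r : ℕ, Set.Finite {M : Tm n | ∃ (k : ℕ) (T₁ T₂ : Tm k) (f : Fin k → Fin n),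
      Defd Ψ r (Ty.sub b T₁ T₂).close ∧ M = .neu (.rc r) (pv f .nil)} := by
    intro r
    by_cases hr : ∃ (k : ℕ) (T₁ T₂ : Tm k), Defd Ψ r (Ty.sub b T₁ T₂).close
    · obtain ⟨k, T₁, T₂, M, hM⟩ := hr
      refine (Set.finite_range fun f : Fin k → Fin n => Tm.neu (.rc r) (pv f .nil)).subset ?_
      rintro _ ⟨k', T₁', T₂', f, ⟨M', hM'⟩, rfl⟩
      rw [hM] at hM'
      obtain rfl := Ty.close_atom_scope (Decl.defn.inj (Option.some.inj hM')).1
      exact ⟨f, rfl⟩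
    · refine Set.finite_empty.subset ?_
      rintro _ ⟨k, T₁, T₂, f, h, -⟩
      exact hr ⟨k, T₁, T₂, h⟩
  refine ((Finset.range Ψ.length).finite_toSet.biUnion fun r _ => key r).subset ?_
  rintro _ ⟨r, S, σ, τ, rfl, h⟩
  obtain ⟨k, f, T₁, T₂, τ₁, τ₂, hd, -, -, -, rfl, -, -⟩ := h.rc_inv
  refine Set.mem_biUnion (x := r) ?_ ⟨k, T₁, T₂, f, hd, rfl⟩
  obtain ⟨M, hM⟩ := hd
  exact Finset.mem_coe.2 (Finset.mem_range.2 (List.getElem?_eq_some_iff.1 hM).1)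

/-- A term of type `subtpinf σ τ` is turned into one of type `subtp σ τ`. -/
def Tm.toSubtp (b : Bool) (M : Tm n) (σ τ : RTy n) : Tm n :=
  match b with
  | false => M
  | true => .cst kSubtpArr [σ.enc, τ.enc, M]

theorem BEq.toSubtp {M M' : Tm n} (h : BEq Ψ Ψ M M') (b : Bool) (σ τ : RTy n) :
    BEq Ψ Ψ (M.toSubtp b σ τ) (M'.toSubtp b σ τ) := by
  cases b with
  | false => exact h
  | true => exact BEq.cst_iff.2 ⟨rfl, .cons (.refl _ _) (.cons (.refl _ _) (.cons h .nil))⟩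

theorem WRep.bEq_enc {T : Tm n} {σ : RTy n} (h : WRep Ψ m T σ) : BEq Ψ Ψ T σ.enc := h.2.bEq Ψ

-- Reading derivations off terms.

section
variable {N : ℕ} {lhs rhs : Fin N → RTy n} {nm : Fin N → Tm n} {hd : Fin N → ℕ}

/-- `hnm` names every well-typed application of a recursion constant. A `subtpinf` term is
translated with its enclosing `subtp/arr` supplied by `toSubtp`, so `subtp/arr` itself adds no rule.
Consequently `subtp/arr` applied to a recursion constant yields a mere reference, the exception
allowed for in the second clause. -/
theorem WSub.exists_deriv
    (hnm : ∀ {b : Bool} {r : ℕ} {S : Spine n} {σ τ : RTy n}, WSub Ψ m b (.neu (.rc r) S) σ τ →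
      ∃ i, lhs i = σ ∧ rhs i = τ ∧ nm i = Tm.toSubtp b (.neu (.rc r) S) σ τ ∧ hd i = r)
    {b : Bool} {M : Tm n} {σ τ : RTy n} (h : WSub Ψ m b M σ τ) :
    ∃ D : Deriv lhs rhs σ τ, BEq Ψ Ψ (M.toSubtp b σ τ) (D.encWith nm) ∧
      (D.IsRef → ∃ r S, M = .neu (.rc r) S ∨
        (b = false ∧ ∃ T₁ T₂, M = .cst kSubtpArr [T₁, T₂, .neu (.rc r) S])) ∧
      ∀ i, D.Exposes i → M.Occ (hd i) := by
  induction h with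
  | top h =>
    exact ⟨.top _, BEq.cst_iff.2 ⟨rfl, .cons h.bEq_enc .nil⟩, False.elim, fun _ => False.elim⟩
  | bot h =>
    exact ⟨.bot _, BEq.cst_iff.2 ⟨rfl, .cons h.bEq_enc .nil⟩, False.elim, fun _ => False.elim⟩
  | refl h =>
    exact ⟨.refl _, BEq.cst_iff.2 ⟨rfl, .cons h.bEq_enc .nil⟩, False.elim, fun _ => False.elim⟩
  | unfold h1 h2 =>
    exact ⟨.unfold _ _ rfl, BEq.cst_iff.2 ⟨rfl, .cons (BEq.lam_iff.2 h1.bEq_enc)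
      (.cons (BEq.lam_iff.2 h2.bEq_enc) .nil)⟩, False.elim, fun _ => False.elim⟩
  | fold h1 h2 =>
    exact ⟨.fold _ _ rfl, BEq.cst_iff.2 ⟨rfl, .cons (BEq.lam_iff.2 h1.bEq_enc)
      (.cons (BEq.lam_iff.2 h2.bEq_enc) .nil)⟩, False.elim, fun _ => False.elim⟩
  | trans h1 h2 h3 _ _ ihD ihE =>
    obtain ⟨D, hD, -, hD'⟩ := ihD
    obtain ⟨E, hE, -, hE'⟩ := ihE
    refine ⟨.trans D E, BEq.cst_iff.2 ⟨rfl, .cons h1.bEq_enc (.cons h2.bEq_enc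
      (.cons h3.bEq_enc (.cons hD (.cons hE .nil))))⟩, False.elim, ?_⟩
    rintro i (hi | hi)
    · exact ⟨by decide, .inr (.inr (.inr (.inl (hD' i hi))))⟩
    · exact ⟨by decide, .inr (.inr (.inr (.inr (.inl (hE' i hi)))))⟩
  | subtpArr h1 h2 _ ih =>
    obtain ⟨D, hD, hr, hD'⟩ := ih
    refine ⟨D, BEq.trans (BEq.cst_iff.2 ⟨rfl, .cons h1.bEq_enc (.cons h2.bEq_enc
      (.cons (.refl _ _) .nil))⟩) hD, fun h => ?_, fun i hi => ⟨by decide, .inr (.inr (.inl (hD' i hi)))⟩⟩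
    obtain ⟨r, S, rfl | ⟨h, -⟩⟩ := hr h
    · exact ⟨r, S, .inr ⟨rfl, _, _, rfl⟩⟩
    · cases h
  | infArr h1 h2 h3 h4 _ _ ihD ihE =>
    obtain ⟨D, hD, -, -⟩ := ihD
    obtain ⟨E, hE, -, -⟩ := ihE
    exact ⟨.arr D E, BEq.cst_iff.2 ⟨rfl, .cons (.refl _ _) (.cons (.refl _ _) (.cons
      (BEq.cst_iff.2 ⟨rfl, .cons h1.bEq_enc (.cons h2.bEq_enc (.cons h3.bEq_enc
        (.cons h4.bEq_enc (.cons hD (.cons hE .nil)))))⟩) .nil))⟩, False.elim,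
      fun _ => False.elim⟩
  | rc f h1 h2 h3 h4 =>
    obtain ⟨i, e1, e2, e3, e4⟩ := hnm (.rc f h1 h2 h3 h4)
    rw [← e1, ← e2] at e3 ⊢
    refine ⟨.ref i, ?_, fun _ => ⟨_, _, .inl rfl⟩, ?_⟩
    · rw [← e3]; exact .refl _ _
    · rintro j rfl; exact e4

/-- Terms that are no recursion constants give rise to derivations that end in a rule. -/
theorem WSub.exists_deriv_of_contra (hΨ : Good Ψ)
    (hnm : ∀ {b : Bool} {r : ℕ} {S : Spine n} {σ τ : RTy n}, WSub Ψ m b (.neu (.rc r) S) σ τ →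
      ∃ i, lhs i = σ ∧ rhs i = τ ∧ nm i = Tm.toSubtp b (.neu (.rc r) S) σ τ ∧ hd i = r)
    {b : Bool} {M : Tm n} {σ τ : RTy n} (h : WSub Ψ m b M σ τ) (hM : M.Contra) :
    ∃ D : Deriv lhs rhs σ τ, BEq Ψ Ψ (M.toSubtp b σ τ) (D.encWith nm) ∧ ¬ D.IsRef ∧
      ∀ i, D.Exposes i → M.Occ (hd i) := by
  obtain ⟨D, hD, hr, hD'⟩ := h.exists_deriv hnm
  by_cases hR : D.IsRef
  swap
  · exact ⟨D, hD, hR, hD'⟩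
  obtain ⟨r, S, rfl | ⟨rfl, T₁, T₂, rfl⟩⟩ := hr hR
  · cases hM
  · cases h with
    | subtpArr h1 h2 h3 =>
      -- The term is `subtp/arr` applied to a recursion constant. One unfolding exposes a
      -- contractive body of type `subtpinf`, which can only be an application of `inf/arr`; the
      -- derivation then ends in (arr) and exposes no name.
      obtain ⟨B, hB, hBc, hBeq, -⟩ := hΨ.exists_body h3
      obtain ⟨E, hE, hr, hE'⟩ := hB.exists_deriv hnm
      refine ⟨E, ?_, fun hR => ?_, fun i hi => ?_⟩
      · exact (BEq.trans (BEq.cst_iff.2 ⟨rfl, .cons h1.bEq_enc (.cons h2.bEq_enc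
          (.cons (.refl _ _) .nil))⟩) (hBeq.toSubtp true σ τ)).trans hE
      · obtain ⟨r, S, rfl | ⟨h, -⟩⟩ := hr hR
        · cases hBc
        · cases h
      · have := hE' i hi
        cases hB with
        | infArr => exact (this.1 rfl).elim
        | rc => cases hBc

end

end

theorem CTm.wSub {n : ℕ} {σ τ : RTy n} (M : CTm (preCtx n) (subtpEnc σ τ)) :
    WSub M.sig (fun _ => .pre) false M.tm σ τ :=
  WSub.of_chkTm (L := M.defs) (Ψ := M.sig) M.good avail_self M.typed (.enc _ _) (.enc _ _)

theorem CTm.exists_cycDeriv {n : ℕ} {σ τ : RTy n} (M : CTm (preCtx n) (subtpEnc σ τ)) :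
    ∃ D : CycDeriv σ τ, BEq D.sig M.sig D.main.enc M.tm := by
  have hΨ := M.good
  set Ψ := M.sig with hsig
  -- One name for each well-typed application, not for each constant: a named derivation has no
  -- parameters, so different argument tuples need different names. The flag separates `subtp` from
  -- `subtpinf`.
  let Name := {p : Bool × Tm n // ∃ r S σ τ, p.2 = .neu (.rc r) S ∧
    WSub Ψ (fun _ => .pre) p.1 p.2 σ τ}
  have : Finite Name := by
    refine Set.Finite.to_subtype (s := {p : Bool × Tm n | ∃ r S σ τ, p.2 = .neu (.rc r) S ∧
      WSub Ψ (fun _ => .pre) p.1 p.2 σ τ}) ?_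
    refine (Set.finite_iUnion fun b => (finite_rc_wSub Ψ (fun _ : Fin n => Mode.pre) b).image
      (Prod.mk b)).subset ?_
    rintro ⟨b, M⟩ h
    exact Set.mem_iUnion.2 ⟨b, M, h, rfl⟩
  let eqv : Name ≃ Fin (Nat.card Name) := Finite.equivFin Name
  choose hd S lhs rhs hN hW using fun i => (eqv.symm i).2
  have hW' : ∀ i, WSub Ψ (fun _ => .pre) (eqv.symm i).1.1 (.neu (.rc (hd i)) (S i)) (lhs i)
      (rhs i) := fun i => by rw [← hN i]; exact hW i
  let nm : Fin (Nat.card Name) → Tm n := fun i =>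
    Tm.toSubtp (eqv.symm i).1.1 (.neu (.rc (hd i)) (S i)) (lhs i) (rhs i)
  have hnm : ∀ {b : Bool} {r : ℕ} {S : Spine n} {σ τ : RTy n},
      WSub Ψ (fun _ => .pre) b (.neu (.rc r) S) σ τ →
      ∃ i, lhs i = σ ∧ rhs i = τ ∧ nm i = Tm.toSubtp b (.neu (.rc r) S) σ τ ∧ hd i = r := by
    intro b r T σ τ h
    obtain ⟨i, hi⟩ := eqv.symm.surjective ⟨(b, .neu (.rc r) T), r, T, σ, τ, rfl, h⟩
    have h1 := hN i
    have h2 := hW' i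
    rw [hi] at h1
    obtain ⟨h3, rfl⟩ := Tm.neu.inj h1
    obtain rfl := Head.rc.inj h3
    -- The judgment chosen for the name is the given one, as an applied constant has only one.
    obtain ⟨h4, h5⟩ := h2.rc_unique h
    refine ⟨i, h4, h5, ?_, rfl⟩
    simp only [nm, hi, h4, h5]
  choose B hB hBc hBeq hBocc using fun i => hΨ.exists_body (hW' i)
  choose body hbody hrule hexp using fun i => (hB i).exists_deriv_of_contra hΨ hnm (hBc i)
  obtain ⟨main, hmain, -, -⟩ := M.wSub.exists_deriv hnm
  -- Forgetting the arguments maps exposed references to edges, so a cycle of names would give a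
  -- cycle in the graph of the signature.
  have hpath : ∀ {i j}, Relation.TransGen (fun i j => (body i).Exposes j) i j →
      Relation.TransGen (Edge Ψ) (hd i) (hd j) :=
    fun h => Relation.TransGen.lift hd (fun i j h => hBocc i _ (hexp i j h)) _ _ h
  let D : CycDeriv σ τ :=
    ⟨_, lhs, rhs, body, main, hrule, fun i h => hΨ.acyclic _ (hpath h)⟩
  -- The original applications `nm` satisfy the defining equations of `D` over `Ψ`, so by uniqueness
  -- of solutions the encoding of `D` has the same trees.
  exact ⟨D, (D.bEq_encWith (nm := nm) (fun i => ((hBeq i).toSubtp _ _ _).trans (hbody i))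
    main).trans hmain.symm⟩

/-! # The bijection between cyclic derivations and canonical terms -/

theorem CycDeriv.toCTm_bijective {n : ℕ} (σ τ : RTy n) : Function.Bijective
    (Quotient.map CycDeriv.toCTm fun D E h => D.bEq_of_unf_eq E D.main E.main h :
      Quotient (CycDeriv.setoid σ τ) → Quotient (CTm.setoid (preCtx n) (subtpEnc σ τ))) := by
  constructor
  · intro p q
    induction p, q using Quotient.inductionOn₂ with
    | _ D E =>
      intro h
      have h : BEq D.sig E.sig D.main.enc E.main.enc := Quotient.exact h
      exact Quotient.sound fun k => D.unf_eq_of_bEq E k D.main E.main h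
  · intro q
    induction q using Quotient.inductionOn with
    | _ M =>
      obtain ⟨D, hD⟩ := M.exists_cycDeriv
      exact ⟨Quotient.mk _ D, Quotient.sound hD⟩

/-- The bijection between valid cyclic derivations and canonical terms of type `subtp`. -/
noncomputable def subtpEquiv (n : ℕ) (σ τ : RTy n) :
    Quotient (CycDeriv.setoid σ τ) ≃ Quotient (CTm.setoid (preCtx n) (subtpEnc σ τ)) :=
  Equiv.ofBijective _ (CycDeriv.toCTm_bijective σ τ)

theorem subtpEquiv_eq_iff {n : ℕ} {σ τ : RTy n} {D : CycDeriv σ τ}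
    {M : CTm (preCtx n) (subtpEnc σ τ)} :
    subtpEquiv n σ τ (Quotient.mk _ D) = Quotient.mk _ M ↔ BEq D.sig M.sig D.main.enc M.tm :=
  Quotient.eq (r := CTm.setoid (preCtx n) (subtpEnc σ τ)) (x := D.toCTm)

theorem subtpEquiv_rename {n n' : ℕ} (ρ : Fin n → Fin n') {σ τ : RTy n} {D : CycDeriv σ τ}
    {M : CTm (preCtx n) (subtpEnc σ τ)}
    (h : subtpEquiv n σ τ (Quotient.mk _ D) = Quotient.mk _ M) :
    ∃ L : CTm (preCtx n') (subtpEnc (σ.rename ρ) (τ.rename ρ)), L.defs = M.defs ∧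
      L.tm = M.tm.rename ρ ∧
      subtpEquiv n' (σ.rename ρ) (τ.rename ρ) (Quotient.mk _ (D.rename ρ)) = Quotient.mk _ L := by
  rw [subtpEquiv_eq_iff] at h
  refine ⟨⟨M.defs, M.tm.rename ρ, M.sig_valid, WSub.chkTm (b := false) (L := M.defs) (Ψ := M.sig)
    (fun _ _ => M.good.prepat_of_defd) avail_self (M.wSub.rename fun _ _ => rfl) (.enc _ _)
    (.enc _ _)⟩, rfl, rfl, subtpEquiv_eq_iff.2 ?_⟩
  -- The old constants applied to `ρ` solve the renamed system, so the encoding of the renamed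
  -- derivation agrees with the renamed encoding although the definitions differ.
  have h1 := (D.rename ρ).bEq_encWith (Ψ := D.sig) (nm := fun i => .neu (.rc (15 + i)) (pv ρ .nil))
    (fun i => (D.bEq_ref ρ i).trans (by rw [Deriv.enc_rename]; exact .refl _ _)) (D.main.rename ρ)
  have h2 : BEq (D.rename ρ).sig D.sig (D.rename ρ).main.enc (D.main.enc.rename ρ) := by
    rw [Deriv.enc_rename]
    exact h1
  exact h2.trans (h.rename ρ)

end CoLF

theorem theorem6 :
    -- (1) recursive types and canonical terms of type `tp`
    (∃ e : (n : ℕ) → (m : Fin n → Mode) → (RTy n ≃ Quotient (CTm.setoid (tpCtx m) Ty.tp)),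
      -- the bijection is the encoding
      (∀ (n : ℕ) (m : Fin n → Mode) (σ : RTy n), ∃ M : CTm (tpCtx m) Ty.tp,
        M.defs = [] ∧ M.tm = σ.enc ∧ e n m σ = Quotient.mk _ M) ∧
      -- it commutes with substitution for ordinary variables
      (∀ (n : ℕ) (m : Fin (n + 1) → Mode) (X : Fin (n + 1)) (σ : RTy (n + 1)) (τ : RTy n)
        (M : CTm (tpCtx m) Ty.tp) (N : CTm (tpCtx fun i => m (X.succAbove i)) Ty.tp),
        m X = Mode.ord → M.defs = N.defs →
        e (n + 1) m σ = Quotient.mk _ M → e n _ τ = Quotient.mk _ N →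
        ∃ L : CTm (tpCtx fun i => m (X.succAbove i)) Ty.tp, L.defs = M.defs ∧
          Tm.hsub STy.star (finSuccEquiv' X) N.tm M.tm = some L.tm ∧
          e n _ (RTy.substAt X τ σ) = Quotient.mk _ L) ∧
      -- it commutes with renaming substitutions
      (∀ (n n' : ℕ) (m : Fin n → Mode) (m' : Fin n' → Mode) (ρ : Fin n → Fin n') (σ : RTy n)
        (M : CTm (tpCtx m) Ty.tp),
        (∀ i, m i = Mode.pre → m' (ρ i) = Mode.pre) → e n m σ = Quotient.mk _ M →
        ∃ L : CTm (tpCtx m') Ty.tp, L.defs = M.defs ∧ L.tm = M.tm.rename ρ ∧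
          e n' m' (σ.rename ρ) = Quotient.mk _ L)) ∧
    -- (2) valid cyclic derivations of `σ ≤ τ` and canonical terms of type `subtp ⌜σ⌝ ⌜τ⌝`
    (∃ e : (n : ℕ) → (σ τ : RTy n) →
        (Quotient (CycDeriv.setoid σ τ) ≃ Quotient (CTm.setoid (preCtx n) (subtpEnc σ τ))),
      -- the bijection is the encoding
      (∀ (n : ℕ) (σ τ : RTy n) (D : CycDeriv σ τ), ∃ M : CTm (preCtx n) (subtpEnc σ τ),
        M.defs = D.encDefs ∧ M.tm = D.main.enc ∧ e n σ τ (Quotient.mk _ D) = Quotient.mk _ M) ∧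
      -- it commutes with renaming substitutions
      (∀ (n n' : ℕ) (ρ : Fin n → Fin n') (σ τ : RTy n) (D : CycDeriv σ τ)
        (M : CTm (preCtx n) (subtpEnc σ τ)), e n σ τ (Quotient.mk _ D) = Quotient.mk _ M →
        ∃ L : CTm (preCtx n') (subtpEnc (σ.rename ρ) (τ.rename ρ)), L.defs = M.defs ∧
          L.tm = M.tm.rename ρ ∧
          e n' (σ.rename ρ) (τ.rename ρ) (Quotient.mk _ (D.rename ρ)) = Quotient.mk _ L)) := by
  refine ⟨⟨tpEquiv, fun n m σ => ⟨CTm.ofRTy m σ, rfl, rfl, rfl⟩,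
    fun n m X σ τ M N hX hMN hM hN => tpEquiv_substAt hX hMN hM hN,
    fun n n' m m' ρ σ M hρ hM => tpEquiv_rename hρ hM⟩,
    ⟨subtpEquiv, fun n σ τ D => ⟨D.toCTm, rfl, rfl, rfl⟩,
      fun n n' ρ σ τ D M h => subtpEquiv_rename ρ h⟩⟩
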